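/- Let $G$ be a finite group. Fix a set $\hat G$ of representatives of the irreducible unitary representations of $G$ up to unitary equivalence, containing the trivial representation $\mathbf 1$ on $\mathbb C$; write $H_\pi$ for the space of $\pi\in\hat G$. For $\pi,\rho,\sigma\in\hat G$ let $(\sigma,\pi\otimes\rho)$ be the space of intertwiners $T:H_\sigma\to H_\pi\otimes H_\rho$, a Hilbert space with inner product $\langle T,S\rangle 1=S^*T$, and fix an orthonormal basis $\{T_{\pi,\rho}^{\sigma,e}\}_e$ of it. Let $M$ be a factor of type II$_1$ with normalized trace $\tau$, write $T$ for $1_M\otimes T$, and let $\|X\|_2=\big((\tau\otimes\mathrm{tr})(X^*X)\big)^{1/2}$ on $M\otimes B(K)$ for finite dimensional $K$, where $\mathrm{tr}$ is the normalized trace of $B(K)$. A cocycle twisted action $\{\alpha,U\}$ of $\hat G$ on $M$ consists of unital $*$-homomorphisms $\alpha_\pi:M\to M\otimes B(H_\pi)$ with $\alpha_{\mathbf 1}=\mathrm{id}_M$ and unitaries $U_{\pi,\rho}\in M\otimes B(H_\pi)\otimes B(H_\rho)$ such that 1. $U_{\pi,\mathbf 1}=U_{\mathbf 1,\pi}=1$;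 2. $(\alpha_\pi\otimes\mathrm{id}_\rho)(\alpha_\rho(x))\,U_{\pi,\rho}T=U_{\pi,\rho}T\,\alpha_\sigma(x)$ for all $x\in M$ and $T\in(\sigma,\pi\otimes\rho)$; 3. with $U_{\pi,\rho}^{\sigma,e}:=U_{\pi,\rho}T_{\pi,\rho}^{\sigma,e}$, for all $\pi,\rho,\sigma\in\hat G$, $$\sum_{\eta,a,\xi,b}(\alpha_\pi\otimes\mathrm{id})(U_{\rho,\sigma}^{\eta,a})\,U_{\pi,\eta}^{\xi,b}\,T_{\pi,\eta}^{\xi,b*}(1_\pi\otimes T_{\rho,\sigma}^{\eta,a*})=\sum_{\zeta,c,\xi,d}(U_{\pi,\rho}^{\zeta,c}\otimes1_\sigma)\,U_{\zeta,\sigma}^{\xi,d}\,T_{\zeta,\sigma}^{\xi,d*}(T_{\pi,\rho}^{\zeta,c*}\otimes1_\sigma).$$ It is outer if for every $\pi\ne\mathbf 1$ the only $a\in M\otimes B(H_\pi)$ with $\alpha_\pi(x)a=a(x\otimes1_\pi)$ for all $x\in M$ is $a=0$. For a family $W_\pi\in M\otimes B(H_\pi)$ put $$(\partial_\alpha W)_{\pi,\rho}:=\sum_{\sigma,e}(\alpha_\pi\otimes\mathrm{id}_\rho)(W_\rho)\,(W_\pi\otimes1_\rho)\,T_{\pi,\rho}^{\sigma,e}\,W_\sigma^*\,T_{\pi,\rho}^{\sigma,e*}.$$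 **Theorem.** There are $\delta_0>0$ and a function $f$ with $f(\delta)>0$ for $\delta>0$ and $\lim_{\delta\to0^+}f(\delta)=0$, both depending only on $G$, such that the following holds. Let $\{\alpha,U\}$ be an outer cocycle twisted action of $\hat G$ on a factor $M$ of type II$_1$, let $0<\delta<\delta_0$, and suppose that $\|U_{\pi,\rho}-1\|_2<\delta$ for all $\pi,\rho\in\hat G$. Then there are unitaries $W_\pi\in M\otimes B(H_\pi)$, $\pi\in\hat G$, with $W_{\mathbf 1}=1$, such that $U_{\pi,\rho}=(\partial_\alpha W^*)_{\pi,\rho}$ for all $\pi,\rho\in\hat G$ and $\|W_\pi-1\|_2<f(\delta)$ for all $\pi\in\hat G$. -/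

import Mathlib

open scoped Matrix Kronecker ComplexOrder
open Filter Topology

noncomputable section

namespace GroupDual

/-! ### Finite dimensional unitary representations and the dual of a finite group -/

section Representations

variable {G : Type*} [Group G]

/-- The linear representation on `ℂⁿ` underlying a unitary matrix representation. -/
def toRep {n : ℕ} (π : G →* Matrix.unitaryGroup (Fin n) ℂ) :
    Representation ℂ G (Fin n → ℂ) :=
  ((Matrix.toLinAlgEquiv' : Matrix (Fin n) (Fin n) ℂ ≃ₐ[ℂ] _) :
      Matrix (Fin n) (Fin n) ℂ →* Module.End ℂ (Fin n → ℂ)).comp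
    ((Submonoid.subtype (Matrix.unitaryGroup (Fin n) ℂ)).comp π)

/-- Unitary equivalence of unitary representations. -/
def UnitarilyEquivalent {m n : ℕ} (σ : G →* Matrix.unitaryGroup (Fin m) ℂ)
    (π : G →* Matrix.unitaryGroup (Fin n) ℂ) : Prop :=
  ∃ V : Matrix (Fin n) (Fin m) ℂ, Vᴴ * V = 1 ∧ V * Vᴴ = 1 ∧
    ∀ g, V * (σ g : Matrix (Fin m) (Fin m) ℂ) = (π g : Matrix (Fin n) (Fin n) ℂ) * V

end Representations

/-- A choice of representatives of the irreducible unitary representations of `G` up to unitary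
equivalence, one of them being the trivial representation `1` on `ℂ`. The representation space
of `π` carries a fixed orthonormal basis indexed by `Fin (dim π)`. -/
structure UnitaryDual (G : Type*) [Group G] where
  Idx : Type
  fintypeIdx : Fintype Idx
  dim : Idx → ℕ
  rep : ∀ i, G →* Matrix.unitaryGroup (Fin (dim i)) ℂ
  irreducible : ∀ i, (toRep (rep i)).IsIrreducible
  inequivalent : ∀ i j, UnitarilyEquivalent (rep i) (rep j) → i = j
  exhaustive : ∀ (n : ℕ) (σ : G →* Matrix.unitaryGroup (Fin n) ℂ),
    (toRep σ).IsIrreducible → ∃ i, UnitarilyEquivalent σ (rep i)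
  triv : Idx
  dim_triv : dim triv = 1
  rep_triv : ∀ g, rep triv g = 1

attribute [instance] UnitaryDual.fintypeIdx

namespace UnitaryDual

variable {G : Type*} [Group G] (D : UnitaryDual G)

/-- Index set of the orthonormal basis of `H_π`. -/
abbrev V (π : D.Idx) : Type := Fin (D.dim π)

/-- The matrix `π(g)`. -/
def mat (π : D.Idx) (g : G) : Matrix (D.V π) (D.V π) ℂ := (D.rep π g).1

/-- The intertwiner space `(σ, π ⊗ ρ)`. -/
def intertwiners (π ρ σ : D.Idx) : Submodule ℂ (Matrix (D.V π × D.V ρ) (D.V σ) ℂ) where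
  carrier := {T | ∀ g, T * D.mat σ g = (D.mat π g ⊗ₖ D.mat ρ g) * T}
  add_mem' := by
    intro S T hS hT g
    rw [Matrix.add_mul, Matrix.mul_add, hS g, hT g]
  zero_mem' := by
    intro g
    simp
  smul_mem' := by
    intro c T hT g
    rw [Matrix.smul_mul, Matrix.mul_smul, hT g]

/-- Orthonormal bases `{T_{π,ρ}^{σ,e}}` of all the Hilbert spaces `(σ, π ⊗ ρ)`, whose inner
product is `⟨T, S⟩ 1 = S* T`. -/
structure IntertwinerBases where
  mult : D.Idx → D.Idx → D.Idx → ℕ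
  T : ∀ π ρ σ, Fin (mult π ρ σ) → Matrix (D.V π × D.V ρ) (D.V σ) ℂ
  orthonormal : ∀ π ρ σ e f, (T π ρ σ e)ᴴ * T π ρ σ f = if e = f then 1 else 0
  span_eq : ∀ π ρ σ, Submodule.span ℂ (Set.range (T π ρ σ)) = D.intertwiners π ρ σ

end UnitaryDual

/-! ### Matrices over a `*`-algebra

`A ⊗ B(H, K)` is the space of matrices over `A`, indexed by the fixed bases of `K` and `H`;
tensor products of Hilbert spaces correspond to products of index sets. -/

section Amplification

variable {A : Type*} [Ring A] [StarRing A] [Algebra ℂ A]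
variable {m n p q : Type*}

/-- `1_A ⊗ T` for a scalar matrix `T`. -/
def scal (A : Type*) [Ring A] [Algebra ℂ A] (T : Matrix m n ℂ) : Matrix m n A :=
  T.map (algebraMap ℂ A)

/-- `x ⊗ 1`. -/
def amp (n : Type*) [DecidableEq n] (x : A) : Matrix n n A :=
  Matrix.diagonal fun _ => x

/-- `X ⊗ 1_q`. -/
def rightAmp (q : Type*) [DecidableEq q] (X : Matrix m n A) : Matrix (m × q) (n × q) A :=
  X ⊗ₖ (1 : Matrix q q A)

/-- `(φ ⊗ id)(X) ∈ A ⊗ B(H_p) ⊗ B(H_n, H_m)` for `φ : A → A ⊗ B(H_p)` and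
`X ∈ A ⊗ B(H_n, H_m)`. -/
def ampMap [Fintype p] [DecidableEq p] (φ : A →⋆ₐ[ℂ] Matrix p p A) (X : Matrix m n A) :
    Matrix (p × m) (p × n) A :=
  Matrix.of fun a b => φ (X a.2 b.2) a.1 b.1

end Amplification

/-! ### Cocycle twisted actions of the dual -/

section Cocycles

variable {G : Type*} [Group G] (D : UnitaryDual G) (B : D.IntertwinerBases)
variable {A : Type*} [Ring A] [StarRing A] [Algebra ℂ A]

/-- `{α_π, U_{π,ρ}}` is a cocycle twisted action of `Ĝ` on `A`. -/
structure IsCocycleTwistedAction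
    (α : ∀ π : D.Idx, A →⋆ₐ[ℂ] Matrix (D.V π) (D.V π) A)
    (U : ∀ π ρ : D.Idx, Matrix (D.V π × D.V ρ) (D.V π × D.V ρ) A) : Prop where
  map_triv : ∀ x, α D.triv x = amp (D.V D.triv) x
  unitary_mem : ∀ π ρ, U π ρ ∈ unitary (Matrix (D.V π × D.V ρ) (D.V π × D.V ρ) A)
  right_triv : ∀ π, U π D.triv = 1
  left_triv : ∀ π, U D.triv π = 1
  intertwine : ∀ π ρ σ, ∀ T ∈ D.intertwiners π ρ σ, ∀ x : A,
    ampMap (α π) (α ρ x) * U π ρ * scal A T = U π ρ * scal A T * α σ x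
  cocycle : ∀ π ρ σ,
    Matrix.reindex (Equiv.prodAssoc _ _ _).symm (Equiv.prodAssoc _ _ _).symm
      (∑ η, ∑ a, ∑ ξ, ∑ b,
        ampMap (α π) (U ρ σ * scal A (B.T ρ σ η a)) *
          (U π η * scal A (B.T π η ξ b)) *
          scal A (B.T π η ξ b)ᴴ *
          scal A ((1 : Matrix (D.V π) (D.V π) ℂ) ⊗ₖ (B.T ρ σ η a)ᴴ)) =
      ∑ ζ, ∑ c, ∑ ξ, ∑ d,
        rightAmp (D.V σ) (U π ρ * scal A (B.T π ρ ζ c)) *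
          (U ζ σ * scal A (B.T ζ σ ξ d)) *
          scal A (B.T ζ σ ξ d)ᴴ *
          scal A ((B.T π ρ ζ c)ᴴ ⊗ₖ (1 : Matrix (D.V σ) (D.V σ) ℂ))

/-- Freeness, which for a factor is called outerness: for `π ≠ 1` there is no nonzero
`a ∈ A ⊗ B(H_π)` with `α_π(x) a = a (x ⊗ 1)` for all `x`. -/
def IsOuter (α : ∀ π : D.Idx, A →⋆ₐ[ℂ] Matrix (D.V π) (D.V π) A) : Prop :=
  ∀ π, π ≠ D.triv → ∀ a : Matrix (D.V π) (D.V π) A,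
    (∀ x : A, α π x * a = a * amp (D.V π) x) → a = 0

/-- `(∂_α W)_{π,ρ} = ∑_{σ,e} (α_π ⊗ id)(W_ρ) (W_π ⊗ 1) T_{π,ρ}^{σ,e} W_σ* T_{π,ρ}^{σ,e}*`. -/
def coboundary (α : ∀ π : D.Idx, A →⋆ₐ[ℂ] Matrix (D.V π) (D.V π) A)
    (W : ∀ π : D.Idx, Matrix (D.V π) (D.V π) A) (π ρ : D.Idx) :
    Matrix (D.V π × D.V ρ) (D.V π × D.V ρ) A :=
  ∑ σ, ∑ e, ampMap (α π) (W ρ) * rightAmp (D.V ρ) (W π) *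
    scal A (B.T π ρ σ e) * star (W σ) * scal A (B.T π ρ σ e)ᴴ

end Cocycles

/-! ### Factors of type II₁ -/

section Factors

variable {H : Type*} [NormedAddCommGroup H] [InnerProductSpace ℂ H] [CompleteSpace H]

/-- A faithful normal tracial state on a von Neumann algebra. Normality of a positive functional
is expressed by ultraweak continuity: it is a sum of vector functionals `x ↦ ⟨x ξ_k, ξ_k⟩` with
`∑ ‖ξ_k‖² < ∞`. -/
structure IsNormalizedTrace (M : VonNeumannAlgebra H)
    (τ : M.toStarSubalgebra →ₗ[ℂ] ℂ) : Prop where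
  map_one : τ 1 = 1
  nonneg : ∀ x, 0 ≤ τ (star x * x)
  faithful : ∀ x, τ (star x * x) = 0 → x = 0
  tracial : ∀ x y, τ (x * y) = τ (y * x)
  normal : ∃ ξ : ℕ → H, Summable (fun k => ‖ξ k‖ ^ 2) ∧
    ∀ x : M.toStarSubalgebra, HasSum (fun k => inner ℂ (ξ k) ((x : H →L[ℂ] H) (ξ k))) (τ x)

/-- `M` is a factor of type II₁: an infinite dimensional factor with a faithful normal tracial
state. -/
structure IsTypeIIOneFactor (M : VonNeumannAlgebra H) : Prop where
  factor : ∀ x : M.toStarSubalgebra, (∀ y, x * y = y * x) →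
    ∃ c : ℂ, x = algebraMap ℂ M.toStarSubalgebra c
  infinite : ¬ FiniteDimensional ℂ M.toStarSubalgebra
  finite : ∃ τ, IsNormalizedTrace M τ

/-- The norm `‖X‖₂ = (τ ⊗ tr)(X* X)^{1/2}` on `A ⊗ B(H_n)`, where `tr` is the normalized trace
of `B(H_n)`. -/
def norm2 {A : Type*} [Ring A] [StarRing A] [Algebra ℂ A] (τ : A →ₗ[ℂ] ℂ)
    {n : Type*} [Fintype n] (X : Matrix n n A) : ℝ :=
  Real.sqrt ((τ (∑ i, (Xᴴ * X) i i)).re / Fintype.card n)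

end Factors

end GroupDual

end

noncomputable section

set_option linter.unusedSectionVars false

namespace GroupDual

/-! ### Tracial states on `*`-algebras and the associated `2`-norm -/

section TracialState

variable {A : Type*} [Ring A] [StarRing A] [Algebra ℂ A] [StarModule ℂ A]

/-! The cocycle becomes a coboundary after tensoring with `B(ℓ²(G))`, and smallness allows one to
come back down to `M`.

Stabilization. Fourier analysis on `G` writes `U π σ = ∑_b u_π(b) ⊗ σ(b)` with coefficients `u_π(b)`
over `M` that do not depend on `σ`. Replacing `σ` by the left regular representation and multiplying
by the diagonal matrix with entries `π(k)` gives the `trivializer` `Ω_π`, whose `(g, k)` block is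
`u_π(g k⁻¹) π(k)`. Unitarity of `U` makes `Ω_π` unitary, and the cocycle identity, read coefficient
by coefficient (`sum_ampMap_coeff_mul`), becomes `α_π(Ω_ρ) Ω_π = U_{π,ρ} Δ(Ω)_{π,ρ}`
(`ampMap_trivializer_mul`), where `Δ` is `coproduct`. Hence `γ_π = Ω_π* α_π(·) Ω_π` is a genuine
action of the dual on `M ⊗ B(ℓ²(G))` (`ampMap_action`).

Descent. Let `p = 1 ⊗ e_{1,1}`, which every `α_π ⊗ id` fixes. If `w* w = p` and `w w*` is fixed by
`γ`, then `α_π(w*) Ω_π w` is a unitary of the corner at `p`, that is over `M`, and it solves the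
same equation (`ampMap_corner_mul`). It is close to `1` as soon as `w` is close to `p` and `u_π(1)`,
the corner of `Ω_π`, is close to `1`.

Finding `w`. If all `U π ρ` are close to `1`, so are the `u_π(1)`, and therefore `p` is almost fixed
by `γ` (`trace_unitProj_sub_le`). Averaging over `γ` is a trace preserving expectation `E` onto the
fixed points with `E x ≥ |G|⁻¹ x` for `x ≥ 0`. A spectral projection of `E p` is a fixed projection
close to `p`; since the inequality makes the fixed point algebra diffuse, this projection can be
corrected slightly to have exactly the trace of `p`. Close projections of equal trace in a factor
are joined by a partial isometry close to them (`exists_partialIsometry_near`), and this is `w`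
(`exists_partialIsometry_of_expectation`).

Trace preservation of `α_π` comes from uniqueness of the trace of a factor (`eq_of_isTracialState`).
The operator algebra is carried out in C*-algebras with a faithful trace whose norm bounded sets are
complete in the `2`-norm, a class stable under matrices; factoriality enters as primeness of the
ring. All constants depend only on `|G|`. -/

/-- A hermitian tracial state on a `*`-algebra. -/
structure IsTracialState (τ : A →ₗ[ℂ] ℂ) : Prop where
  map_one : τ 1 = 1
  nonneg : ∀ x, 0 ≤ τ (star x * x)
  tracial : ∀ x y, τ (x * y) = τ (y * x)
  map_star : ∀ x, τ (star x) = star (τ x)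

/-- The `2`-norm of a tracial state. -/
def l2 (τ : A →ₗ[ℂ] ℂ) (x : A) : ℝ := √(τ (star x * x)).re

/-- The pre-inner product `⟨x, y⟩ = τ(x* y)` of a tracial state. -/
abbrev IsTracialState.core {τ : A →ₗ[ℂ] ℂ} (h : IsTracialState τ) :
    PreInnerProductSpace.Core ℂ A where
  inner x y := τ (star x * y)
  conj_inner_symm x y := by
    rw [starRingEnd_apply, ← h.map_star]; simp
  re_inner_nonneg x := (Complex.le_def.1 (h.nonneg x)).1
  add_left x y z := by simp [add_mul]
  smul_left x y r := by simp

namespace IsTracialState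

variable {τ : A →ₗ[ℂ] ℂ} (h : IsTracialState τ)
include h

lemma re_nonneg (x : A) : 0 ≤ (τ (star x * x)).re := (Complex.le_def.1 (h.nonneg x)).1

lemma l2_nonneg (x : A) : 0 ≤ l2 τ x := Real.sqrt_nonneg _

lemma l2_sq (x : A) : l2 τ x ^ 2 = (τ (star x * x)).re := Real.sq_sqrt (h.re_nonneg x)

lemma coe_l2_sq (x : A) : ((l2 τ x ^ 2 : ℝ) : ℂ) = τ (star x * x) := by
  rw [h.l2_sq]
  have := (Complex.le_def.1 (h.nonneg x)).2
  exact Complex.ext (by simp) (by simpa using this)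

lemma cauchy_schwarz (x y : A) : ‖τ (star x * y)‖ ≤ l2 τ x * l2 τ y :=
  let _ := h.core
  InnerProductSpace.Core.norm_inner_le_norm (𝕜 := ℂ) (F := A) x y

lemma l2_add_le (x y : A) : l2 τ (x + y) ≤ l2 τ x + l2 τ y := by
  let _ := h.core
  let _ := InnerProductSpace.Core.toSeminormedAddCommGroup (𝕜 := ℂ) (F := A)
  exact norm_add_le x y

lemma l2_neg (x : A) : l2 τ (-x) = l2 τ x := by simp [l2]

lemma l2_zero : l2 τ 0 = 0 := by simp [l2]

lemma l2_one : l2 τ 1 = 1 := by simp [l2, h.map_one]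

lemma l2_sub_le (x y : A) : l2 τ (x - y) ≤ l2 τ x + l2 τ y := by
  rw [sub_eq_add_neg, ← h.l2_neg y]; exact h.l2_add_le _ _

lemma l2_sub_comm (x y : A) : l2 τ (x - y) = l2 τ (y - x) := by
  rw [← neg_sub, h.l2_neg]

lemma l2_sub_le_sub_add_sub (x y z : A) : l2 τ (x - z) ≤ l2 τ (x - y) + l2 τ (y - z) := by
  simpa using h.l2_add_le (x - y) (y - z)

lemma l2_star (x : A) : l2 τ (star x) = l2 τ x := by
  rw [l2, l2, star_star, h.tracial]

lemma l2_smul (c : ℂ) (x : A) : l2 τ (c • x) = ‖c‖ * l2 τ x := by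
  let _ := h.core
  let _ := InnerProductSpace.Core.toSeminormedAddCommGroup (𝕜 := ℂ) (F := A)
  let _ := InnerProductSpace.Core.toNormedSpace (𝕜 := ℂ) (F := A)
  exact norm_smul c x

lemma l2_sum_le {ι : Type*} (s : Finset ι) (f : ι → A) :
    l2 τ (∑ i ∈ s, f i) ≤ ∑ i ∈ s, l2 τ (f i) := by
  let _ := h.core
  let _ := InnerProductSpace.Core.toSeminormedAddCommGroup (𝕜 := ℂ) (F := A)
  exact norm_sum_le s f

lemma norm_apply_le_l2 (x : A) : ‖τ x‖ ≤ l2 τ x := by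
  simpa [h.l2_one] using h.cauchy_schwarz 1 x

lemma l2_mul_of_star_mul_self {u : A} (hu : star u * u = 1) (x : A) : l2 τ (u * x) = l2 τ x := by
  rw [l2, l2, star_mul, mul_assoc, ← mul_assoc (star u), hu, one_mul]

lemma l2_mul_of_mul_star_self {u : A} (hu : u * star u = 1) (x : A) : l2 τ (x * u) = l2 τ x := by
  rw [← h.l2_star, star_mul, h.l2_mul_of_star_mul_self (by simpa using hu), h.l2_star]

/-- Right multiplication by a partial isometry is a contraction. -/
lemma l2_mul_le_of_isStarProjection {w : A} (hw : IsStarProjection (w * star w)) (x : A) :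
    l2 τ (x * w) ≤ l2 τ x := by
  refine Real.sqrt_le_sqrt ?_
  have h1 := h.re_nonneg ((1 - w * star w) * star x)
  have e1 : star ((1 - w * star w) * star x) * ((1 - w * star w) * star x)
      = x * star x - x * (w * star w) * star x := by
    rw [star_mul, star_star, hw.one_sub.isSelfAdjoint.star_eq, mul_assoc, ← mul_assoc (1 - _) (1 - _),
      hw.one_sub.isIdempotentElem.eq]
    noncomm_ring
  rw [e1, map_sub, Complex.sub_re, h.tracial x (star x)] at h1
  have e2 : τ (star (x * w) * (x * w)) = τ (x * (w * star w) * star x) := by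
    rw [star_mul, h.tracial, ← mul_assoc, ← mul_assoc]
  rw [e2]; linarith

lemma l2_mul_proj_le {p : A} (hp : IsStarProjection p) (x : A) : l2 τ (x * p) ≤ l2 τ x :=
  h.l2_mul_le_of_isStarProjection
    (by rwa [hp.isSelfAdjoint.star_eq, hp.isIdempotentElem.eq]) x

lemma l2_proj_mul_le {p : A} (hp : IsStarProjection p) (x : A) : l2 τ (p * x) ≤ l2 τ x := by
  rw [← h.l2_star, star_mul, hp.isSelfAdjoint.star_eq, ← h.l2_star x]
  exact h.l2_mul_proj_le hp _

lemma l2_proj_sq {p : A} (hp : IsStarProjection p) : l2 τ p ^ 2 = (τ p).re := by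
  rw [h.l2_sq, hp.isSelfAdjoint.star_eq, hp.isIdempotentElem.eq]

lemma proj_re_nonneg {p : A} (hp : IsStarProjection p) : 0 ≤ (τ p).re := by
  rw [← h.l2_proj_sq hp]; positivity

lemma coe_re_proj {p : A} (hp : IsStarProjection p) : (((τ p).re : ℝ) : ℂ) = τ p := by
  rw [← h.l2_proj_sq hp, h.coe_l2_sq, hp.isSelfAdjoint.star_eq, hp.isIdempotentElem.eq]

end IsTracialState

end TracialState

/-! ### The trace on matrices and its entrywise `2`-norm. -/

section MatrixTrace

variable {A : Type*} [Ring A] [StarRing A] [Algebra ℂ A] [StarModule ℂ A]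
variable {n : Type*} [Fintype n] [DecidableEq n]

/-- `τ ⊗ tr` on `A ⊗ B(H_n)`, with `tr` the normalized trace. -/
def matTrace (τ : A →ₗ[ℂ] ℂ) (n : Type*) [Fintype n] : Matrix n n A →ₗ[ℂ] ℂ where
  toFun X := (Fintype.card n : ℂ)⁻¹ * ∑ i, τ (X i i)
  map_add' X Y := by simp [Finset.sum_add_distrib, mul_add]
  map_smul' c X := by simp [← Finset.mul_sum]; ring

lemma matTrace_apply (τ : A →ₗ[ℂ] ℂ) (X : Matrix n n A) :
    matTrace τ n X = (Fintype.card n : ℂ)⁻¹ * ∑ i, τ (X i i) := rfl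

lemma matTrace_star_mul_self (τ : A →ₗ[ℂ] ℂ) (X : Matrix n n A) :
    matTrace τ n (star X * X)
      = (Fintype.card n : ℂ)⁻¹ * ∑ i, ∑ j, τ (star (X j i) * X j i) := by
  simp only [matTrace_apply, Matrix.star_eq_conjTranspose, Matrix.mul_apply,
    Matrix.conjTranspose_apply, map_sum]

lemma IsTracialState.matTrace {τ : A →ₗ[ℂ] ℂ} (h : IsTracialState τ) [Nonempty n] :
    IsTracialState (matTrace τ n) where
  map_one := by
    simp [matTrace_apply, h.map_one]
  nonneg X := by
    rw [matTrace_star_mul_self]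
    refine mul_nonneg (by rw [inv_nonneg]; exact Nat.cast_nonneg _) ?_
    exact Finset.sum_nonneg fun i _ => Finset.sum_nonneg fun j _ => h.nonneg _
  tracial X Y := by
    simp only [matTrace_apply, Matrix.mul_apply, map_sum]
    rw [Finset.sum_comm]
    simp only [fun i j => h.tracial (X i j) (Y j i)]
  map_star X := by
    simp [matTrace_apply, Matrix.star_apply, h.map_star]

lemma l2_matTrace_sq {τ : A →ₗ[ℂ] ℂ} (h : IsTracialState τ) [Nonempty n]
    (X : Matrix n n A) :
    l2 (matTrace τ n) X ^ 2 = (Fintype.card n : ℝ)⁻¹ * ∑ i, ∑ j, l2 τ (X i j) ^ 2 := by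
  rw [h.matTrace.l2_sq, matTrace_star_mul_self, Finset.sum_comm]
  simp only [← h.coe_l2_sq]
  rw [← Complex.ofReal_re ((Fintype.card n : ℝ)⁻¹ * _)]
  congr 1
  push_cast
  rfl

lemma l2_entry_sq_le {τ : A →ₗ[ℂ] ℂ} (h : IsTracialState τ) [Nonempty n] (X : Matrix n n A) (i j : n) :
    l2 τ (X i j) ^ 2 ≤ Fintype.card n * l2 (matTrace τ n) X ^ 2 := by
  have hc : (0 : ℝ) < Fintype.card n := by exact_mod_cast Fintype.card_pos
  rw [l2_matTrace_sq h, mul_inv_cancel_left₀ hc.ne']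
  refine (Finset.single_le_sum (f := fun j => l2 τ (X i j) ^ 2) (fun _ _ => sq_nonneg _)
    (Finset.mem_univ j)).trans ?_
  exact Finset.single_le_sum (f := fun i => ∑ j, l2 τ (X i j) ^ 2)
    (fun _ _ => Finset.sum_nonneg fun _ _ => sq_nonneg _) (Finset.mem_univ i)

lemma l2_entry_le {τ : A →ₗ[ℂ] ℂ} (h : IsTracialState τ) [Nonempty n] (X : Matrix n n A) (i j : n) :
    l2 τ (X i j) ≤ √(Fintype.card n) * l2 (matTrace τ n) X := by
  refine abs_le_of_sq_le_sq' ?_ (mul_nonneg (Real.sqrt_nonneg _) (h.matTrace.l2_nonneg _)) |>.2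
  rw [mul_pow, Real.sq_sqrt (Nat.cast_nonneg _)]
  exact l2_entry_sq_le h X i j

lemma norm2_eq_l2 (τ : A →ₗ[ℂ] ℂ) (X : Matrix n n A) : norm2 τ X = l2 (matTrace τ n) X := by
  rw [norm2, l2, matTrace_apply, map_sum, Matrix.star_eq_conjTranspose, mul_comm,
    ← div_eq_mul_inv, Complex.div_natCast_re]

end MatrixTrace

/-! ### Tracial von Neumann algebras -/

section TracialWStar

variable {A : Type*} [CStarAlgebra A]

/-- A faithful tracial state on a C*-algebra whose norm bounded subsets are complete in the
`2`-norm, i.e. a C*-algebraic description of a finite von Neumann algebra. -/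
structure IsTracialWStar (τ : A →ₗ[ℂ] ℂ) : Prop extends IsTracialState τ where
  faithful : ∀ x, τ (star x * x) = 0 → x = 0
  complete : ∀ (C : ℝ) (x : ℕ → A), (∀ n, ‖x n‖ ≤ C) →
    (∀ ε > 0, ∃ N, ∀ m ≥ N, ∀ n ≥ N, l2 τ (x m - x n) < ε) →
    ∃ y, Tendsto (fun n => l2 τ (x n - y)) atTop (𝓝 0)

namespace IsTracialState

variable [PartialOrder A] [StarOrderedRing A]
variable {τ : A →ₗ[ℂ] ℂ} (h : IsTracialState τ)
include h

lemma re_apply_nonneg {a : A} (ha : 0 ≤ a) : 0 ≤ (τ a).re := by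
  obtain ⟨b, rfl⟩ := CStarAlgebra.nonneg_iff_eq_star_mul_self.1 ha
  exact h.re_nonneg b

lemma re_mono {a b : A} (hab : a ≤ b) : (τ a).re ≤ (τ b).re := by
  have := h.re_apply_nonneg (sub_nonneg.2 hab)
  rw [map_sub, Complex.sub_re] at this
  linarith

/-- With `a = z* z`, traciality gives `τ(ab) = τ(z b z*)`. This replaces operator inequalities
between products that do not commute. -/
lemma re_mul_nonneg {a b : A} (ha : 0 ≤ a) (hb : 0 ≤ b) : 0 ≤ (τ (a * b)).re := by
  obtain ⟨z, rfl⟩ := CStarAlgebra.nonneg_iff_eq_star_mul_self.1 ha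
  rw [mul_assoc, h.tracial]
  exact h.re_apply_nonneg (star_right_conjugate_nonneg hb z)

lemma l2_mul_le (a x : A) : l2 τ (a * x) ≤ ‖a‖ * l2 τ x := by
  rw [l2, l2]
  refine Real.sqrt_le_iff.2 ⟨by positivity, ?_⟩
  rw [mul_pow, Real.sq_sqrt (h.re_nonneg x)]
  have h1 := h.re_mono (star_left_conjugate_le_conjugate
    (CStarAlgebra.star_mul_le_algebraMap_norm_sq (a := a)) x)
  have e1 : star (a * x) * (a * x) = star x * (star a * a) * x := by simp [mul_assoc]
  have e2 : star x * algebraMap ℝ A (‖a‖ ^ 2) * x = ((‖a‖ ^ 2 : ℝ) : ℂ) • (star x * x) := by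
    rw [mul_assoc, Algebra.algebraMap_eq_smul_one, smul_mul_assoc, one_mul, mul_smul_comm,
      Complex.coe_smul]
  rw [e1]
  rw [e2, map_smul, smul_eq_mul, Complex.re_ofReal_mul] at h1
  exact h1

lemma l2_mul_le' (x a : A) : l2 τ (x * a) ≤ l2 τ x * ‖a‖ := by
  rw [← h.l2_star, star_mul, mul_comm, ← h.l2_star x, ← norm_star a]
  exact h.l2_mul_le _ _

lemma l2_le_norm (x : A) : l2 τ x ≤ ‖x‖ := by
  simpa [h.l2_one] using h.l2_mul_le x 1

end IsTracialState

namespace IsTracialWStar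

variable [PartialOrder A] [StarOrderedRing A]
variable {τ : A →ₗ[ℂ] ℂ} (h : IsTracialWStar τ)
include h

lemma eq_zero_of_l2 {x : A} (hx : l2 τ x = 0) : x = 0 := by
  apply h.faithful
  rw [← h.coe_l2_sq, hx]; simp

lemma eq_of_tendsto {x : ℕ → A} {y z : A} (hy : Tendsto (fun n => l2 τ (x n - y)) atTop (𝓝 0))
    (hz : Tendsto (fun n => l2 τ (x n - z)) atTop (𝓝 0)) : y = z := by
  rw [← sub_eq_zero]
  apply h.eq_zero_of_l2
  refine le_antisymm ?_ (h.l2_nonneg _)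
  refine ge_of_tendsto' (by simpa using hy.add hz) fun n => ?_
  have := h.l2_sub_le_sub_add_sub y (x n) z
  rwa [h.l2_sub_comm y (x n)] at this

omit h in
lemma _root_.GroupDual.IsTracialState.tendsto_const_mul {τ : A →ₗ[ℂ] ℂ} (h : IsTracialState τ)
    {x : ℕ → A} {y : A} (a : A)
    (hy : Tendsto (fun n => l2 τ (x n - y)) atTop (𝓝 0)) :
    Tendsto (fun n => l2 τ (a * x n - a * y)) atTop (𝓝 0) := by
  refine squeeze_zero (fun n => h.l2_nonneg _) (fun n => ?_) (by simpa using hy.const_mul ‖a‖)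
  rw [← mul_sub]; exact h.l2_mul_le _ _

omit h in
lemma _root_.GroupDual.IsTracialState.tendsto_mul_const {τ : A →ₗ[ℂ] ℂ} (h : IsTracialState τ)
    {x : ℕ → A} {y : A} (a : A)
    (hy : Tendsto (fun n => l2 τ (x n - y)) atTop (𝓝 0)) :
    Tendsto (fun n => l2 τ (x n * a - y * a)) atTop (𝓝 0) := by
  refine squeeze_zero (fun n => h.l2_nonneg _) (fun n => ?_) (by simpa using hy.mul_const ‖a‖)
  rw [← sub_mul]; exact h.l2_mul_le' _ _

omit h in
lemma _root_.GroupDual.IsTracialState.tendsto_star {τ : A →ₗ[ℂ] ℂ} (h : IsTracialState τ)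
    {x : ℕ → A} {y : A} (hy : Tendsto (fun n => l2 τ (x n - y)) atTop (𝓝 0)) :
    Tendsto (fun n => l2 τ (star (x n) - star y)) atTop (𝓝 0) := by
  simpa only [← star_sub, h.l2_star] using hy

-- Multiplication is jointly continuous for the `2`-norm on norm bounded sets; a bound on the left
-- factors is enough, the right limit being a fixed element.
omit h in
lemma _root_.GroupDual.IsTracialState.tendsto_mul {τ : A →ₗ[ℂ] ℂ} (h : IsTracialState τ)
    {x x' : ℕ → A} {y y' : A} {C : ℝ} (hC : ∀ n, ‖x n‖ ≤ C)
    (hy : Tendsto (fun n => l2 τ (x n - y)) atTop (𝓝 0))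
    (hy' : Tendsto (fun n => l2 τ (x' n - y')) atTop (𝓝 0)) :
    Tendsto (fun n => l2 τ (x n * x' n - y * y')) atTop (𝓝 0) := by
  refine squeeze_zero (fun n => h.l2_nonneg _) (fun n => ?_)
    (by simpa using (hy'.const_mul C).add (hy.mul_const ‖y'‖))
  calc l2 τ (x n * x' n - y * y') ≤ l2 τ (x n * x' n - x n * y') + l2 τ (x n * y' - y * y') :=
        h.l2_sub_le_sub_add_sub _ _ _
    _ ≤ C * l2 τ (x' n - y') + l2 τ (x n - y) * ‖y'‖ := by
        rw [← mul_sub, ← sub_mul]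
        gcongr
        · exact (h.l2_mul_le _ _).trans (by gcongr; exacts [h.l2_nonneg _, hC n])
        · exact h.l2_mul_le' _ _

omit h in
lemma _root_.GroupDual.IsTracialState.tendsto_apply {τ : A →ₗ[ℂ] ℂ} (h : IsTracialState τ)
    {x : ℕ → A} {y : A} (hy : Tendsto (fun n => l2 τ (x n - y)) atTop (𝓝 0)) :
    Tendsto (fun n => τ (x n)) atTop (𝓝 (τ y)) := by
  rw [tendsto_iff_norm_sub_tendsto_zero]
  refine squeeze_zero (fun n => norm_nonneg _) (fun n => ?_) hy
  rw [← map_sub]; exact h.norm_apply_le_l2 _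

omit h in
/-- Closedness in the `2`-norm. -/
def _root_.GroupDual.IsL2Closed (τ : A →ₗ[ℂ] ℂ) (S : Set A) : Prop :=
  ∀ (x : ℕ → A) (y : A), (∀ n, x n ∈ S) → Tendsto (fun n => l2 τ (x n - y)) atTop (𝓝 0) → y ∈ S

omit h in
lemma _root_.GroupDual.IsL2Closed.isClosed {τ : A →ₗ[ℂ] ℂ} (h : IsTracialState τ) {S : Set A}
    (hS : IsL2Closed τ S) : IsClosed S := by
  refine IsSeqClosed.isClosed fun x y hx hy => hS x y hx ?_
  refine squeeze_zero (fun n => h.l2_nonneg _) (fun n => h.l2_le_norm _) ?_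
  exact tendsto_iff_norm_sub_tendsto_zero.1 hy

/-- Monotone convergence: the increments are controlled by those of a bounded increasing real
sequence, so the sequence is Cauchy in the `2`-norm. In the applications `t` is the trace of an
increasing family of projections, supports or contractions. -/
lemma exists_tendsto_of_sq_le {C D : ℝ} {x : ℕ → A} {t : ℕ → ℝ} (hC : ∀ n, ‖x n‖ ≤ C)
    (hD : ∀ n, t n ≤ D) (hx : ∀ k m, k ≤ m → l2 τ (x m - x k) ^ 2 ≤ t m - t k) :
    ∃ y, Tendsto (fun n => l2 τ (x n - y)) atTop (𝓝 0) := by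
  have hmono : Monotone t := monotone_nat_of_le_succ fun k => by
    have := hx k (k + 1) k.le_succ
    nlinarith [sq_nonneg (l2 τ (x (k + 1) - x k))]
  have hbdd : BddAbove (Set.range t) := by
    refine ⟨D, ?_⟩
    rintro _ ⟨k, rfl⟩
    exact hD k
  refine h.complete C x hC fun ε hε => ?_
  have := (tendsto_atTop_ciSup hmono hbdd).cauchySeq
  obtain ⟨N, hN⟩ := Metric.cauchySeq_iff.1 this (ε ^ 2) (by positivity)
  refine ⟨N, fun m hm n hn => ?_⟩
  have key : ∀ m n, n ≥ N → n ≤ m → l2 τ (x m - x n) < ε := fun m n hn hnm => by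
    have h1 := hx n m hnm
    have h2 := hN m (hn.trans hnm) n hn
    rw [Real.dist_eq] at h2
    exact lt_of_pow_lt_pow_left₀ 2 hε.le (h1.trans_lt ((le_abs_self _).trans_lt h2))
  rcases le_total n m with hnm | hnm
  · exact key m n hn hnm
  · rw [h.l2_sub_comm]; exact key n m hm hnm

/-- Range projections of positive elements. -/
lemma exists_rangeProj {a : A} (ha : 0 ≤ a) : ∃ p : A, IsStarProjection p ∧ p * a = a ∧
    (∀ z, a * z = 0 → p * z = 0) ∧
    ∀ S : StarSubalgebra ℂ A, IsL2Closed τ (S : Set A) → a ∈ S → p ∈ S := by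
  have hsa : IsSelfAdjoint a := ha.isSelfAdjoint
  have hsp : ∀ t ∈ spectrum ℝ a, 0 ≤ t := fun t ht => spectrum_nonneg_of_nonneg ha ht
  -- The range projection is the increasing limit of `a (a + 1/(k+1))⁻¹`. The maximum keeps the
  -- functions continuous on all of `ℝ`.
  set g : ℕ → ℝ → ℝ := fun k t => (max t 0 + 1 / ((k : ℝ) + 1))⁻¹ with hg
  have hgpos : ∀ (k : ℕ) (t : ℝ), 0 < max t 0 + 1 / ((k : ℝ) + 1) := fun k t => by positivity
  have hgc : ∀ k, Continuous (g k) := fun k =>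
    Continuous.inv₀ (by fun_prop) fun t => (hgpos k t).ne'
  set f : ℕ → ℝ → ℝ := fun k t => t * g k t with hf
  have hfc : ∀ k, Continuous (f k) := fun k => continuous_id.mul (hgc k)
  have hf0 : ∀ k t, 0 ≤ t → 0 ≤ f k t := fun k t ht =>
    mul_nonneg ht (inv_nonneg.2 (hgpos k t).le)
  have hf1 : ∀ k t, 0 ≤ t → f k t ≤ 1 := fun k t ht => by
    simp only [hf, hg, ← div_eq_mul_inv]
    rw [div_le_one (hgpos k t), max_eq_left ht]
    have : 0 < 1 / ((k : ℝ) + 1) := by positivity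
    linarith
  have hfm : ∀ k m t, k ≤ m → 0 ≤ t → f k t ≤ f m t := fun k m t hkm ht => by
    simp only [hf, hg]
    gcongr
  set p : ℕ → A := fun k => cfc (f k) a with hp
  have hpa : ∀ k, p k = cfc (g k) a * a := fun k => by
    have := cfc_mul (g k) (fun t => t) a (hgc k).continuousOn
    rw [cfc_id' ℝ a] at this
    rw [← this]
    simp only [hp, hf, mul_comm]
  have hpn : ∀ k, ‖p k‖ ≤ 1 := fun k => by
    refine norm_cfc_le zero_le_one fun t ht => ?_
    rw [Real.norm_eq_abs, abs_of_nonneg (hf0 k t (hsp t ht))]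
    exact hf1 k t (hsp t ht)
  have hpsa : ∀ k, star (p k) = p k := fun k => (cfc_predicate (f k) a : IsSelfAdjoint _).star_eq
  -- The difference lies between `0` and `1`, so it dominates its own square.
  have hdiff : ∀ k m, k ≤ m → l2 τ (p m - p k) ^ 2 ≤ (τ (p m)).re - (τ (p k)).re := by
    intro k m hkm
    rw [h.l2_sq, ← Complex.sub_re, ← map_sub, star_sub, hpsa, hpsa]
    apply h.re_mono
    simp only [hp]
    have hc : Continuous fun t => f m t - f k t := (hfc m).sub (hfc k)
    rw [← cfc_sub _ _ _ (hfc m).continuousOn (hfc k).continuousOn,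
      ← cfc_mul (fun t => f m t - f k t) (fun t => f m t - f k t) a hc.continuousOn hc.continuousOn]
    refine cfc_mono (fun t ht => ?_) (hc.mul hc).continuousOn hc.continuousOn
    have h1 := hfm k m t hkm (hsp t ht)
    have h2 := hf1 m t (hsp t ht)
    have h3 := hf0 k t (hsp t ht)
    nlinarith
  have hbdd : ∀ k, (τ (p k)).re ≤ 1 := fun k => (Complex.re_le_norm _).trans
    ((h.norm_apply_le_l2 _).trans ((h.l2_le_norm _).trans (hpn k)))
  obtain ⟨q, hq⟩ := h.exists_tendsto_of_sq_le hpn hbdd hdiff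
  have hqsa : star q = q := by
    have := h.tendsto_star hq
    simp only [hpsa] at this
    exact h.eq_of_tendsto this hq
  have hqa : q * a = a := by
    refine h.eq_of_tendsto (h.tendsto_mul_const a hq) ?_
    refine squeeze_zero (fun n => h.l2_nonneg _) (fun n => (h.l2_le_norm _).trans ?_)
      tendsto_one_div_add_atTop_nhds_zero_nat
    have e : p n * a - a = cfc (fun t => f n t * t - t) a := by
      rw [cfc_sub (fun t => f n t * t) (fun t => t) a ((hfc n).mul continuous_id).continuousOn,
        cfc_mul (f n) (fun t => t) a (hfc n).continuousOn, cfc_id' ℝ a]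
    rw [e]
    refine norm_cfc_le (by positivity) fun t ht => ?_
    have ht0 := hsp t ht
    have hε : 0 < 1 / ((n : ℝ) + 1) := by positivity
    have e2 : f n t * t - t = -(t * (1 / ((n : ℝ) + 1)) / (t + 1 / ((n : ℝ) + 1))) := by
      simp only [hf, hg, max_eq_left ht0]
      field_simp
      ring
    rw [e2, norm_neg, Real.norm_eq_abs, abs_of_nonneg (by positivity),
      div_le_iff₀ (by positivity)]
    nlinarith
  have haq : a * q = a := by
    have := congrArg star hqa
    rwa [star_mul, hqsa, hsa.star_eq] at this
  have hpq : ∀ k, p k * q = p k := fun k => by rw [hpa, mul_assoc, haq]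
  refine ⟨q, ⟨?_, hqsa⟩, hqa, ?_, ?_⟩
  · have := h.tendsto_mul_const q hq
    simp only [hpq] at this
    exact h.eq_of_tendsto this hq
  · intro z hz
    have := h.tendsto_mul_const z hq
    simp only [hpa, mul_assoc, hz, mul_zero] at this
    simpa [h.l2_zero, h.l2_neg] using h.eq_of_tendsto this (z := 0) (by simp [h.l2_zero])
  · intro S hS haS
    exact hS p q (fun k => cfc_mem (hs := hS.isClosed h.toIsTracialState) _ haS) hq

end IsTracialWStar

end TracialWStar

/-! ### Spectral projections, polar decomposition and comparison of projections -/

section Comparison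

variable {A : Type*} [CStarAlgebra A] [PartialOrder A] [StarOrderedRing A]

/-- A sequential form of Zorn's lemma: each step gains at least half of the supremum of `ψ` still
available, so a bound of the resulting chain leaves nothing to gain. Only increasing sequences, not
arbitrary chains, need upper bounds. -/
lemma exists_exhaustion {X : Type*} (R : X → X → Prop) (hrefl : ∀ x, R x x)
    (htrans : ∀ x y z, R x y → R y z → R x z) (ψ : X → ℝ) {C : ℝ} (hC : ∀ x, ψ x ≤ C)
    (hmono : ∀ x y, R x y → ψ x ≤ ψ y)
    (hchain : ∀ x : ℕ → X, (∀ n, R (x n) (x (n + 1))) → ∃ y, ∀ n, R (x n) y) (x₀ : X) :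
    ∃ y, R x₀ y ∧ ∀ z, R y z → ψ z = ψ y := by
  set s : X → ℝ := fun x => sSup (ψ '' {z | R x z}) with hs
  have hbdd : ∀ x, BddAbove (ψ '' {z | R x z}) := fun x => by
    refine ⟨C, ?_⟩
    rintro _ ⟨z, -, rfl⟩
    exact hC z
  have hnext : ∀ x, ∃ z, R x z ∧ ψ x + s x ≤ 2 * ψ z := fun x => by
    by_cases hx : s x ≤ ψ x
    · exact ⟨x, hrefl x, by linarith⟩
    · push Not at hx
      obtain ⟨_, ⟨z, hz, rfl⟩, hlt⟩ := exists_lt_of_lt_csSup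
        (s := ψ '' {z | R x z}) ⟨ψ x, x, hrefl x, rfl⟩ (show (ψ x + s x) / 2 < s x by linarith)
      exact ⟨z, hz, by linarith⟩
  choose f hf1 hf2 using hnext
  set x : ℕ → X := fun n => f^[n] x₀ with hx
  have hxs : ∀ n, x (n + 1) = f (x n) := fun n => Function.iterate_succ_apply' f n x₀
  have hxR : ∀ n, R (x n) (x (n + 1)) := fun n => by rw [hxs]; exact hf1 _
  obtain ⟨y, hy⟩ := hchain x hxR
  refine ⟨y, hy 0, fun z hz => le_antisymm ?_ (hmono _ _ hz)⟩
  have hm : Monotone fun n => ψ (x n) := monotone_nat_of_le_succ fun n => hmono _ _ (hxR n)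
  have hb : BddAbove (Set.range fun n => ψ (x n)) := by
    refine ⟨ψ y, ?_⟩
    rintro _ ⟨n, rfl⟩
    exact hmono _ _ (hy n)
  have hlim := tendsto_atTop_ciSup hm hb
  have hle : (⨆ n, ψ (x n)) ≤ ψ y := ciSup_le fun n => hmono _ _ (hy n)
  have hz' : ∀ n, ψ z ≤ 2 * ψ (x (n + 1)) - ψ (x n) := fun n => by
    have h1 : ψ z ≤ s (x n) := le_csSup (hbdd _) ⟨z, htrans _ _ _ (hy n) hz, rfl⟩
    have h2 := hf2 (x n)
    rw [← hxs] at h2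
    linarith
  have hlim2 := ((hlim.comp (tendsto_add_atTop_nat 1)).const_mul 2).sub hlim
  have := ge_of_tendsto' hlim2 hz'
  linarith

lemma norm_le_one_of_partialIsometry {w : A} (hw : w * star w * w = w) : ‖w‖ ≤ 1 := by
  have hp : IsStarProjection (star w * w) := ⟨by
    rw [IsIdempotentElem, mul_assoc, ← mul_assoc w, hw], by simp [IsSelfAdjoint]⟩
  have := hp.norm_le
  rw [CStarRing.norm_star_mul_self] at this
  nlinarith [norm_nonneg w]

namespace IsTracialWStar

variable {τ : A →ₗ[ℂ] ℂ} (h : IsTracialWStar τ)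
include h

omit [PartialOrder A] [StarOrderedRing A] in
lemma nontrivial : Nontrivial A :=
  ⟨0, 1, fun h01 => by simpa [← h01] using h.map_one⟩

/-- The range projection of `(b - c)₊` serves as the spectral projection of `b` for `(c, ∞)`; it
kills `(c - b)₊` because the two parts have product zero. -/
lemma exists_specCut (b : A) (c : ℝ) :
    ∃ e : A, IsStarProjection e ∧
      e * cfc (fun t : ℝ => max (t - c) 0) b = cfc (fun t : ℝ => max (t - c) 0) b ∧
      e * cfc (fun t : ℝ => max (c - t) 0) b = 0 ∧
      (∀ z, cfc (fun t : ℝ => max (t - c) 0) b * z = 0 → e * z = 0) ∧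
      ∀ S : StarSubalgebra ℂ A, IsL2Closed τ (S : Set A) → b ∈ S → e ∈ S := by
  have ha : 0 ≤ cfc (fun t : ℝ => max (t - c) 0) b := cfc_nonneg fun t _ => le_max_right _ _
  obtain ⟨e, he, he1, he2, he3⟩ := h.exists_rangeProj ha
  refine ⟨e, he, he1, he2 _ ?_, he2, fun S hS hbS =>
    he3 S hS (cfc_mem (hs := hS.isClosed h.toIsTracialState) _ hbS)⟩
  rw [← cfc_mul _ _ _ (by fun_prop) (by fun_prop), ← cfc_const_zero ℝ b]
  congr 1
  ext t
  rcases le_total t c with htc | htc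
  · rw [max_eq_right (a := t - c) (by linarith), zero_mul]
  · rw [max_eq_right (a := c - t) (by linarith), mul_zero]

omit h in
lemma _root_.GroupDual.cfc_cut_sub {b : A} (hb : IsSelfAdjoint b) (c : ℝ) :
    cfc (fun t : ℝ => max (t - c) 0) b - cfc (fun t : ℝ => max (c - t) 0) b
      = b - algebraMap ℝ A c := by
  rw [← cfc_sub _ _ _ (by fun_prop) (by fun_prop)]
  conv_rhs => rw [← cfc_id' ℝ b, ← cfc_const c b]
  rw [← cfc_sub _ _ _ (by fun_prop) (by fun_prop)]
  congr 1
  ext t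
  rcases le_total t c with htc | htc
  · rw [max_eq_right (a := t - c) (by linarith), max_eq_left (by linarith)]; ring
  · rw [max_eq_right (a := c - t) (by linarith), max_eq_left (by linarith)]; ring

/-- Spectral projections of self-adjoint elements. -/
lemma exists_specProj {b : A} (hb : IsSelfAdjoint b) (c : ℝ) :
    ∃ e : A, IsStarProjection e ∧ e * b = b * e ∧ 0 ≤ e * (b - algebraMap ℝ A c) ∧
      0 ≤ (1 - e) * (algebraMap ℝ A c - b) ∧
      ∀ S : StarSubalgebra ℂ A, IsL2Closed τ (S : Set A) → b ∈ S → e ∈ S := by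
  obtain ⟨e, he, he1, he2, -, heS⟩ := h.exists_specCut b c
  have hsub := cfc_cut_sub hb c
  set P := cfc (fun t : ℝ => max (t - c) 0) b with hP
  set N := cfc (fun t : ℝ => max (c - t) 0) b with hN
  have hP0 : 0 ≤ P := cfc_nonneg fun t _ => le_max_right _ _
  have hN0 : 0 ≤ N := cfc_nonneg fun t _ => le_max_right _ _
  have h1 : e * (b - algebraMap ℝ A c) = P := by rw [← hsub, mul_sub, he1, he2, sub_zero]
  have h2 : (1 - e) * (algebraMap ℝ A c - b) = N := by
    rw [← neg_sub b, ← hsub, sub_mul, one_mul, mul_neg, mul_sub, he1, he2]; abel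
  refine ⟨e, he, ?_, h1 ▸ hP0, h2 ▸ hN0, heS⟩
  have h3 : (b - algebraMap ℝ A c) * e = P := by
    have := congrArg star h1
    rwa [star_mul, he.isSelfAdjoint.star_eq, hP0.isSelfAdjoint.star_eq,
      (hb.sub (.algebraMap A (.all c))).star_eq] at this
  have h4 := h1.trans h3.symm
  rw [mul_sub, sub_mul, ← (Algebra.commutes c e)] at h4
  exact sub_left_injective h4

/-- A polar decomposition confined to the part where `x* x > c`: there the inverse square root of
`x* x` is bounded, so `w` is a right multiple of `x`. In the last clause, `w` and `x e` are compared
using `(x* x)^{1/2} ≥ x* x` on the support of `e`, valid for a contraction. -/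
lemma exists_polarCut (x : A) {c : ℝ} (hc : 0 < c) :
    ∃ w e : A, IsStarProjection e ∧ star w * w = e ∧ (∃ k, w = x * k) ∧ w * e = w ∧
      (∀ z, x * z = 0 → e * z = 0) ∧ (c < ‖x‖ ^ 2 → e ≠ 0) ∧
      e * (star x * x) = star x * x * e ∧ 0 ≤ (1 - e) * (algebraMap ℝ A c - star x * x) ∧
      (c ≤ 1 → ‖x‖ ≤ 1 → l2 τ (w - x * e) ^ 2 ≤ (τ e).re - (τ (e * (star x * x))).re) := by
  set b := star x * x with hbdef
  have hb0 : 0 ≤ b := star_mul_self_nonneg x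
  have hb : IsSelfAdjoint b := hb0.isSelfAdjoint
  have hsp : ∀ t ∈ spectrum ℝ b, 0 ≤ t := fun t ht => spectrum_nonneg_of_nonneg hb0 ht
  obtain ⟨e, he, he1, he2, he3, -⟩ := h.exists_specCut b c
  have hsub := cfc_cut_sub hb c
  set P := cfc (fun t : ℝ => max (t - c) 0) b with hP
  set N := cfc (fun t : ℝ => max (c - t) 0) b with hN
  have hP0 : 0 ≤ P := cfc_nonneg fun t _ => le_max_right _ _
  have hN0 : 0 ≤ N := cfc_nonneg fun t _ => le_max_right _ _
  -- Truncating at `c` gives a continuous function agreeing with `t^{-1/2}` above `c`; its values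
  -- below `c` are harmless because `e` vanishes there.
  set g : ℝ → ℝ := fun t => (√(max t c))⁻¹ with hg
  have hmaxpos : ∀ t, 0 < max t c := fun t => lt_max_of_lt_right hc
  have hgc : Continuous g := Continuous.inv₀ (by fun_prop) fun t => (Real.sqrt_pos.2 (hmaxpos t)).ne'
  have hgg : ∀ t, g t * g t * max t c = 1 := fun t => by
    have := Real.mul_self_sqrt (hmaxpos t).le
    have h2 := (Real.sqrt_pos.2 (hmaxpos t)).ne'
    simp only [hg]
    field_simp
    rw [sq, this]
  have hgpos : ∀ t, 0 < g t := fun t => inv_pos.2 (Real.sqrt_pos.2 (hmaxpos t))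
  set k := cfc g b with hk
  have hksa : star k = k := (cfc_predicate g b : IsSelfAdjoint _).star_eq
  have ebid : cfc (fun t : ℝ => t) b = b := cfc_id' ℝ b
  have hkb : k * b = cfc (fun t => g t * t) b := by
    rw [cfc_mul g (fun t => t) b hgc.continuousOn, ebid]
  have hkbk : k * b * k = cfc (fun t => g t * t * g t) b := by
    rw [cfc_mul (fun t => g t * t) g b (hgc.mul continuous_id).continuousOn hgc.continuousOn, hkb]
  -- Pointwise, `1 - g(t)² t = g(t)² (max t c - t) = (c - t)₊ g(t)²`, which `e` kills.
  have hone : 1 - k * b * k = N * (k * k) := by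
    rw [hkbk, hN, hk, ← cfc_mul g g b hgc.continuousOn hgc.continuousOn,
      ← cfc_mul _ (fun t => g t * g t) b (by fun_prop) (hgc.mul hgc).continuousOn,
      ← cfc_one ℝ b, ← cfc_sub 1 (fun t => g t * t * g t) b continuousOn_const
        ((hgc.mul continuous_id).mul hgc).continuousOn]
    congr 1
    ext t
    have h1 := hgg t
    rcases le_total t c with htc | htc
    · rw [max_eq_right htc] at h1
      rw [max_eq_left (by linarith), Pi.one_apply]; linear_combination -h1
    · rw [max_eq_left htc] at h1
      rw [max_eq_right (by linarith), Pi.one_apply]; linear_combination -h1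
  have hek : e * (k * b * k) = e := by
    have : e * (1 - k * b * k) = 0 := by rw [hone, ← mul_assoc, he2, zero_mul]
    rw [mul_sub, mul_one, sub_eq_zero] at this
    exact this.symm
  have h1 : e * (b - algebraMap ℝ A c) = P := by rw [← hsub, mul_sub, he1, he2, sub_zero]
  have h2 : (1 - e) * (algebraMap ℝ A c - b) = N := by
    rw [← neg_sub b, ← hsub, sub_mul, one_mul, mul_neg, mul_sub, he1, he2]; abel
  have hcomm : e * b = b * e := by
    have h3 : (b - algebraMap ℝ A c) * e = P := by
      have := congrArg star h1
      rwa [star_mul, he.isSelfAdjoint.star_eq, hP0.isSelfAdjoint.star_eq,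
        (hb.sub (.algebraMap A (.all c))).star_eq] at this
    have h4 := h1.trans h3.symm
    rw [mul_sub, sub_mul, ← (Algebra.commutes c e)] at h4
    exact sub_left_injective h4
  have hw : star (x * k * e) * (x * k * e) = e := by
    rw [star_mul, star_mul, he.isSelfAdjoint.star_eq, hksa]
    calc e * (k * star x) * (x * k * e) = e * (k * (star x * x) * k) * e := by noncomm_ring
      _ = e := by rw [hek, he.isIdempotentElem.eq]
  have hPb : P = cfc (fun t => max (t - c) 0 * (max t c)⁻¹) b * b := by
    have hcont : Continuous fun t => max (t - c) 0 * (max t c)⁻¹ :=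
      Continuous.mul (by fun_prop) (Continuous.inv₀ (by fun_prop) fun t => (hmaxpos t).ne')
    have := cfc_mul (fun t => max (t - c) 0 * (max t c)⁻¹) (fun t => t) b hcont.continuousOn
    rw [ebid] at this
    rw [← this, hP]
    congr 1
    ext t
    rcases le_total t c with htc | htc
    · rw [max_eq_right (a := t - c) (by linarith)]; simp
    · have : t ≠ 0 := by linarith
      rw [max_eq_left htc, mul_assoc, inv_mul_cancel₀ this, mul_one]
  refine ⟨x * k * e, e, he, hw, ⟨k * e, mul_assoc _ _ _⟩, ?_, ?_, ?_, hcomm, h2 ▸ hN0, ?_⟩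
  · rw [mul_assoc, he.isIdempotentElem.eq]
  · intro z hz
    apply he3
    rw [hPb, mul_assoc, hbdef, mul_assoc (star x), hz, mul_zero, mul_zero]
  · intro hcx he0
    rw [he0, sub_zero, one_mul] at h2
    have : b ≤ algebraMap ℝ A c := by rw [← sub_nonneg, h2]; exact hN0
    rw [← CStarAlgebra.norm_le_iff_le_algebraMap b hc.le hb0, hbdef,
      CStarRing.norm_star_mul_self] at this
    nlinarith
  · intro hc1 hx1
    have : Nontrivial A := h.nontrivial
    have hsp1 : ∀ t ∈ spectrum ℝ b, t ≤ 1 := fun t ht => by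
      have h1 := spectrum.norm_le_norm_of_mem ht
      rw [hbdef, CStarRing.norm_star_mul_self] at h1
      have h2 := le_abs_self t
      rw [Real.norm_eq_abs] at h1
      nlinarith [norm_nonneg x]
    have hg1 : ∀ t ∈ spectrum ℝ b, t ≤ g t * t := fun t ht => by
      have h0 := hsp t ht
      have : 1 ≤ g t := by
        rw [hg]
        refine (one_le_inv₀ (Real.sqrt_pos.2 (hmaxpos t))).2 ?_
        exact Real.sqrt_le_one.2 (max_le (hsp1 t ht) hc1)
      nlinarith
    have hge : b ≤ k * b := by
      conv_lhs => rw [← ebid]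
      rw [hkb]
      exact cfc_mono hg1 (by fun_prop) (hgc.mul continuous_id).continuousOn
    have hge2 := h.re_mul_nonneg he.nonneg (sub_nonneg.2 hge)
    rw [mul_sub, map_sub, Complex.sub_re] at hge2
    have hexp : star (x * k * e - x * e) * (x * k * e - x * e)
        = star (x * k * e) * (x * k * e) + e * b * e - e * (k * b) * e - star (e * (k * b) * e) := by
      simp only [star_sub, star_mul, he.isSelfAdjoint.star_eq, hksa, hbdef, star_star]
      noncomm_ring
    have ht : ∀ y, τ (e * y * e) = τ (e * y) := fun y => by
      rw [h.tracial, ← mul_assoc, he.isIdempotentElem.eq]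
    rw [h.l2_sq, hexp, hw, map_sub, map_sub, map_add, h.map_star, ht, ht]
    simp only [Complex.sub_re, Complex.add_re, Complex.star_def, Complex.conj_re]
    linarith

end IsTracialWStar

end Comparison

/-! ### Comparison of projections under primeness. -/

section Factor

variable {A : Type*} [CStarAlgebra A] [PartialOrder A] [StarOrderedRing A]

lemma isStarProjection_star_mul_self {w : A} (hw : w * star w * w = w) :
    IsStarProjection (star w * w) :=
  ⟨by rw [IsIdempotentElem, mul_assoc, ← mul_assoc w, hw], by simp [IsSelfAdjoint]⟩

lemma isStarProjection_mul_star_self {w : A} (hw : w * star w * w = w) :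
    IsStarProjection (w * star w) :=
  ⟨by rw [IsIdempotentElem, ← mul_assoc, hw], by simp [IsSelfAdjoint]⟩

namespace IsTracialWStar

variable {τ : A →ₗ[ℂ] ℂ} (h : IsTracialWStar τ)
include h

lemma eq_zero_of_re_proj {p : A} (hp : IsStarProjection p) (h0 : (τ p).re = 0) : p = 0 := by
  apply h.eq_zero_of_l2
  rw [← sq_eq_zero_iff, h.l2_proj_sq hp, h0]

lemma partialIsometry_of_star_mul_self {w e : A} (he : IsStarProjection e) (hw : star w * w = e) :
    w * star w * w = w := by
  have : w * (1 - e) = 0 := by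
    rw [← CStarRing.star_mul_self_eq_zero_iff, star_mul, he.one_sub.isSelfAdjoint.star_eq]
    calc (1 - e) * star w * (w * (1 - e)) = (1 - e) * (star w * w) * (1 - e) := by noncomm_ring
      _ = 0 := by rw [hw, he.one_sub_mul_self, zero_mul]
  rw [mul_sub, mul_one, sub_eq_zero] at this
  rw [mul_assoc, hw, ← this]

/-- A partial isometry between two projections of a factor extends to one that exhausts one of
them. -/
theorem exists_extension (hprime : ∀ x y : A, (∀ a, x * a * y = 0) → x = 0 ∨ y = 0)
    {p q w₀ : A} (hp : IsStarProjection p) (hq : IsStarProjection q)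
    (hw₀ : w₀ * star w₀ * w₀ = w₀) (hw₀p : w₀ * p = w₀) (hqw₀ : q * w₀ = w₀) :
    ∃ w, w * star w * w = w ∧ w * p = w ∧ q * w = w ∧ w * (star w₀ * w₀) = w₀ ∧
      (star w * w = p ∨ w * star w = q) := by
  let X := {w : A // w * star w * w = w ∧ w * p = w ∧ q * w = w}
  -- The order is extension: `w` restricts to `v` on the source of `v` and corestricts to it on the
  -- range.
  let R : X → X → Prop := fun v w => w.1 * (star v.1 * v.1) = v.1 ∧ v.1 * star v.1 * w.1 = v.1
  -- Under extension, `w - v` is a partial isometry with source `w* w - v* v`, so its squared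
  -- `2`-norm is the gain in trace and increasing sequences converge.
  have hdiff : ∀ v w : X, R v w →
      l2 τ (w.1 - v.1) ^ 2 = (τ (star w.1 * w.1)).re - (τ (star v.1 * v.1)).re := by
    intro ⟨v, hv, _⟩ ⟨w, hw, _⟩ hR
    have h2 : v * star v * w = v := hR.2
    simp only
    have e1 : star v * w = star v * v := by
      calc star v * w = star (v * star v * v) * w := by rw [hv]
        _ = star v * (v * star v * w) := by simp [mul_assoc]
        _ = star v * v := by rw [h2]
    have e2 : star w * v = star v * v := by
      have := congrArg star e1
      simpa using this
    rw [h.l2_sq, ← Complex.sub_re, ← map_sub]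
    congr 2
    rw [star_sub, sub_mul, mul_sub, mul_sub, e1, e2]; abel
  have hψ : ∀ w : X, (τ (star w.1 * w.1)).re ≤ 1 := fun w => by
    have h1 := norm_le_one_of_partialIsometry w.2.1
    have h2 := h.l2_le_norm w.1
    rw [← h.l2_sq]
    nlinarith [h.l2_nonneg w.1]
  have htrans : ∀ u v w : X, R u v → R v w → R u w := by
    intro ⟨u, hu, _⟩ ⟨v, hv, _⟩ ⟨w, hw, _⟩ huv hvw
    have h1 : v * (star u * u) = u := huv.1
    have h2 : u * star u * v = u := huv.2
    have h3 : w * (star v * v) = v := hvw.1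
    have h4 : v * star v * w = v := hvw.2
    change w * (star u * u) = u ∧ u * star u * w = u
    refine ⟨?_, ?_⟩
    · have e : star u = star v * u * star u := by
        have := congrArg star h2
        simp only [star_mul, star_star] at this
        rw [mul_assoc, this]
      calc w * (star u * u) = w * (star v * (u * star u * u)) := by
            conv_lhs => rw [e]
            simp only [mul_assoc]
        _ = w * (star v * (v * (star u * u))) := by rw [hu, h1]
        _ = w * (star v * v) * (star u * u) := by simp only [mul_assoc]
        _ = u := by rw [h3, h1]
    · have e : star u = star u * u * star v := by
        have := congrArg star h1
        simp only [star_mul, star_star] at this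
        rw [this]
      calc u * star u * w = u * star u * u * star v * w := by
            conv_lhs => rw [e]
            simp only [mul_assoc]
        _ = u * star u * v * star v * w := by rw [hu, h2]
        _ = u * star u * (v * star v * w) := by simp only [mul_assoc]
        _ = u := by rw [h4, h2]
  obtain ⟨⟨w, hw, hwp, hqw⟩, hR, hmax⟩ := exists_exhaustion (X := X) R
    (fun v => ⟨by rw [← mul_assoc]; exact v.2.1, v.2.1⟩) htrans
    (fun w => (τ (star w.1 * w.1)).re) hψ
    (fun v w hvw => by have := hdiff v w hvw; nlinarith [sq_nonneg (l2 τ (w.1 - v.1))])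
    (by
      intro x hx
      have hxR : ∀ k m, k ≤ m → R (x k) (x m) := fun k m hkm => by
        induction m, hkm using Nat.le_induction with
        | base => exact ⟨by rw [← mul_assoc]; exact (x k).2.1, (x k).2.1⟩
        | succ m _ ih => exact htrans _ _ _ ih (hx m)
      have hn : ∀ n, ‖(x n).1‖ ≤ 1 := fun n => norm_le_one_of_partialIsometry (x n).2.1
      obtain ⟨y, hy⟩ := h.exists_tendsto_of_sq_le hn (fun n => hψ (x n))
        (fun k m hkm => (hdiff _ _ (hxR k m hkm)).le)
      have hstar := h.tendsto_star hy
      have hyp : y * star y * y = y := by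
        have h1 := h.tendsto_mul (C := 1) (fun n => (norm_mul_le _ _).trans (by
          rw [norm_star]; nlinarith [hn n, norm_nonneg (x n).1])) (h.tendsto_mul hn hy hstar) hy
        refine h.eq_of_tendsto h1 ?_
        simpa only [(x _).2.1] using hy
      refine ⟨⟨y, hyp, ?_, ?_⟩, fun n => ⟨?_, ?_⟩⟩
      · refine h.eq_of_tendsto (h.tendsto_mul_const p hy) ?_
        simpa only [(x _).2.2.1] using hy
      · refine h.eq_of_tendsto (h.tendsto_const_mul q hy) ?_
        simpa only [(x _).2.2.2] using hy
      · have := h.tendsto_mul_const (star (x n).1 * (x n).1) hy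
        refine h.eq_of_tendsto this (tendsto_const_nhds.congr' ?_)
        filter_upwards [eventually_ge_atTop n] with m hm
        rw [(hxR n m hm).1, sub_self, h.l2_zero]
      · have := h.tendsto_const_mul ((x n).1 * star (x n).1) hy
        refine h.eq_of_tendsto this (tendsto_const_nhds.congr' ?_)
        filter_upwards [eventually_ge_atTop n] with m hm
        rw [(hxR n m hm).2, sub_self, h.l2_zero])
    ⟨w₀, hw₀, hw₀p, hqw₀⟩
  refine ⟨w, hw, hwp, hqw, hR.1, ?_⟩
  -- If the defects `r` and `s` of source and range are both nonzero, primeness gives `s a r ≠ 0`. A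
  -- polar part of it is a nonzero partial isometry from under `r` to under `s`, and adding it to
  -- `w` contradicts maximality.
  by_contra hcon
  push Not at hcon
  have hr0 : p - star w * w ≠ 0 := fun h0 => hcon.1 (sub_eq_zero.1 h0).symm
  have hs0 : q - w * star w ≠ 0 := fun h0 => hcon.2 (sub_eq_zero.1 h0).symm
  set r := p - star w * w with hr
  set s := q - w * star w with hs
  have hpw : p * star w = star w := by
    have := congrArg star hwp
    rwa [star_mul, hp.isSelfAdjoint.star_eq] at this
  have hwr : w * r = 0 := by rw [hr, mul_sub, hwp, ← mul_assoc, hw, sub_self]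
  have hsw : s * w = 0 := by rw [hs, sub_mul, hqw, hw, sub_self]
  have hrp : r * p = r := by rw [hr, sub_mul, hp.isIdempotentElem.eq, mul_assoc, hwp]
  have hqs : q * s = s := by rw [hs, mul_sub, hq.isIdempotentElem.eq, ← mul_assoc, hqw]
  have hrr : r * r = r := by
    conv_lhs => rw [hr]
    rw [sub_mul, mul_assoc, hwr, mul_zero, sub_zero, hr, mul_sub, hp.isIdempotentElem.eq,
      ← mul_assoc, hpw]
  have hss : s * s = s := by
    conv_lhs => rw [hs]
    have : star w * s = 0 := by
      rw [hs, mul_sub, ← mul_assoc]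
      have := congrArg star hqw
      rw [star_mul, hq.isSelfAdjoint.star_eq] at this
      have h2 := congrArg star hw
      simp only [star_mul, star_star, ← mul_assoc] at h2
      rw [this, h2, sub_self]
    rw [sub_mul, hqs, mul_assoc, this, mul_zero, sub_zero]
  obtain ⟨a, ha⟩ : ∃ a, s * a * r ≠ 0 := by
    by_contra hall
    push Not at hall
    exact (hprime s r hall).elim hs0 hr0
  have hnorm : 0 < ‖s * a * r‖ := norm_pos_iff.2 ha
  -- Cutting below `‖s a r‖²` ensures that the spectral projection is nonzero.
  obtain ⟨v, e, he, hve, ⟨k, hk⟩, hve', hez, hene, -⟩ :=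
    h.exists_polarCut (s * a * r) (c := ‖s * a * r‖ ^ 2 / 2) (by positivity)
  have he0 : e ≠ 0 := hene (by linarith [pow_pos hnorm 2])
  have hsv : s * v = v := by rw [hk, ← mul_assoc, ← mul_assoc, ← mul_assoc, hss]
  have her : e * r = e := by
    have := hez (1 - r) (by rw [mul_assoc, mul_sub, mul_one, hrr, sub_self, mul_zero])
    rw [mul_sub, mul_one, sub_eq_zero] at this
    exact this.symm
  have hvr : v * r = v := by rw [← hve', mul_assoc, her]
  have hrsa : star r = r := by simp [hr, hp.isSelfAdjoint.star_eq]
  have hssa : star s = s := by simp [hs, hq.isSelfAdjoint.star_eq]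
  have hvw : v * star w = 0 := by
    have : r * star w = 0 := by simpa [hrsa] using congrArg star hwr
    rw [← hvr, mul_assoc, this, mul_zero]
  have hwv : star w * v = 0 := by
    have : star w * s = 0 := by simpa [hssa] using congrArg star hsw
    rw [← hsv, ← mul_assoc, this, zero_mul]
  have hwv' : w * star v = 0 := by simpa using congrArg star hvw
  have hvw' : star v * w = 0 := by simpa using congrArg star hwv
  have hv : v * star v * v = v := h.partialIsometry_of_star_mul_self he hve
  have e1 : star (w + v) * (w + v) = star w * w + star v * v := by
    rw [star_add, add_mul, mul_add, mul_add, hwv, hvw']; abel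
  have hnew : (w + v) * star (w + v) * (w + v) = w + v := by
    rw [mul_assoc, e1, add_mul, mul_add, mul_add, ← mul_assoc, ← mul_assoc, ← mul_assoc,
      ← mul_assoc, hw, hv, hwv', hvw]; simp
  have := hmax ⟨w + v, hnew, by rw [add_mul, hwp, ← hvr, mul_assoc, hrp],
    by rw [mul_add, hqw, ← hsv, ← mul_assoc, hqs]⟩ ⟨by
      simp only
      rw [add_mul, ← mul_assoc, ← mul_assoc, hw, hvw, zero_mul, add_zero], by
      simp only
      rw [mul_add, hw, mul_assoc, hwv, mul_zero, add_zero]⟩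
  simp only [e1, map_add, Complex.add_re, hve] at this
  exact he0 (h.eq_zero_of_re_proj he (by linarith))

/-- Close projections of equal trace in a factor are equivalent via a partial isometry close to
them. -/
theorem exists_partialIsometry_near (hprime : ∀ x y : A, (∀ a, x * a * y = 0) → x = 0 ∨ y = 0)
    {p q : A} (hp : IsStarProjection p) (hq : IsStarProjection q) (hpq : τ p = τ q) :
    ∃ w, star w * w = p ∧ w * star w = q ∧ l2 τ (w - p) ≤ 4 * l2 τ (q - p) := by
  have hpsa := hp.isSelfAdjoint.star_eq
  have hqsa := hq.isSelfAdjoint.star_eq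
  have hpp := hp.isIdempotentElem.eq
  have hqq := hq.isIdempotentElem.eq
  have hx1 : ‖q * p‖ ≤ 1 :=
    (norm_mul_le _ _).trans (by nlinarith [hp.norm_le, hq.norm_le, norm_nonneg p, norm_nonneg q])
  -- The polar part of `q p` is used only where `p q p > 1/2`. The rest of `p` is small in trace,
  -- and any extension to it will do.
  obtain ⟨w₀, e, he, hwe, ⟨k, hk⟩, hwe', hez, -, hcomm, hpos, hnear⟩ :=
    h.exists_polarCut (q * p) (c := 1 / 2) (by norm_num)
  have hnear := hnear (by norm_num) hx1
  have hesa := he.isSelfAdjoint.star_eq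
  have hee := he.isIdempotentElem.eq
  set x := q * p with hx
  set b := star x * x with hb
  have hxp : x * p = x := by rw [hx, mul_assoc, hpp]
  have hbp : b * p = b := by rw [hb, mul_assoc, hxp]
  have hep : e * p = e := by
    have := hez (1 - p) (by rw [mul_sub, mul_one, hxp, sub_self])
    rw [mul_sub, mul_one, sub_eq_zero] at this
    exact this.symm
  have hpe : p * e = e := by simpa [hpsa, hesa] using congrArg star hep
  obtain ⟨w, hw, hwp, hqw, hww₀, hor⟩ := h.exists_extension hprime hp hq
    (h.partialIsometry_of_star_mul_self he hwe) (by rw [← hwe', mul_assoc, hep])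
    (by rw [hk, ← mul_assoc, hx, ← mul_assoc, hqq])
  rw [hwe] at hww₀
  -- The extension exhausts one of the two projections; equality of traces and faithfulness force it
  -- to exhaust the other as well.
  have hboth : star w * w = p ∧ w * star w = q := by
    have htr : τ (star w * w) = τ (w * star w) := h.tracial _ _
    rcases hor with h1 | h1
    · refine ⟨h1, ?_⟩
      have hq' : IsStarProjection (q - w * star w) :=
        (isStarProjection_mul_star_self hw).sub_of_mul_eq_right hq (by rw [← mul_assoc, hqw])
      have := h.eq_zero_of_re_proj hq' (by rw [map_sub, ← htr, h1, hpq, sub_self]; rfl)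
      exact (sub_eq_zero.1 this).symm
    · refine ⟨?_, h1⟩
      have hp' : IsStarProjection (p - star w * w) :=
        (isStarProjection_star_mul_self hw).sub_of_mul_eq_left hp (by rw [mul_assoc, hwp])
      have := h.eq_zero_of_re_proj hp' (by rw [map_sub, htr, h1, hpq, sub_self]; rfl)
      exact (sub_eq_zero.1 this).symm
  refine ⟨w, hboth.1, hboth.2, ?_⟩
  have hpeproj : IsStarProjection (p - e) := he.sub_of_mul_eq_left hp hep
  set d := l2 τ (q - p) with hd
  have hd0 : 0 ≤ d := h.l2_nonneg _
  have hbpq : τ b = τ (q * p) := by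
    rw [hb, hx, star_mul, hpsa, hqsa, mul_assoc, ← mul_assoc q, hqq, h.tracial, mul_assoc, hpp]
  have hD : d ^ 2 = 2 * ((τ p).re - (τ b).re) := by
    have e1 : star (q - p) * (q - p) = q + p - q * p - star (q * p) := by
      simp only [star_sub, star_mul, hpsa, hqsa]
      rw [sub_mul, mul_sub, mul_sub, hqq, hpp]; abel
    rw [hd, h.l2_sq, e1, map_sub, map_sub, map_add, h.map_star, hbpq, hpq]
    simp only [Complex.sub_re, Complex.add_re, Complex.star_def, Complex.conj_re]
    ring
  have h1 := h.re_mul_nonneg he.nonneg (star_mul_self_nonneg ((1 - q) * p))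
  have e1 : e * (star ((1 - q) * p) * ((1 - q) * p)) = e - e * b := by
    rw [star_mul, hpsa, hq.one_sub.isSelfAdjoint.star_eq, hb, hx, star_mul, hpsa, hqsa]
    calc e * (p * (1 - q) * ((1 - q) * p)) = e * p * ((1 - q) * (1 - q)) * p := by noncomm_ring
      _ = e * p - e * p * q * p := by
        rw [hq.one_sub.isIdempotentElem.eq, mul_sub, sub_mul, mul_one, mul_assoc e p p, hpp]
      _ = e - e * (p * q * (q * p)) := by
        rw [hep, mul_assoc p, ← mul_assoc q q, hqq]
        congr 1
        conv_lhs => rw [← hep]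
        simp only [mul_assoc]
  rw [e1, map_sub, Complex.sub_re] at h1
  have h2 := h.re_mul_nonneg hpos hp.nonneg
  have e2 : (1 - e) * (algebraMap ℝ A (1 / 2) - b) * p
      = ((1 / 2 : ℝ) : ℂ) • (p - e) - (b - e * b) := by
    rw [mul_assoc, sub_mul _ b, hbp, Algebra.algebraMap_eq_smul_one, smul_mul_assoc, one_mul,
      mul_sub, mul_smul_comm, sub_mul, one_mul, hep, sub_mul, one_mul, Complex.coe_smul]
  rw [e2, map_sub, map_smul, smul_eq_mul, Complex.sub_re, Complex.re_ofReal_mul, map_sub, map_sub,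
    Complex.sub_re, Complex.sub_re] at h2
  -- From `b ≤ 1/2` off `e` one has `τ(b - eb) ≤ τ(p - e)/2`, and `τ(eb) ≤ τ(e)`. Together these
  -- give `τ(p - e) ≤ 2 τ(p - b) = d²`.
  have hT : l2 τ (p - e) ^ 2 ≤ d ^ 2 := by
    rw [h.l2_proj_sq hpeproj, map_sub, Complex.sub_re]
    linarith
  have hT' : l2 τ (p - e) ≤ d := (pow_le_pow_iff_left₀ (h.l2_nonneg _) hd0 two_ne_zero).1 hT
  have hE : l2 τ ((w - x) * e) ≤ d := by
    refine (pow_le_pow_iff_left₀ (h.l2_nonneg _) hd0 two_ne_zero).1 ?_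
    rw [sub_mul, hww₀]
    have h3 := h.proj_re_nonneg hpeproj
    rw [map_sub, Complex.sub_re] at h3
    linarith
  have hF : l2 τ ((w - x) * (p - e)) ≤ 2 * d := by
    rw [sub_mul]
    refine (h.l2_sub_le _ _).trans ?_
    have h3 := h.l2_mul_le w (p - e)
    have h4 := h.l2_mul_le x (p - e)
    have h5 := norm_le_one_of_partialIsometry hw
    have h6 := h.l2_nonneg (p - e)
    nlinarith
  have hG : w - x = (w - x) * e + (w - x) * (p - e) := by
    rw [← mul_add, add_sub_cancel, sub_mul, hwp, hxp]
  have hH : l2 τ (x - p) ≤ d := by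
    have : x - p = (q - p) * p := by rw [sub_mul, hpp]
    rw [this]
    exact h.l2_mul_proj_le hp _
  -- The constant is `1 + 2 + 1`: the part of `w - x` on `e`, the part on `p - e` where both are
  -- contractions, and `x - p`.
  calc l2 τ (w - p) ≤ l2 τ (w - x) + l2 τ (x - p) := h.l2_sub_le_sub_add_sub _ _ _
    _ ≤ (l2 τ ((w - x) * e) + l2 τ ((w - x) * (p - e))) + l2 τ (x - p) := by
        gcongr
        conv_lhs => rw [hG]
        exact h.l2_add_le _ _
    _ ≤ 4 * d := by linarith

end IsTracialWStar

end Factor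

/-! ### Uniqueness of the trace of a factor -/

section Dixmier

variable {A : Type*} [CStarAlgebra A] [PartialOrder A] [StarOrderedRing A]

/-- The self-adjoint unitary `w + w* + (1 - p - f)` exchanges `p` with the orthogonal projection `f
= w w*`. The excess `d p` and its conjugate `d f` then sit side by side below `d`, rather than
adding up to `2d`. -/
lemma exists_unitary_add_conj_le {a p w : A} {c d : ℝ} (hd : 0 ≤ d) (hp : IsStarProjection p)
    (hw : star w * w = p) (hwp : w * p = w) (hwp' : w * star w * p = 0) (ha : a ≤ c • 1 + d • p) :
    ∃ u ∈ unitary A, a + u * a * star u ≤ (2 * c + d) • 1 := by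
  set f := w * star w with hf
  have hpsa := hp.isSelfAdjoint.star_eq
  have hpp := hp.isIdempotentElem.eq
  have hfsa : star f = f := by simp [hf]
  have hpw : p * star w = star w := by simpa [hpsa] using congrArg star hwp
  have hfw : f * w = w := by rw [hf, mul_assoc, hw, hwp]
  have hff : f * f = f := by
    conv_lhs => rw [hf, mul_assoc, ← hf]
    have := congrArg star hfw
    rw [star_mul, hfsa] at this
    rw [this, hf]
  have hpf : p * f = 0 := by simpa [hfsa, hpsa] using congrArg star hwp'
  have hpw0 : p * w = 0 := by rw [← hfw, ← mul_assoc, hpf, zero_mul]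
  have hsw : star w * p = 0 := by simpa [hpsa] using congrArg star hpw0
  have hww : w * w = 0 := by
    calc w * w = w * p * w := by rw [hwp]
      _ = 0 := by rw [mul_assoc, hpw0, mul_zero]
  have hww' : star w * star w = 0 := by simpa using congrArg star hww
  have hwf : w * f = 0 := by
    calc w * f = w * p * f := by rw [hwp]
      _ = 0 := by rw [mul_assoc, hpf, mul_zero]
  have hfw' : star w * f = star w := by simpa [hfsa] using congrArg star hfw
  have hfsw : f * star w = 0 := by simpa [hfsa] using congrArg star hwf
  have hsa : star (w + star w + (1 - p - f)) = w + star w + (1 - p - f) := by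
    simp only [star_add, star_sub, star_star, star_one, hpsa, hfsa]; abel
  have huu : (w + star w + (1 - p - f)) * (w + star w + (1 - p - f)) = 1 := by
    simp only [add_mul, mul_add, sub_mul, mul_sub, mul_one, one_mul, hww, hww', hw, hwp, hwf, hsw,
      hfw', hpw0, hpw, hfw, hfsw, hpf, hwp', hpp, hff]
    rw [← hf]
    abel
  have hupu : (w + star w + (1 - p - f)) * p * (w + star w + (1 - p - f)) = f := by
    have : (w + star w + (1 - p - f)) * p = w := by
      simp only [add_mul, sub_mul, one_mul, hwp, hsw, hpp, hwp']; abel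
    rw [this]
    simp only [mul_add, mul_sub, mul_one, hww, hwp, hwf]
    rw [← hf]; abel
  refine ⟨w + star w + (1 - p - f), ⟨by rw [hsa, huu], by rw [hsa, huu]⟩, ?_⟩
  set u := w + star w + (1 - p - f) with hu
  rw [hsa]
  have h1 := star_left_conjugate_le_conjugate ha u
  rw [hsa, mul_add u, add_mul _ _ u, mul_smul_comm, mul_smul_comm, smul_mul_assoc, smul_mul_assoc,
    hupu, mul_one, huu] at h1
  have hproj : IsStarProjection (1 - p - f) := by
    refine ⟨?_, by simp [IsSelfAdjoint, hpsa, hfsa]⟩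
    simp only [IsIdempotentElem, sub_mul, mul_sub, mul_one, one_mul, hpp, hff, hpf, hwp']
    abel
  have h2 : d • (p + f) ≤ d • (1 : A) := by
    have := smul_nonneg hd hproj.nonneg
    rw [← sub_nonneg, ← smul_sub]
    convert this using 2
    abel
  calc a + u * a * u ≤ (c • 1 + d • p) + (c • 1 + d • f) := add_le_add ha h1
    _ = (2 * c) • 1 + d • (p + f) := by rw [smul_add, two_mul, add_smul]; abel
    _ ≤ (2 * c) • 1 + d • 1 := by gcongr
    _ = (2 * c + d) • 1 := by rw [add_smul]

namespace IsTracialWStar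

variable {τ : A →ₗ[ℂ] ℂ} (h : IsTracialWStar τ)
include h

/-- Cut the spectrum at its midpoint. One of the two spectral projections is equivalent to a
subprojection of the other; moving it there improves one of the bounds on `a + u a u*` by `(β -
α)/2`, so the trivial width `2(β - α)` drops to `3/2 (β - α)`. -/
lemma exists_unitary_average (hprime : ∀ x y : A, (∀ a, x * a * y = 0) → x = 0 ∨ y = 0)
    {a : A} (ha : IsSelfAdjoint a) {α β : ℝ} (h1 : α • 1 ≤ a) (h2 : a ≤ β • 1) (hαβ : α ≤ β) :
    ∃ u ∈ unitary A, ∃ α' β' : ℝ, α' • 1 ≤ a + u * a * star u ∧ a + u * a * star u ≤ β' • 1 ∧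
      β' - α' = 3 / 2 * (β - α) := by
  set c := (α + β) / 2 with hc
  obtain ⟨e, he, hcomm, hpos, hneg, -⟩ := h.exists_specProj ha c
  rw [Algebra.algebraMap_eq_smul_one] at hpos hneg
  have hesa := he.isSelfAdjoint.star_eq
  have hee := he.isIdempotentElem.eq
  have hee' := he.one_sub.isIdempotentElem.eq
  have up : a ≤ c • 1 + (β - c) • e := by
    have := star_left_conjugate_nonneg (sub_nonneg.2 h2) e
    rw [hesa] at this
    have := add_nonneg this hneg
    rw [← sub_nonneg]
    convert this using 1
    have : e * (β • 1 - a) * e = β • e - a * e := by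
      rw [mul_sub, sub_mul, mul_smul_comm, mul_one, smul_mul_assoc, hee, hcomm, mul_assoc, hee]
    rw [this, sub_mul, one_mul, mul_sub, mul_smul_comm, mul_one, hcomm, sub_smul]
    abel
  have down : -a ≤ (-c) • 1 + (c - α) • (1 - e) := by
    have := star_left_conjugate_nonneg (sub_nonneg.2 h1) (1 - e)
    rw [he.one_sub.isSelfAdjoint.star_eq] at this
    have := add_nonneg this hpos
    rw [← sub_nonneg]
    convert this using 1
    have hcomm' : (1 - e) * a = a * (1 - e) := by rw [sub_mul, mul_sub, hcomm, one_mul, mul_one]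
    have : (1 - e) * (a - α • 1) * (1 - e) = a * (1 - e) - α • (1 - e) := by
      rw [mul_sub (1 - e), sub_mul _ _ (1 - e), mul_smul_comm, mul_one, smul_mul_assoc, hee', hcomm',
        mul_assoc, hee']
    rw [this, mul_sub, mul_sub, mul_smul_comm, mul_one, mul_one, hcomm, neg_smul, sub_smul,
      smul_sub, smul_sub]
    abel
  have conj_lower : ∀ u ∈ unitary A, (2 * α) • 1 ≤ a + u * a * star u := fun u hu => by
    have := star_right_conjugate_le_conjugate h1 u
    rw [mul_smul_comm, mul_one, smul_mul_assoc, (Unitary.mem_iff.1 hu).2] at this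
    rw [two_mul, add_smul]
    exact add_le_add h1 this
  have conj_upper : ∀ u ∈ unitary A, a + u * a * star u ≤ (2 * β) • 1 := fun u hu => by
    have := star_right_conjugate_le_conjugate h2 u
    rw [mul_smul_comm, mul_one, smul_mul_assoc, (Unitary.mem_iff.1 hu).2] at this
    rw [two_mul, add_smul]
    exact add_le_add h2 this
  obtain ⟨w, hw, hwe, hew, -, hor⟩ := h.exists_extension hprime (w₀ := 0) he he.one_sub
    (by simp) (by simp) (by simp)
  rcases hor with hor | hor
  · obtain ⟨u, hu, hle⟩ := exists_unitary_add_conj_le (by rw [hc]; linarith) he hor hwe (by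
      have : star w * e = 0 := by
        have := congrArg star hew
        rw [star_mul, he.one_sub.isSelfAdjoint.star_eq] at this
        rw [← this, mul_assoc, he.one_sub_mul_self, mul_zero]
      rw [mul_assoc, this, mul_zero]) up
    refine ⟨u, hu, 2 * α, 2 * c + (β - c), conj_lower u hu, hle, by rw [hc]; ring⟩
  · obtain ⟨u, hu, hle⟩ := exists_unitary_add_conj_le (w := star w) (by rw [hc]; linarith)
      he.one_sub (by rw [star_star, hor]) (by
        have := congrArg star hew
        rwa [star_mul, he.one_sub.isSelfAdjoint.star_eq] at this)
      (by rw [star_star, ← hwe, mul_assoc, mul_assoc, he.mul_one_sub_self, mul_zero, mul_zero])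
      down
    refine ⟨u, hu, c + α, 2 * β, ?_, conj_upper u hu, by rw [hc]; ring⟩
    rw [← neg_le_neg_iff, ← neg_smul]
    convert hle using 1
    · rw [mul_neg, neg_mul]; abel
    · congr 1; ring

/-- Dixmier averaging: replacing `a` by `a + u a u*` doubles the value of every tracial state but
multiplies the spectral width by only `3/2`, so each round gains a factor `3/4`. -/
lemma norm_apply_sub_le (hprime : ∀ x y : A, (∀ a, x * a * y = 0) → x = 0 ∨ y = 0)
    {σ : A →ₗ[ℂ] ℂ} (hσ : IsTracialState σ) (n : ℕ) :
    ∀ {a : A}, IsSelfAdjoint a → ∀ {α β : ℝ}, α • 1 ≤ a → a ≤ β • 1 → α ≤ β →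
      ‖σ a - τ a‖ ≤ (3 / 4) ^ n * (β - α) := by
  have him : ∀ {ω : A →ₗ[ℂ] ℂ}, IsTracialState ω → ∀ {a : A}, IsSelfAdjoint a →
      ω a = ((ω a).re : ℂ) := fun hω a ha => by
    have := hω.map_star a
    rw [ha.star_eq] at this
    exact (Complex.conj_eq_iff_re.1 this.symm).symm
  induction n with
  | zero =>
    intro a ha α β h1 h2 _
    have hb : ∀ {ω : A →ₗ[ℂ] ℂ}, IsTracialState ω → α ≤ (ω a).re ∧ (ω a).re ≤ β := fun hω => by
      have l1 := hω.re_mono h1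
      have l2 := hω.re_mono h2
      rw [← Complex.coe_smul, map_smul, hω.map_one] at l1 l2
      rw [smul_eq_mul, mul_one, Complex.ofReal_re] at l1 l2
      exact ⟨l1, l2⟩
    rw [him hσ ha, him h.toIsTracialState ha, ← Complex.ofReal_sub, Complex.norm_real,
      Real.norm_eq_abs, abs_le]
    have := hb hσ
    have := hb h.toIsTracialState
    constructor <;> linarith
  | succ n ih =>
    intro a ha α β h1 h2 hαβ
    obtain ⟨u, hu, α', β', h3, h4, h5⟩ := h.exists_unitary_average hprime ha h1 h2 hαβ
    have hconj : ∀ {ω : A →ₗ[ℂ] ℂ}, IsTracialState ω → ω (a + u * a * star u) = 2 * ω a :=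
      fun hω => by
        rw [map_add, hω.tracial, ← mul_assoc, (Unitary.mem_iff.1 hu).1, one_mul, two_mul]
    have := ih (a := a + u * a * star u) (by
      simp only [IsSelfAdjoint, star_add, star_mul, star_star, ha.star_eq, mul_assoc]) h3 h4
      (by linarith)
    rw [hconj hσ, hconj h.toIsTracialState, ← mul_sub, norm_mul, h5] at this
    rw [show ‖(2 : ℂ)‖ = 2 by simp] at this
    rw [pow_succ]
    linarith

/-- The tracial state of a factor is unique. -/
theorem eq_of_isTracialState (hprime : ∀ x y : A, (∀ a, x * a * y = 0) → x = 0 ∨ y = 0)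
    {σ : A →ₗ[ℂ] ℂ} (hσ : IsTracialState σ) : σ = τ := by
  have key : ∀ a : A, IsSelfAdjoint a → σ a = τ a := fun a ha => by
    rw [← sub_eq_zero, ← norm_le_zero_iff]
    have h1 := ha.neg_algebraMap_norm_le_self
    have h2 := ha.le_algebraMap_norm_self
    rw [Algebra.algebraMap_eq_smul_one] at h1 h2
    rw [← neg_smul] at h1
    have h0 : Tendsto (fun n : ℕ => (3 / 4 : ℝ) ^ n * (‖a‖ - -‖a‖)) atTop (𝓝 0) := by
      have := (tendsto_pow_atTop_nhds_zero_of_lt_one (r := (3 / 4 : ℝ)) (by norm_num)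
        (by norm_num)).mul_const (‖a‖ - -‖a‖)
      simpa using this
    exact ge_of_tendsto' h0 fun n => h.norm_apply_sub_le hprime hσ n ha h1 h2
      (by linarith [norm_nonneg a])
  ext a
  rw [← realPart_add_I_smul_imaginaryPart a]
  simp only [map_add, map_smul, key _ (realPart a).2, key _ (imaginaryPart a).2]

end IsTracialWStar

end Dixmier

/-! ### Diffuseness -/

section Diffuse

variable {A : Type*} [CStarAlgebra A] [PartialOrder A] [StarOrderedRing A]

/-- `S` has no minimal projections. -/
def IsDiffuse (S : StarSubalgebra ℂ A) : Prop :=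
  ∀ r ∈ S, IsStarProjection r → r ≠ 0 → ∃ b ∈ S, 0 ≤ b ∧ b * r = b ∧ ∀ c : ℂ, b ≠ c • r

lemma isStarProjection_sub {p q : A} (hp : IsStarProjection p) (hq : IsStarProjection q)
    (hpq : q * p = p) : IsStarProjection (q - p) := by
  have h2 : p * q = p := by
    simpa [hp.isSelfAdjoint.star_eq, hq.isSelfAdjoint.star_eq] using congrArg star hpq
  refine ⟨?_, hq.isSelfAdjoint.sub hp.isSelfAdjoint⟩
  rw [IsIdempotentElem, mul_sub, sub_mul, sub_mul, hq.isIdempotentElem.eq, hp.isIdempotentElem.eq,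
    hpq, h2, sub_self, sub_zero]

lemma isStarProjection_add {p q : A} (hp : IsStarProjection p) (hq : IsStarProjection q)
    (hpq : q * p = 0) : IsStarProjection (q + p) := by
  have h2 : p * q = 0 := by
    simpa [hp.isSelfAdjoint.star_eq, hq.isSelfAdjoint.star_eq] using congrArg star hpq
  refine ⟨?_, hq.isSelfAdjoint.add hp.isSelfAdjoint⟩
  rw [IsIdempotentElem, mul_add, add_mul, add_mul, hq.isIdempotentElem.eq, hp.isIdempotentElem.eq,
    hpq, h2, add_zero, zero_add]

namespace IsTracialWStar

variable {τ : A →ₗ[ℂ] ℂ} (h : IsTracialWStar τ)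
include h

lemma eq_zero_of_nonneg_of_re {a : A} (ha : 0 ≤ a) (h0 : (τ a).re = 0) : a = 0 := by
  obtain ⟨b, rfl⟩ := CStarAlgebra.nonneg_iff_eq_star_mul_self.1 ha
  have : b = 0 := h.eq_zero_of_l2 (by rw [l2, h0, Real.sqrt_zero])
  rw [this, mul_zero]

lemma proj_re_pos {p : A} (hp : IsStarProjection p) (h0 : p ≠ 0) : 0 < (τ p).re :=
  lt_of_le_of_ne (h.proj_re_nonneg hp) fun h' => h0 (h.eq_zero_of_re_proj hp h'.symm)

/-- Copies of a minimal projection `r` are packed as long as possible. If the packing stops, the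
copies add up to `1` and matrix units span the algebra; if it never stops, the trace of `1` exceeds
any multiple of `τ(r)`. -/
lemma finiteDimensional_of_minimal (hprime : ∀ x y : A, (∀ a, x * a * y = 0) → x = 0 ∨ y = 0)
    {r : A} (hr : IsStarProjection r) (hr0 : r ≠ 0) (hmin : ∀ x, ∃ c : ℂ, r * x * r = c • r) :
    FiniteDimensional ℂ A := by
  by_contra hfd
  have hrr := hr.isIdempotentElem.eq
  have hrsa := hr.isSelfAdjoint.star_eq
  have hfam : ∀ k : ℕ, ∃ v : Fin k → A, (∀ i, v i * r = v i) ∧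
      ∀ i j, star (v i) * v j = if i = j then r else 0 := by
    intro k
    induction k with
    | zero => exact ⟨Fin.elim0, fun i => i.elim0, fun i => i.elim0⟩
    | succ k ih =>
      obtain ⟨v, hv, hvv⟩ := ih
      set e := ∑ i, v i * star (v i) with he
      have hev : ∀ j, e * v j = v j := fun j => by
        simp [he, Finset.sum_mul, mul_assoc, hvv, hv]
      have hep : IsStarProjection e := by
        refine ⟨?_, by simp [IsSelfAdjoint, he]⟩
        rw [IsIdempotentElem]
        conv_lhs => enter [2]; rw [he]
        simp only [Finset.mul_sum, ← mul_assoc, hev]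
        exact he.symm
      obtain ⟨w, hw, hwr, hqw, -, hor⟩ := h.exists_extension hprime (w₀ := 0) hr hep.one_sub
        (by simp) (by simp) (by simp)
      have hrw : r * star w = star w := by simpa [hrsa] using congrArg star hwr
      have hvw : ∀ i, star (v i) * w = 0 := fun i => by
        have h1 : star (v i) * e = star (v i) := by
          simpa [hep.isSelfAdjoint.star_eq] using congrArg star (hev i)
        rw [← hqw, ← mul_assoc, mul_sub, h1, mul_one, sub_self, zero_mul]
      -- When `w` exhausts `1 - e` instead of `r`, minimality makes `w* w` either `0` or `r`. The
      -- value `0` means `e = 1`, and then the products `v i * star (v j)` span `A`.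
      have hww : star w * w = r := by
        rcases hor with hor | hor
        · exact hor
        · obtain ⟨c, hc⟩ := hmin (star w * w)
          have hc' : star w * w = c • r := by
            rw [← hc, ← mul_assoc, hrw, mul_assoc, hwr]
          have hid := (isStarProjection_star_mul_self hw).isIdempotentElem.eq
          rw [hc', smul_mul_smul_comm, hrr, ← sub_eq_zero, ← sub_smul, smul_eq_zero] at hid
          have hcc : c = 0 ∨ c = 1 := by
            have : c * (c - 1) = 0 := by rw [← hid.resolve_right hr0]; ring
            rcases mul_eq_zero.1 this with h1 | h1
            · exact Or.inl h1
            · exact Or.inr (sub_eq_zero.1 h1)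
          rcases hcc with rfl | rfl
          · exfalso
            rw [zero_smul, CStarRing.star_mul_self_eq_zero_iff] at hc'
            rw [hc', zero_mul] at hor
            have he1 : e = 1 := (sub_eq_zero.1 hor.symm).symm
            apply hfd
            have hspan : (⊤ : Submodule ℂ A)
                = Submodule.span ℂ (Set.range fun ij : Fin k × Fin k => v ij.1 * star (v ij.2)) := by
              refine le_antisymm (fun x _ => ?_) le_top
              have hx : x = ∑ i, ∑ j, v i * (star (v i) * x * v j) * star (v j) := by
                calc x = e * x * e := by rw [he1, one_mul, mul_one]
                  _ = _ := by
                    simp only [he, Finset.sum_mul, Finset.mul_sum, mul_assoc]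
                    exact Finset.sum_comm
              rw [hx]
              refine Submodule.sum_mem _ fun i _ => Submodule.sum_mem _ fun j _ => ?_
              obtain ⟨c, hc⟩ := hmin (star (v i) * x * v j)
              have h1 : star (v i) * x * v j = c • r := by
                have h2 : r * star (v i) = star (v i) := by simpa [hrsa] using congrArg star (hv i)
                calc star (v i) * x * v j = r * star (v i) * x * (v j * r) := by rw [h2, hv]
                  _ = r * (star (v i) * x * v j) * r := by simp only [mul_assoc]
                  _ = _ := hc
              rw [h1, mul_smul_comm, smul_mul_assoc, hv]
              exact Submodule.smul_mem _ _ (Submodule.subset_span ⟨(i, j), rfl⟩)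
            exact Module.finite_def.2 (hspan ▸ Submodule.fg_span (Set.finite_range _))
          · rw [hc', one_smul]
      refine ⟨Fin.cons w v, fun i => ?_, fun i j => ?_⟩
      · refine Fin.cases ?_ (fun i => ?_) i
        · simpa using hwr
        · simpa using hv i
      · have hwv : ∀ i, star w * v i = 0 := fun i => by simpa using congrArg star (hvw i)
        refine Fin.cases ?_ (fun i => ?_) i <;> refine Fin.cases ?_ (fun j => ?_) j
        · simpa using hww
        · simp [hwv, (Fin.succ_ne_zero _).symm]
        · simp [hvw]
        · simp [hvv]
  have hpos := h.proj_re_pos hr hr0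
  obtain ⟨k, hk⟩ := exists_nat_gt (1 / (τ r).re)
  obtain ⟨v, hv, hvv⟩ := hfam k
  set e := ∑ i, v i * star (v i) with he
  have hev : ∀ j, e * v j = v j := fun j => by
    simp [he, Finset.sum_mul, mul_assoc, hvv, hv]
  have hep : IsStarProjection e := by
    refine ⟨?_, by simp [IsSelfAdjoint, he]⟩
    rw [IsIdempotentElem]
    conv_lhs => enter [2]; rw [he]
    simp only [Finset.mul_sum, ← mul_assoc, hev]
    exact he.symm
  have h1 := h.re_apply_nonneg hep.one_sub.nonneg
  have h2 : τ e = k * τ r := by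
    rw [he, map_sum]
    simp [h.tracial _ (star _), hvv]
  rw [map_sub, h.map_one, h2, ← Complex.ofReal_natCast] at h1
  simp only [Complex.sub_re, Complex.one_re, Complex.re_ofReal_mul] at h1
  rw [div_lt_iff₀ hpos] at hk
  linarith

/-- An infinite dimensional factor is diffuse. -/
lemma isDiffuse_top (hprime : ∀ x y : A, (∀ a, x * a * y = 0) → x = 0 ∨ y = 0)
    (hfd : ¬ FiniteDimensional ℂ A) : IsDiffuse (⊤ : StarSubalgebra ℂ A) := by
  intro r _ hr hr0
  by_contra! hcon
  refine hfd (h.finiteDimensional_of_minimal hprime hr hr0 fun x => ?_)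
  have hpos : ∀ a : A, 0 ≤ a → ∃ c : ℂ, r * a * r = c • r := fun a ha => by
    have h1 := star_left_conjugate_nonneg ha r
    rw [hr.isSelfAdjoint.star_eq] at h1
    exact hcon _ trivial h1 (by rw [mul_assoc _ r r, hr.isIdempotentElem.eq])
  obtain ⟨y, hy, -, hxy⟩ := CStarAlgebra.exists_sum_four_nonneg x
  choose c hc using fun i => hpos (y i) (hy i)
  refine ⟨∑ i : Fin 4, Complex.I ^ (i : ℕ) * c i, ?_⟩
  rw [hxy, Finset.mul_sum, Finset.sum_mul, Finset.sum_smul]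
  refine Finset.sum_congr rfl fun i _ => ?_
  rw [mul_smul_comm, smul_mul_assoc, hc, smul_smul]

/-- Cut a nonscalar positive element of the corner at its mean value. A trivial spectral projection
would put `b - c r` on one side of `0`; having trace zero, it would vanish. -/
lemma exists_split {S : StarSubalgebra ℂ A} (hS : IsL2Closed τ (S : Set A)) (hd : IsDiffuse S)
    {r : A} (hrS : r ∈ S) (hr : IsStarProjection r) (hr0 : r ≠ 0) :
    ∃ f ∈ S, IsStarProjection f ∧ f * r = f ∧ f ≠ 0 ∧ f ≠ r := by
  obtain ⟨b, hbS, hb0, hbr, hbc⟩ := hd r hrS hr hr0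
  have hrsa := hr.isSelfAdjoint.star_eq
  have hrb : r * b = b := by simpa [hrsa, hb0.isSelfAdjoint.star_eq] using congrArg star hbr
  have hrpos := h.proj_re_pos hr hr0
  have hbpos : 0 < (τ b).re := lt_of_le_of_ne (h.re_apply_nonneg hb0) fun h' =>
    hbc 0 (by rw [zero_smul]; exact h.eq_zero_of_nonneg_of_re hb0 h'.symm)
  set c := (τ b).re / (τ r).re with hc
  have hcpos : 0 < c := by positivity
  obtain ⟨f, hf, hfb, hf1, hf2, hfS⟩ := h.exists_specProj hb0.isSelfAdjoint c
  rw [Algebra.algebraMap_eq_smul_one] at hf1 hf2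
  have hsc : ∀ x : A, c • x = (c : ℂ) • x := fun x => (Complex.coe_smul c x).symm
  have htr : ∀ ε : ℝ, (τ (ε • (b - c • r))).re = 0 := fun ε => by
    rw [← Complex.coe_smul, hsc, map_smul, map_sub, map_smul, smul_eq_mul, smul_eq_mul,
      Complex.re_ofReal_mul, Complex.sub_re, Complex.re_ofReal_mul, hc, div_mul_cancel₀ _ hrpos.ne',
      sub_self, mul_zero]
  have hfr : f * r = f := by
    have h1 := star_left_conjugate_nonneg hf1 (1 - r)
    rw [hr.one_sub.isSelfAdjoint.star_eq] at h1
    have e1 : (1 - r) * (f * (b - c • 1)) * (1 - r) = -(c • (star (f * (1 - r)) * (f * (1 - r)))) := by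
      have hb1 : b * (1 - r) = 0 := by rw [mul_sub, mul_one, hbr, sub_self]
      rw [star_mul, hf.isSelfAdjoint.star_eq, hr.one_sub.isSelfAdjoint.star_eq, mul_assoc (1 - r) f,
        ← mul_assoc f f, hf.isIdempotentElem.eq, mul_assoc, mul_assoc, sub_mul b, hb1, zero_sub,
        smul_mul_assoc, one_mul, mul_neg, mul_neg, mul_smul_comm, mul_smul_comm]
    rw [e1, Left.nonneg_neg_iff] at h1
    have h2 : 0 ≤ c • (star (f * (1 - r)) * (f * (1 - r))) :=
      smul_nonneg hcpos.le (star_mul_self_nonneg _)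
    have h3 := (smul_eq_zero.1 (le_antisymm h1 h2)).resolve_left hcpos.ne'
    rw [CStarRing.star_mul_self_eq_zero_iff, mul_sub, mul_one, sub_eq_zero] at h3
    exact h3.symm
  refine ⟨f, hfS S hS hbS, hf, hfr, ?_, ?_⟩
  · rintro rfl
    have h1 := star_left_conjugate_nonneg hf2 r
    have e1 : star r * ((1 - 0) * (c • 1 - b)) * r = (-1 : ℝ) • (b - c • r) := by
      rw [hrsa, sub_zero, one_mul, mul_sub, sub_mul _ _ r, mul_smul_comm, mul_one, smul_mul_assoc,
        hr.isIdempotentElem.eq, mul_assoc, hbr, hrb, neg_smul, one_smul, neg_sub]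
    rw [e1] at h1
    have h2 := h.eq_zero_of_nonneg_of_re h1 (htr _)
    rw [neg_smul, one_smul, neg_eq_zero, sub_eq_zero, hsc] at h2
    exact hbc _ h2
  · rintro rfl
    rw [mul_sub, hrb, mul_smul_comm, mul_one, ← one_smul ℝ (b - c • f)] at hf1
    have h2 := h.eq_zero_of_nonneg_of_re hf1 (htr _)
    rw [one_smul, sub_eq_zero, hsc] at h2
    exact hbc _ h2

/-- Split repeatedly and keep the piece of smaller trace, which at least halves it. -/
lemma exists_small {S : StarSubalgebra ℂ A} (hS : IsL2Closed τ (S : Set A)) (hd : IsDiffuse S)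
    {r : A} (hrS : r ∈ S) (hr : IsStarProjection r) (hr0 : r ≠ 0) {ε : ℝ} (hε : 0 < ε) :
    ∃ f ∈ S, IsStarProjection f ∧ f * r = f ∧ f ≠ 0 ∧ (τ f).re < ε := by
  have key : ∀ k : ℕ, ∃ f ∈ S, IsStarProjection f ∧ f * r = f ∧ f ≠ 0 ∧
      (τ f).re ≤ (1 / 2) ^ k * (τ r).re := by
    intro k
    induction k with
    | zero => exact ⟨r, hrS, hr, hr.isIdempotentElem.eq, hr0, by simp⟩
    | succ k ih =>
      obtain ⟨f, hfS, hf, hfr, hf0, hle⟩ := ih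
      obtain ⟨g, hgS, hg, hgf, hg0, hgf'⟩ := h.exists_split hS hd hfS hf hf0
      have hfg : f * g = g := by
        simpa [hf.isSelfAdjoint.star_eq, hg.isSelfAdjoint.star_eq] using congrArg star hgf
      have hadd : (τ (f - g)).re = (τ f).re - (τ g).re := by simp
      have hpow : (1 / 2 : ℝ) ^ (k + 1) * (τ r).re = (1 / 2) ^ k * (τ r).re / 2 := by
        rw [pow_succ]; ring
      rw [hpow]
      rcases le_total (τ g).re ((τ f).re / 2) with hc | hc
      · exact ⟨g, hgS, hg, by rw [← hgf, mul_assoc, hfr], hg0, by linarith⟩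
      · exact ⟨f - g, S.sub_mem hfS hgS, isStarProjection_sub hg hf hfg,
          by rw [sub_mul, hfr, ← hgf, mul_assoc, hfr],
          fun h' => hgf' (sub_eq_zero.1 h').symm, by linarith⟩
  have hlim : Tendsto (fun k : ℕ => (1 / 2 : ℝ) ^ k * (τ r).re) atTop (𝓝 0) := by
    simpa using (tendsto_pow_atTop_nhds_zero_of_lt_one (r := (1 / 2 : ℝ)) (by norm_num)
      (by norm_num)).mul_const (τ r).re
  obtain ⟨k, hk⟩ := (hlim.eventually_lt_const hε).exists
  obtain ⟨f, hfS, hf, hfr, hf0, hle⟩ := key k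
  exact ⟨f, hfS, hf, hfr, hf0, hle.trans_lt hk⟩

/-- The projections of a diffuse algebra take all possible traces. -/
theorem exists_proj_trace_eq {S : StarSubalgebra ℂ A} (hS : IsL2Closed τ (S : Set A))
    (hd : IsDiffuse S) {r : A} (hrS : r ∈ S) (hr : IsStarProjection r) {t : ℝ} (ht : 0 ≤ t)
    (htr : t ≤ (τ r).re) : ∃ s ∈ S, IsStarProjection s ∧ s * r = s ∧ (τ s).re = t := by
  -- Exhaust from below: a maximal subprojection of trace at most `t` reaches `t`, since otherwise a
  -- projection smaller than the gap fits under its complement in `r`.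
  let X := {s : A // s ∈ S ∧ IsStarProjection s ∧ s * r = s ∧ (τ s).re ≤ t}
  have hdiff : ∀ {s s' : A}, IsStarProjection s → IsStarProjection s' → s' * s = s →
      l2 τ (s' - s) ^ 2 = (τ s').re - (τ s).re := fun h1 h2 h12 => by
    rw [h.l2_proj_sq (isStarProjection_sub h1 h2 h12), map_sub, Complex.sub_re]
  obtain ⟨⟨y, hyS, hy, hyr, hyt⟩, -, hmax⟩ := exists_exhaustion (X := X)
    (fun s s' => s'.1 * s.1 = s.1) (fun s => s.2.2.1.isIdempotentElem.eq)
    (fun x y z hxy hyz => by rw [← hxy, ← mul_assoc, hyz]) (fun s => (τ s.1).re) (C := t)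
    (fun s => s.2.2.2.2)
    (fun x y hxy => by
      have := hdiff x.2.2.1 y.2.2.1 hxy
      nlinarith [sq_nonneg (l2 τ (y.1 - x.1))])
    (fun x hx => by
      have hx' : ∀ k m, k ≤ m → (x m).1 * (x k).1 = (x k).1 := fun k m hkm => by
        induction m, hkm using Nat.le_induction with
        | base => exact (x k).2.2.1.isIdempotentElem.eq
        | succ m hm ih => rw [← ih, ← mul_assoc, hx]
      obtain ⟨y, hy⟩ := h.exists_tendsto_of_sq_le (C := 1) (D := t) (x := fun n => (x n).1)
        (t := fun n => (τ (x n).1).re) (fun n => (x n).2.2.1.norm_le) (fun n => (x n).2.2.2.2)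
        (fun k m hkm => (hdiff (x k).2.2.1 (x m).2.2.1 (hx' k m hkm)).le)
      refine ⟨⟨y, hS _ y (fun n => (x n).2.1) hy, ⟨?_, ?_⟩, ?_, ?_⟩, fun n => ?_⟩
      · refine h.eq_of_tendsto (h.toIsTracialState.tendsto_mul (fun n => (x n).2.2.1.norm_le) hy hy) ?_
        simpa only [(x _).2.2.1.isIdempotentElem.eq] using hy
      · refine h.eq_of_tendsto (h.toIsTracialState.tendsto_star hy) ?_
        simpa only [(x _).2.2.1.isSelfAdjoint.star_eq] using hy
      · refine h.eq_of_tendsto (h.toIsTracialState.tendsto_mul_const r hy) ?_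
        simpa only [(x _).2.2.2.1] using hy
      · refine le_of_tendsto' (Complex.continuous_re.continuousAt.tendsto.comp
          (h.toIsTracialState.tendsto_apply hy)) fun n => (x n).2.2.2.2
      · refine h.eq_of_tendsto (h.toIsTracialState.tendsto_mul_const (x n).1 hy) ?_
        refine tendsto_const_nhds.congr' ?_
        filter_upwards [eventually_ge_atTop n] with m hm
        rw [hx' n m hm, sub_self, h.l2_zero])
    ⟨0, S.zero_mem, IsStarProjection.zero A, by simp, by simpa using ht⟩
  refine ⟨y, hyS, hy, hyr, le_antisymm hyt ?_⟩
  by_contra! hlt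
  have hry : r * y = y := by
    simpa [hr.isSelfAdjoint.star_eq, hy.isSelfAdjoint.star_eq] using congrArg star hyr
  obtain ⟨f, hfS, hf, hfr, hf0, hft⟩ := h.exists_small hS hd (S.sub_mem hrS hyS)
    (isStarProjection_sub hy hr hry) (fun h' => by
      rw [sub_eq_zero.1 h'] at htr; linarith) (sub_pos.2 hlt)
  have hyf : f * y = 0 := by
    rw [← hfr, mul_assoc, sub_mul, hry, hy.isIdempotentElem.eq, sub_self, mul_zero]
  have hyf' : y * f = 0 := by
    simpa [hf.isSelfAdjoint.star_eq, hy.isSelfAdjoint.star_eq] using congrArg star hyf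
  have hfr' : f * r = f := by
    rw [← hfr, mul_assoc, sub_mul, hr.isIdempotentElem.eq, hyr]
  have hre : (τ (y + f)).re = (τ y).re + (τ f).re := by simp
  have := hmax ⟨y + f, S.add_mem hyS hfS, isStarProjection_add hf hy hyf', by
    rw [add_mul, hyr, hfr'], by rw [hre]; linarith⟩
    (by show (y + f) * y = y; rw [add_mul, hyf, hy.isIdempotentElem.eq, add_zero])
  simp only [hre] at this
  linarith [h.proj_re_pos hf hf0]

end IsTracialWStar

end Diffuse

/-! ### Projections almost contained in a subalgebra of finite index -/

section Expectation

variable {A : Type*} [CStarAlgebra A] [PartialOrder A] [StarOrderedRing A]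

/-- A trace preserving expectation onto an `l2`-closed subalgebra satisfying a Pimsner–Popa
inequality. -/
structure IsFiniteIndexExpectation (τ : A →ₗ[ℂ] ℂ) (N : StarSubalgebra ℂ A) (E : A →ₗ[ℂ] A)
    (c : ℝ) : Prop where
  pos : 0 < c
  closed : IsL2Closed τ (N : Set A)
  mem : ∀ x, E x ∈ N
  map_one : E 1 = 1
  trace : ∀ x, τ (E x) = τ x
  conj : ∀ r ∈ N, ∀ x, E (r * x * r) = r * E x * r
  index : ∀ x, 0 ≤ x → c • x ≤ E x

namespace IsTracialWStar

variable {τ : A →ₗ[ℂ] ℂ} (h : IsTracialWStar τ)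
include h

/-- Take `x ≤ r` nonzero with `τ(x) < c τ(r)`. If `E x` were `l r`, the index inequality compressed
by `x` would give `l ≥ c`, whereas the trace gives `l τ(r) = τ(x)`. -/
lemma isDiffuse_of_expectation {N : StarSubalgebra ℂ A} {E : A →ₗ[ℂ] A} {c : ℝ}
    (hE : IsFiniteIndexExpectation τ N E c) (hd : IsDiffuse (⊤ : StarSubalgebra ℂ A)) :
    IsDiffuse N := by
  intro r hrN hr hr0
  have hpos := h.proj_re_pos hr hr0
  have hc := hE.pos
  obtain ⟨x, -, hx, hxr, hx0, hxt⟩ := h.exists_small (S := ⊤) (fun _ _ _ _ => trivial) hd trivial hr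
    hr0 (mul_pos hc hpos)
  have hrx : r * x = x := by
    simpa [hr.isSelfAdjoint.star_eq, hx.isSelfAdjoint.star_eq] using congrArg star hxr
  have hind := hE.index x hx.nonneg
  have hconj := hE.conj r hrN x
  rw [hrx, hxr] at hconj
  refine ⟨E x, hE.mem x, (smul_nonneg hc.le hx.nonneg).trans hind, ?_, fun l hl => ?_⟩
  · rw [hconj, mul_assoc, hr.isIdempotentElem.eq]
  have h1 := h.re_mono (star_left_conjugate_le_conjugate hind x)
  have hxx := hx.isIdempotentElem.eq
  rw [hl, hx.isSelfAdjoint.star_eq, mul_smul_comm, smul_mul_assoc, hxx, hxx, mul_smul_comm,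
    smul_mul_assoc, hxr, hxx, ← Complex.coe_smul, map_smul, map_smul, smul_eq_mul, smul_eq_mul,
    ← h.coe_re_proj hx] at h1
  have h2 : l * τ r = τ x := by rw [← hE.trace x, hl, map_smul, smul_eq_mul]
  rw [← h.coe_re_proj hr, ← h.coe_re_proj hx] at h2
  have h3 : l.re * (τ r).re = (τ x).re := by
    simpa using congrArg Complex.re h2
  have hxpos := h.proj_re_pos hx hx0
  simp only [← Complex.ofReal_mul, Complex.ofReal_re, Complex.re_mul_ofReal] at h1
  have h4 : c ≤ l.re := le_of_mul_le_mul_right h1 hxpos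
  nlinarith

/-- A projection which is almost fixed by the expectation is equivalent, by a partial isometry
close to it, to a projection of the subalgebra. -/
theorem exists_partialIsometry_of_expectation
    (hprime : ∀ x y : A, (∀ a, x * a * y = 0) → x = 0 ∨ y = 0)
    (hd : IsDiffuse (⊤ : StarSubalgebra ℂ A)) {N : StarSubalgebra ℂ A} {E : A →ₗ[ℂ] A} {c : ℝ}
    (hE : IsFiniteIndexExpectation τ N E c) {p : A} (hp : IsStarProjection p) {ε : ℝ}
    (hε : l2 τ (E p - p) ≤ ε) :
    ∃ q ∈ N, ∃ w, star w * w = p ∧ w * star w = q ∧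
      l2 τ (w - p) ≤ 4 * (7 * ε + √(7 * ε)) := by
  have hdN := h.isDiffuse_of_expectation hE hd
  set b := E p with hb
  have hbN : b ∈ N := hE.mem p
  have hb0 : 0 ≤ b := (smul_nonneg hE.pos.le hp.nonneg).trans (hE.index p hp.nonneg)
  have hb1 : b ≤ 1 := by
    have := (smul_nonneg hE.pos.le hp.one_sub.nonneg).trans (hE.index (1 - p) hp.one_sub.nonneg)
    rwa [map_sub, hE.map_one, sub_nonneg] at this
  have hbn : ‖b‖ ≤ 1 := (CStarAlgebra.norm_le_one_iff_of_nonneg b hb0).2 hb1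
  have hbb : l2 τ (b - b * b) ≤ 3 * ε := by
    have e : b - b * b = (b - p) - (b * (b - p) + (b - p) * p) := by
      rw [mul_sub, sub_mul, hp.isIdempotentElem.eq]; abel
    rw [e]
    have h1 := h.l2_sub_le (b - p) (b * (b - p) + (b - p) * p)
    have h2 := h.l2_add_le (b * (b - p)) ((b - p) * p)
    have h3 := h.l2_mul_le b (b - p)
    have h4 := h.l2_mul_proj_le hp (b - p)
    have h5 := mul_le_mul_of_nonneg_right hbn (h.l2_nonneg (b - p))
    linarith
  obtain ⟨f, hf, hfb, hf1, hf2, hfS⟩ := h.exists_specProj hb0.isSelfAdjoint (1 / 2)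
  rw [Algebra.algebraMap_eq_smul_one] at hf1 hf2
  have hfN := hfS N hE.closed hbN
  have hff := hf.isIdempotentElem.eq
  have hfnear : l2 τ (f - b) ≤ 6 * ε := by
    -- On the two sides of `1/2`, `z` is `2b` and `2b - 2`, so `z² ≥ 1`, while `(f - b) z = 2(b -
    -- b²)`. This turns the bound `3ε` on `b - b²` into `6ε` on `f - b`.
    set z : A := (2 : ℝ) • f + (2 : ℝ) • b - (2 : ℝ) • 1 with hz
    have hzsa : star z = z := by
      simp [hz, hf.isSelfAdjoint.star_eq, hb0.isSelfAdjoint.star_eq]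
    have e1 : (f - b) * z = (2 : ℝ) • (b - b * b) := by
      have : (f - b) * z = (2 : ℝ) • ((f - b) * f + (f - b) * b - (f - b)) := by
        rw [hz, mul_sub, mul_add, mul_smul_comm, mul_smul_comm, mul_smul_comm, mul_one]
        module
      rw [this, sub_mul, sub_mul, hff, hfb]
      congr 1
      abel
    have e2 : z * z - 1 = (2 : ℝ) • b * ((2 : ℝ) • b - (2 : ℝ) • 1) + 1 +
        (4 : ℝ) • (f * (b - (1 / 2 : ℝ) • 1) + (1 - f) * ((1 / 2 : ℝ) • 1 - b)) - 0 := by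
      simp only [hz, mul_sub, sub_mul, mul_add, add_mul, smul_sub, smul_add, mul_smul_comm,
        smul_mul_assoc, mul_one, one_mul, hff, ← hfb, smul_smul, sub_zero]
      have h1 : (1 : A) = (1 : ℝ) • 1 := (one_smul _ _).symm
      rw [h1]
      module
    have h0 : 0 ≤ z * z - 1 := by
      have e3 : (2 : ℝ) • b * ((2 : ℝ) • b - (2 : ℝ) • 1) + 1
          = star ((2 : ℝ) • b - 1) * ((2 : ℝ) • b - 1) := by
        simp only [star_sub, star_smul, star_one, hb0.isSelfAdjoint.star_eq, mul_sub, sub_mul,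
          mul_one, one_mul, mul_smul_comm, smul_mul_assoc, star_trivial]
        module
      rw [e2, e3, sub_zero]
      exact add_nonneg (star_mul_self_nonneg _) (smul_nonneg (by norm_num) (add_nonneg hf1 hf2))
    have h1 := h.re_mul_nonneg (star_mul_self_nonneg (f - b)) h0
    have h2 : l2 τ (f - b) ≤ l2 τ ((f - b) * z) := by
      refine Real.sqrt_le_sqrt ?_
      have : τ (star ((f - b) * z) * ((f - b) * z)) = τ (star (f - b) * (f - b) * (z * z)) := by
        rw [star_mul, hzsa, mul_assoc z, h.tracial]
        simp only [mul_assoc]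
      rw [this]
      rw [mul_sub, mul_one, map_sub, Complex.sub_re] at h1
      linarith
    rw [e1, ← Complex.coe_smul, h.l2_smul] at h2
    have : ‖((2 : ℝ) : ℂ)‖ = 2 := by simp
    rw [this] at h2
    linarith
  have hfp : l2 τ (f - p) ≤ 7 * ε := by
    have := h.l2_sub_le_sub_add_sub f b p
    linarith
  have htr : |(τ p).re - (τ f).re| ≤ 7 * ε := by
    rw [← Complex.sub_re, ← map_sub]
    have h1 := (Complex.abs_re_le_norm (τ (p - f))).trans (h.norm_apply_le_l2 _)
    rw [h.l2_sub_comm] at h1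
    linarith
  -- Diffuseness of `N` corrects the trace of `f`, removing a subprojection or adding an orthogonal
  -- one. Its trace is at most `7ε`, hence the square root in the `2`-norm.
  obtain ⟨q, hqN, hq, hqt, hqf⟩ : ∃ q ∈ N, IsStarProjection q ∧ τ p = τ q ∧
      l2 τ (q - f) ≤ √(7 * ε) := by
    have hlift : ∀ q, IsStarProjection q → (τ q).re = (τ p).re → τ p = τ q := fun q hq heq => by
      rw [← h.coe_re_proj hp, ← h.coe_re_proj hq, heq]
    rcases le_total (τ p).re (τ f).re with hle | hle
    · obtain ⟨q, hqN, hq, hqf, hqt⟩ := h.exists_proj_trace_eq hE.closed hdN hfN hf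
        (h.proj_re_nonneg hp) hle
      refine ⟨q, hqN, hq, hlift q hq hqt, Real.le_sqrt_of_sq_le ?_⟩
      have hfq : f * q = q := by
        simpa [hf.isSelfAdjoint.star_eq, hq.isSelfAdjoint.star_eq] using congrArg star hqf
      rw [h.l2_sub_comm, h.l2_proj_sq (isStarProjection_sub hq hf hfq), map_sub, Complex.sub_re, hqt]
      rw [abs_sub_comm] at htr
      exact (le_abs_self _).trans htr
    · have hle1 : (τ p).re ≤ 1 := by
        have := h.proj_re_nonneg hp.one_sub
        rw [map_sub, h.map_one] at this
        simpa using this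
      obtain ⟨s, hsN, hs, hsf, hst⟩ := h.exists_proj_trace_eq hE.closed hdN
        (N.sub_mem N.one_mem hfN) hf.one_sub (t := (τ p).re - (τ f).re) (sub_nonneg.2 hle)
        (by rw [map_sub, h.map_one]; simpa using hle1)
      have hsf0 : s * f = 0 := by rw [← hsf, mul_assoc, hf.one_sub_mul_self, mul_zero]
      have hq := isStarProjection_add hf hs hsf0
      refine ⟨s + f, N.add_mem hsN hfN, hq, hlift _ hq (by simp [hst]), Real.le_sqrt_of_sq_le ?_⟩
      rw [add_sub_cancel_right, h.l2_proj_sq hs, hst]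
      exact (le_abs_self _).trans htr
  obtain ⟨w, hw1, hw2, hw3⟩ := h.exists_partialIsometry_near hprime hp hq hqt
  refine ⟨q, hqN, w, hw1, hw2, hw3.trans ?_⟩
  have := h.l2_sub_le_sub_add_sub q f p
  linarith

/-- Expand the square and use `τ((E p)²) ≤ τ(E p) = τ(p)`, which holds because `0 ≤ E p ≤ 1`. -/
lemma l2_expectation_sub_sq_le {N : StarSubalgebra ℂ A} {E : A →ₗ[ℂ] A} {c : ℝ}
    (hE : IsFiniteIndexExpectation τ N E c) {p : A} (hp : IsStarProjection p) :
    l2 τ (E p - p) ^ 2 ≤ 2 * ((τ p).re - (τ (p * E p)).re) := by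
  have hb0 : 0 ≤ E p := (smul_nonneg hE.pos.le hp.nonneg).trans (hE.index p hp.nonneg)
  have hb1 : 0 ≤ 1 - E p := by
    have := (smul_nonneg hE.pos.le hp.one_sub.nonneg).trans (hE.index (1 - p) hp.one_sub.nonneg)
    rwa [map_sub, hE.map_one] at this
  have h1 := h.re_mul_nonneg hb0 hb1
  rw [mul_sub, mul_one, map_sub, hE.trace, Complex.sub_re] at h1
  rw [h.l2_sq, star_sub, hb0.isSelfAdjoint.star_eq, hp.isSelfAdjoint.star_eq, sub_mul, mul_sub,
    mul_sub, hp.isIdempotentElem.eq]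
  simp only [map_sub, Complex.sub_re]
  rw [h.tracial (E p) p]
  linarith

end IsTracialWStar

end Expectation

/-! ### Matrix amplifications -/

section CStarMatrices

variable {A : Type*} [CStarAlgebra A] [PartialOrder A] [StarOrderedRing A]
variable (n : Type*) [Fintype n] [DecidableEq n] [Nonempty n]

/-- The trace `τ ⊗ tr` on the C*-algebra of matrices over `A`. -/
def cmatTrace (τ : A →ₗ[ℂ] ℂ) : CStarMatrix n n A →ₗ[ℂ] ℂ := matTrace τ n

variable {n} {τ : A →ₗ[ℂ] ℂ}

lemma l2_cmatTrace_sq (h : IsTracialState τ) (X : CStarMatrix n n A) :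
    l2 (cmatTrace n τ) X ^ 2 = (Fintype.card n : ℝ)⁻¹ * ∑ i, ∑ j, l2 τ (X i j) ^ 2 :=
  l2_matTrace_sq h X

/-- The type `CStarMatrix` is the ring of matrices with its C*-norm. Entries are bounded by that
norm and by a multiple of the `2`-norm, so completeness is checked entry by entry. -/
theorem IsTracialWStar.cmatTrace (h : IsTracialWStar τ) :
    IsTracialWStar (GroupDual.cmatTrace n τ) where
  __ := (h.toIsTracialState.matTrace (n := n) : IsTracialState (A := Matrix n n A) _)
  faithful X hX := by
    have h0 : l2 (matTrace τ n) X = 0 := by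
      show √((GroupDual.cmatTrace n τ) (star X * X)).re = 0
      rw [hX]; simp
    ext i j
    refine h.eq_zero_of_l2 (le_antisymm ?_ (h.l2_nonneg _))
    simpa [h0] using l2_entry_le h.toIsTracialState X i j
  complete C X hC hX := by
    have hc : (0 : ℝ) < Fintype.card n := by exact_mod_cast Fintype.card_pos
    have hent : ∀ i j, ∃ y, Tendsto (fun k => l2 τ (X k i j - y)) atTop (𝓝 0) := fun i j => by
      refine h.complete C _ (fun k => CStarMatrix.norm_entry_le_norm.trans (hC k)) fun ε hε => ?_
      have hs : 0 < √(Fintype.card n : ℝ) := Real.sqrt_pos.2 hc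
      obtain ⟨N, hN⟩ := hX (ε / √(Fintype.card n : ℝ)) (by positivity)
      refine ⟨N, fun k hk l hl => ?_⟩
      have h1 := hN k hk l hl
      rw [lt_div_iff₀ hs, mul_comm] at h1
      exact (l2_entry_le h.toIsTracialState (X k - X l) i j).trans_lt h1
    choose Y hY using hent
    refine ⟨CStarMatrix.ofMatrix (Matrix.of Y), ?_⟩
    have h2 : Tendsto (fun k => l2 (GroupDual.cmatTrace n τ)
        (X k - CStarMatrix.ofMatrix (Matrix.of Y)) ^ 2) atTop (𝓝 0) := by
      simp only [l2_cmatTrace_sq h.toIsTracialState]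
      have : Tendsto (fun k => (Fintype.card n : ℝ)⁻¹ * ∑ i, ∑ j, l2 τ (X k i j - Y i j) ^ 2) atTop
          (𝓝 ((Fintype.card n : ℝ)⁻¹ * ∑ _i : n, ∑ _j : n, (0 : ℝ) ^ 2)) :=
        Tendsto.const_mul _ (tendsto_finsetSum _ fun i _ => tendsto_finsetSum _ fun j _ =>
          (hY i j).pow 2)
      simpa using this
    have h3 := (Real.continuous_sqrt.tendsto 0).comp h2
    rw [Real.sqrt_zero] at h3
    refine h3.congr fun k => ?_
    exact Real.sqrt_sq (Real.sqrt_nonneg _)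

/-- Matrix units carry a nonzero entry of `X` next to a nonzero entry of `Y`. -/
lemma matrix_prime {A n : Type*} [Ring A] [Fintype n] [DecidableEq n]
    (hprime : ∀ x y : A, (∀ a, x * a * y = 0) → x = 0 ∨ y = 0)
    (X Y : Matrix n n A) (hXY : ∀ a, X * a * Y = 0) : X = 0 ∨ Y = 0 := by
  by_contra! hcon
  obtain ⟨hX, hY⟩ := hcon
  obtain ⟨i, j, hij⟩ : ∃ i j, X i j ≠ 0 := by
    by_contra! h0; exact hX (Matrix.ext h0)
  obtain ⟨k, l, hkl⟩ : ∃ i j, Y i j ≠ 0 := by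
    by_contra! h0; exact hY (Matrix.ext h0)
  refine (hprime (X i j) (Y k l) fun a => ?_).elim hij hkl
  have h1 := congrFun (congrFun (hXY (Matrix.single j k a)) i) l
  rw [Matrix.mul_assoc, Matrix.mul_apply, Finset.sum_eq_single j] at h1
  · simpa [mul_assoc] using h1
  · intro b _ hb
    simp [Matrix.single_mul_apply_of_ne _ _ _ _ _ hb]
  · simp

lemma cmat_prime (hprime : ∀ x y : A, (∀ a, x * a * y = 0) → x = 0 ∨ y = 0)
    (X Y : CStarMatrix n n A) (hXY : ∀ a, X * a * Y = 0) : X = 0 ∨ Y = 0 :=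
  matrix_prime (A := A) (n := n) hprime X Y hXY

lemma not_finiteDimensional_cmat (hfd : ¬ FiniteDimensional ℂ A) :
    ¬ FiniteDimensional ℂ (CStarMatrix n n A) := by
  intro hf
  obtain ⟨i⟩ := ‹Nonempty n›
  let φ : CStarMatrix n n A →ₗ[ℂ] A :=
    { toFun := fun X => X i i, map_add' := fun _ _ => rfl, map_smul' := fun _ _ => rfl }
  exact hfd (Module.Finite.of_surjective φ fun a => ⟨fun _ _ => a, rfl⟩)

end CStarMatrices

/-! ### Von Neumann algebras with a trace -/

section VonNeumann

variable {H : Type*} [NormedAddCommGroup H] [InnerProductSpace ℂ H] [CompleteSpace H]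

lemma isClosed_vonNeumann (M : VonNeumannAlgebra H) :
    IsClosed (M.toStarSubalgebra : Set (H →L[ℂ] H)) := by
  rw [VonNeumannAlgebra.coe_toStarSubalgebra, ← M.centralizer_centralizer]
  exact Set.isClosed_centralizer _

lemma starProjection_mem (M : VonNeumannAlgebra H) (K : Submodule ℂ H) [K.HasOrthogonalProjection]
    (hK : ∀ y ∈ M.commutant, ∀ ξ ∈ K, y ξ ∈ K) : K.starProjection ∈ M := by
  rw [VonNeumannAlgebra.IsStarProjection.mem_iff isStarProjection_starProjection]
  intro y hy
  rw [Submodule.range_starProjection]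
  exact fun ξ hξ => hK y hy ξ hξ

/-- The closed span of `M ξ` for `ξ` in a set. -/
def cyclicSpan (M : VonNeumannAlgebra H) (s : Set H) : Submodule ℂ H :=
  (Submodule.span ℂ {η | ∃ a ∈ M, ∃ ξ ∈ s, a ξ = η}).topologicalClosure

instance (M : VonNeumannAlgebra H) (s : Set H) :
    (cyclicSpan M s).HasOrthogonalProjection :=
  haveI : CompleteSpace (cyclicSpan M s) :=
    (Submodule.isClosed_topologicalClosure _).completeSpace_coe
  inferInstance

lemma subset_cyclicSpan (M : VonNeumannAlgebra H) {s : Set H} {ξ : H} (hξ : ξ ∈ s) {a : H →L[ℂ] H}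
    (ha : a ∈ M) : a ξ ∈ cyclicSpan M s :=
  Submodule.le_topologicalClosure _ (Submodule.subset_span ⟨a, ha, ξ, hξ, rfl⟩)

lemma cyclicSpan_le (M : VonNeumannAlgebra H) {s : Set H} {K : Submodule ℂ H}
    (hK : IsClosed (K : Set H)) (hs : ∀ a ∈ M, ∀ ξ ∈ s, a ξ ∈ K) : cyclicSpan M s ≤ K := by
  refine Submodule.topologicalClosure_minimal _ (Submodule.span_le.2 ?_) hK
  rintro _ ⟨a, ha, ξ, hξ, rfl⟩
  exact hs a ha ξ hξ

lemma cyclicSpan_invariant (M : VonNeumannAlgebra H) {s : Set H} {y : H →L[ℂ] H}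
    (hy : ∀ a ∈ M, ∀ ξ ∈ s, y (a ξ) ∈ cyclicSpan M s) {η : H} (hη : η ∈ cyclicSpan M s) :
    y η ∈ cyclicSpan M s := by
  have := cyclicSpan_le M (K := (cyclicSpan M s).comap (y : H →ₗ[ℂ] H)) (s := s)
    ((Submodule.isClosed_topologicalClosure _).preimage y.continuous) hy
  exact this hη

lemma cyclicSpan_invariant_self (M : VonNeumannAlgebra H) {s : Set H} {y : H →L[ℂ] H}
    (hy : y ∈ M) {η : H} (hη : η ∈ cyclicSpan M s) : y η ∈ cyclicSpan M s :=
  cyclicSpan_invariant M (fun _ ha _ hξ => subset_cyclicSpan M hξ (mul_mem hy ha)) hη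

lemma starProjection_cyclicSpan_mem (M : VonNeumannAlgebra H) (s : Set H) :
    (cyclicSpan M s).starProjection ∈ M.commutant := by
  refine starProjection_mem _ _ fun y hy ξ hξ => ?_
  rw [VonNeumannAlgebra.commutant_commutant] at hy
  exact cyclicSpan_invariant_self M hy hξ

/-- A factor is a prime ring. -/
lemma IsTypeIIOneFactor.prime {M : VonNeumannAlgebra H} (hM : IsTypeIIOneFactor M)
    (x y : M.toStarSubalgebra) (hxy : ∀ a, x * a * y = 0) : x = 0 ∨ y = 0 := by
  by_contra! hcon
  obtain ⟨hx, hy⟩ := hcon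
  obtain ⟨ξ, hξ⟩ : ∃ ξ, (y : H →L[ℂ] H) ξ ≠ 0 := by
    by_contra! h0
    exact hy (Subtype.ext (ContinuousLinearMap.ext h0))
  -- The closed span of `M y H` is invariant under both `M` and its commutant, so its projection is
  -- central, hence scalar, and equal to `1` because `y ≠ 0`. But `x` kills that space.
  set s : Set H := Set.range fun ξ => (y : H →L[ℂ] H) ξ with hs
  have he' := starProjection_cyclicSpan_mem M s
  have he : (cyclicSpan M s).starProjection ∈ M := by
    refine starProjection_mem _ _ fun z hz η hη => ?_
    refine cyclicSpan_invariant M (fun a ha ζ hζ => ?_) hη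
    obtain ⟨ζ, rfl⟩ := hζ
    rw [VonNeumannAlgebra.mem_commutant_iff] at hz
    have h1 : z (a ((y : H →L[ℂ] H) ζ)) = a ((y : H →L[ℂ] H) (z ζ)) := by
      have := congrArg (fun T : H →L[ℂ] H => T ζ) (hz (a * y) (mul_mem ha y.2))
      simpa using this.symm
    rw [h1]
    exact subset_cyclicSpan M (s := s) (Set.mem_range_self _) ha
  obtain ⟨c, hc⟩ := hM.factor ⟨_, he⟩ fun a => by
    refine Subtype.ext ?_
    exact ((VonNeumannAlgebra.mem_commutant_iff.1 he') a a.2).symm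
  have hc' : ∀ η, (cyclicSpan M s).starProjection η = c • η := fun η => by
    have := congrArg (fun T : M.toStarSubalgebra => (T : H →L[ℂ] H) η) hc
    simpa [Algebra.algebraMap_eq_smul_one] using this
  have hyK : (y : H →L[ℂ] H) ξ ∈ cyclicSpan M s := by
    simpa using subset_cyclicSpan M (s := s) ⟨ξ, rfl⟩ (one_mem M)
  have hc1 : c = 1 := by
    have h1 := hc' ((y : H →L[ℂ] H) ξ)
    rw [Submodule.starProjection_eq_self_iff.2 hyK] at h1
    have h2 : (c - 1) • (y : H →L[ℂ] H) ξ = 0 := by rw [sub_smul, one_smul, ← h1, sub_self]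
    exact sub_eq_zero.1 ((smul_eq_zero.1 h2).resolve_right hξ)
  apply hx
  refine Subtype.ext (ContinuousLinearMap.ext fun η => ?_)
  have hη : η ∈ cyclicSpan M s := by
    rw [← Submodule.starProjection_eq_self_iff, hc', hc1, one_smul]
  have := cyclicSpan_le M (s := s) (K := LinearMap.ker ((x : H →L[ℂ] H) : H →ₗ[ℂ] H))
    (x : H →L[ℂ] H).isClosed_ker (by
      rintro a ha _ ⟨ζ, rfl⟩
      have h1 := congrArg (fun T : M.toStarSubalgebra => (T : H →L[ℂ] H) ζ) (hxy ⟨a, ha⟩)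
      simpa using h1) hη
  simpa using this

variable {M : VonNeumannAlgebra H} {τ : M.toStarSubalgebra →ₗ[ℂ] ℂ}

theorem IsNormalizedTrace.isTracialState (hτ : IsNormalizedTrace M τ) : IsTracialState τ where
  map_one := hτ.map_one
  nonneg := hτ.nonneg
  tracial := hτ.tracial
  map_star x := by
    obtain ⟨ξ, -, hξ⟩ := hτ.normal
    refine (hξ (star x)).unique ?_
    convert (hξ x).star using 2 with k
    rw [StarMemClass.coe_star, ContinuousLinearMap.star_eq_adjoint,
      ContinuousLinearMap.adjoint_inner_right]
    exact (inner_conj_symm _ _).symm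

/-- Normality realizes the `2`-norm as the norm of `x` on a sequence of vectors. Faithfulness says
that the sequence is separating for `M`; equivalently it is cyclic for the commutant, since the
projection onto the span it generates lies in `M`. -/
theorem IsNormalizedTrace.exists_vectors (hτ : IsNormalizedTrace M τ) :
    ∃ ξ : ℕ → H, (∀ x : M.toStarSubalgebra,
      HasSum (fun k => ‖(x : H →L[ℂ] H) (ξ k)‖ ^ 2) (l2 τ x ^ 2)) ∧
      cyclicSpan M.commutant (Set.range ξ) = ⊤ := by
  obtain ⟨ξ, -, hξ⟩ := hτ.normal
  have hsum : ∀ x : M.toStarSubalgebra,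
      HasSum (fun k => ‖(x : H →L[ℂ] H) (ξ k)‖ ^ 2) (l2 τ x ^ 2) := fun x => by
    rw [hτ.isTracialState.l2_sq]
    have := Complex.hasSum_re (hξ (star x * x))
    convert this using 2 with k
    rw [MulMemClass.coe_mul, StarMemClass.coe_star, ContinuousLinearMap.star_eq_adjoint,
      mul_apply_eq_comp, ContinuousLinearMap.adjoint_inner_right,
      inner_self_eq_norm_sq_to_K]
    norm_cast
  refine ⟨ξ, hsum, ?_⟩
  have he : (cyclicSpan M.commutant (Set.range ξ)).starProjection ∈ M := by
    simpa using starProjection_cyclicSpan_mem M.commutant (Set.range ξ)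
  have h0 : l2 τ (1 - ⟨_, he⟩) ^ 2 = 0 := by
    refine (hsum _).unique ?_
    convert hasSum_zero (α := ℝ) (β := ℕ) using 2 with k
    have hk : ξ k ∈ cyclicSpan M.commutant (Set.range ξ) := by
      simpa using subset_cyclicSpan M.commutant (s := Set.range ξ) ⟨k, rfl⟩ (one_mem _)
    have : ((1 - ⟨_, he⟩ : M.toStarSubalgebra) : H →L[ℂ] H) (ξ k) = 0 := by
      simp [Submodule.starProjection_eq_self_iff.2 hk]
    rw [this]; simp
  have h1 : (1 : M.toStarSubalgebra) - ⟨_, he⟩ = 0 := by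
    refine hτ.faithful _ ?_
    rw [← hτ.isTracialState.coe_l2_sq, h0]; simp
  rw [eq_top_iff]
  intro η _
  rw [← Submodule.starProjection_eq_self_iff]
  have := congrArg (fun T : M.toStarSubalgebra => (T : H →L[ℂ] H) η) (sub_eq_zero.1 h1)
  simpa using this.symm

/-- A bounded `2`-norm Cauchy sequence converges on the vectors `ξ k`, hence on their translates by
the commutant, hence everywhere by density and boundedness. The strong limit commutes with the
commutant and so belongs to `M`. -/
theorem IsNormalizedTrace.complete (hτ : IsNormalizedTrace M τ) (C : ℝ)
    (x : ℕ → M.toStarSubalgebra) (hC : ∀ n, ‖(x n : H →L[ℂ] H)‖ ≤ C)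
    (hx : ∀ ε > 0, ∃ N, ∀ m ≥ N, ∀ n ≥ N, l2 τ (x m - x n) < ε) :
    ∃ y, Tendsto (fun n => l2 τ (x n - y)) atTop (𝓝 0) := by
  obtain ⟨ξ, hsum, htop⟩ := hτ.exists_vectors
  have hl2 := hτ.isTracialState.l2_nonneg
  have hle : ∀ (z : M.toStarSubalgebra) k, ‖(z : H →L[ℂ] H) (ξ k)‖ ≤ l2 τ z := fun z k =>
    le_of_sq_le_sq (le_hasSum (hsum z) k fun _ _ => sq_nonneg _) (hl2 z)
  have hC0 : 0 ≤ C := (norm_nonneg _).trans (hC 0)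
  -- the vectors on which the sequence converges form a closed subspace
  let K : Submodule ℂ H :=
    { carrier := {η | CauchySeq fun n => (x n : H →L[ℂ] H) η}
      add_mem' := fun {a b} ha hb => by
        simpa using! ha.add hb
      zero_mem' := by simpa using! cauchySeq_const (0 : H)
      smul_mem' := fun c a ha => by
        simpa using! ha.map (uniformContinuous_const_smul c) }
  have hK : IsClosed (K : Set H) := by
    rw [← isSeqClosed_iff_isClosed]
    intro η ζ hη hζ
    rw [SetLike.mem_coe]
    show CauchySeq fun n => (x n : H →L[ℂ] H) ζ
    rw [Metric.cauchySeq_iff]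
    intro ε hε
    obtain ⟨j, hj⟩ := (Metric.tendsto_atTop.1 hζ (ε / (3 * (C + 1))) (by positivity))
    have hj := hj j le_rfl
    obtain ⟨N, hN⟩ := Metric.cauchySeq_iff.1 (hη j) (ε / 3) (by positivity)
    refine ⟨N, fun m hm n hn => ?_⟩
    have h1 : ∀ n, dist ((x n : H →L[ℂ] H) (η j)) ((x n : H →L[ℂ] H) ζ) < ε / 3 := fun n => by
      rw [dist_eq_norm, ← map_sub]
      refine ((x n : H →L[ℂ] H).le_opNorm _).trans_lt ?_
      rw [dist_eq_norm, lt_div_iff₀ (by positivity)] at hj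
      have := mul_le_mul_of_nonneg_right (hC n) (norm_nonneg (η j - ζ))
      nlinarith [norm_nonneg (η j - ζ)]
    have h2 := h1 m
    rw [dist_comm] at h2
    have := dist_triangle4 ((x m : H →L[ℂ] H) ζ) ((x m : H →L[ℂ] H) (η j))
      ((x n : H →L[ℂ] H) (η j)) ((x n : H →L[ℂ] H) ζ)
    linarith [h1 n, hN m hm n hn]
  have hall : ∀ η, CauchySeq fun n => (x n : H →L[ℂ] H) η := fun η => by
    have : cyclicSpan M.commutant (Set.range ξ) ≤ K := by
      refine cyclicSpan_le _ hK ?_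
      rintro a ha _ ⟨k, rfl⟩
      have hcomm : ∀ n, (x n : H →L[ℂ] H) (a (ξ k)) = a ((x n : H →L[ℂ] H) (ξ k)) := fun n => by
        have := VonNeumannAlgebra.mem_commutant_iff.1 ha (x n) (x n).2
        exact congrArg (fun T : H →L[ℂ] H => T (ξ k)) this
      have h0 : CauchySeq fun n => (x n : H →L[ℂ] H) (ξ k) := by
        rw [Metric.cauchySeq_iff]
        intro ε hε
        obtain ⟨N, hN⟩ := hx ε hε
        refine ⟨N, fun m hm n hn => ?_⟩
        rw [dist_eq_norm]
        exact (hle (x m - x n) k).trans_lt (hN m hm n hn)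
      show CauchySeq fun n => (x n : H →L[ℂ] H) (a (ξ k))
      simp only [hcomm]
      exact h0.map a.uniformContinuous
    exact this (htop ▸ Submodule.mem_top)
  choose y hy using fun η => cauchySeq_tendsto_of_complete (hall η)
  let Y : H →L[ℂ] H := continuousLinearMapOfTendsto (fun n => (x n : H →L[ℂ] H))
    (tendsto_pi_nhds.2 hy)
  have hY : ∀ η, Tendsto (fun n => (x n : H →L[ℂ] H) η) atTop (𝓝 (Y η)) := hy
  have hYM : Y ∈ M := by
    rw [← M.commutant_commutant, VonNeumannAlgebra.mem_commutant_iff]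
    intro a ha
    ext η
    refine tendsto_nhds_unique ((a.continuous.tendsto _).comp (hY η)) ?_
    refine (hY (a η)).congr fun n => ?_
    have := VonNeumannAlgebra.mem_commutant_iff.1 ha (x n) (x n).2
    exact congrArg (fun T : H →L[ℂ] H => T η) this
  refine ⟨⟨Y, hYM⟩, ?_⟩
  rw [Metric.tendsto_atTop]
  intro ε hε
  obtain ⟨N, hN⟩ := hx (ε / 2) (by positivity)
  refine ⟨N, fun n hn => ?_⟩
  rw [Real.dist_0_eq_abs, abs_of_nonneg (hl2 _)]
  refine lt_of_le_of_lt ?_ (half_lt_self hε)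
  refine le_of_sq_le_sq ?_ (by positivity)
  -- Fatou's argument: for finitely many vectors the estimate for `x n - x m` passes to the limit in
  -- `m`.
  refine hasSum_le_of_sum_le (hsum _) fun s => ?_
  have hlim : Tendsto (fun m => ∑ k ∈ s, ‖((x n - x m : M.toStarSubalgebra) : H →L[ℂ] H) (ξ k)‖ ^ 2)
      atTop (𝓝 (∑ k ∈ s, ‖((x n - ⟨Y, hYM⟩ : M.toStarSubalgebra) : H →L[ℂ] H) (ξ k)‖ ^ 2)) := by
    refine tendsto_finsetSum _ fun k _ => ((Tendsto.norm ?_).pow 2)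
    exact (hY (ξ k)).const_sub ((x n : H →L[ℂ] H) (ξ k))
  refine le_of_tendsto hlim ?_
  filter_upwards [eventually_ge_atTop N] with m hm
  refine (sum_le_hasSum s (fun _ _ => sq_nonneg _) (hsum (x n - x m))).trans ?_
  exact pow_le_pow_left₀ (hl2 _) (hN n hn m hm).le 2

end VonNeumann

/-! ### Schur's lemma and complete reducibility -/

section Schur

variable {G : Type*} [Group G]

lemma toRep_apply {n : ℕ} (π : G →* Matrix.unitaryGroup (Fin n) ℂ) (g : G) (v : Fin n → ℂ) :
    toRep π g v = (π g).1 *ᵥ v := rfl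

namespace UnitaryDual

variable (D : UnitaryDual G)

lemma mat_mul (π : D.Idx) (g h : G) : D.mat π (g * h) = D.mat π g * D.mat π h := by
  simp [mat]

@[simp] lemma mat_one (π : D.Idx) : D.mat π 1 = 1 := by simp [mat]

lemma mat_conjTranspose (π : D.Idx) (g : G) : (D.mat π g)ᴴ = D.mat π g⁻¹ := by
  rw [mat, mat, map_inv]; rfl

lemma nontrivial_space (π : D.Idx) : Nontrivial (D.V π → ℂ) := by
  have := D.irreducible π
  obtain ⟨K, L, hKL⟩ := exists_pair_ne (Subrepresentation (toRep (D.rep π)))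
  by_contra hcon
  rw [not_nontrivial_iff_subsingleton] at hcon
  exact hKL (Subrepresentation.toSubmodule_injective (Subsingleton.elim _ _))

instance nonempty_space (π : D.Idx) : Nonempty (D.V π) := by
  by_contra hcon
  rw [not_nonempty_iff] at hcon
  have := D.nontrivial_space π
  exact not_subsingleton (D.V π → ℂ) inferInstance

lemma dim_pos (π : D.Idx) : 0 < D.dim π := Fin.pos_iff_nonempty.2 (D.nonempty_space π)

theorem schur_self {π : D.Idx} (T : Matrix (D.V π) (D.V π) ℂ)
    (hT : ∀ g, T * D.mat π g = D.mat π g * T) : ∃ c : ℂ, T = c • 1 := by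
  have := D.nontrivial_space π
  have := D.irreducible π
  obtain ⟨c, hc⟩ := Module.End.exists_eigenvalue (Matrix.toLin' T)
  obtain ⟨v, hv⟩ := hc.exists_hasEigenvector
  let K : Subrepresentation (toRep (D.rep π)) :=
    { toSubmodule := Module.End.eigenspace (Matrix.toLin' T) c
      apply_mem_toSubmodule := fun g w hw => by
        rw [Module.End.mem_eigenspace_iff, Matrix.toLin'_apply] at hw ⊢
        have h1 := congrArg (fun S => S *ᵥ w) (hT g)
        simp only [← Matrix.mulVec_mulVec, hw, Matrix.mulVec_smul] at h1
        exact h1 }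
  refine ⟨c, ?_⟩
  rcases eq_bot_or_eq_top K with hK | hK
  · exfalso
    have h1 : v ∈ K := hv.1
    rw [hK] at h1
    exact hv.2 ((Submodule.mem_bot ℂ).1 h1)
  · refine Matrix.toLin'.injective (LinearMap.ext fun w => ?_)
    have h1 : w ∈ K := by rw [hK]; exact Submodule.mem_top (R := ℂ)
    have h2 : Matrix.toLin' T w = c • w := Module.End.mem_eigenspace_iff.1 h1
    rw [h2]
    simp

/-- By the previous lemma `T* T` and `T T*` are scalars, necessarily the same one. Were it nonzero,
a multiple of `T` would be a unitary equivalence between distinct representatives. -/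
theorem schur_ne {π σ : D.Idx} (hne : σ ≠ π) (T : Matrix (D.V π) (D.V σ) ℂ)
    (hT : ∀ g, T * D.mat σ g = D.mat π g * T) : T = 0 := by
  have hT' : ∀ g, Tᴴ * D.mat π g = D.mat σ g * Tᴴ := fun g => by
    have := congrArg Matrix.conjTranspose (hT g⁻¹)
    simpa [Matrix.conjTranspose_mul, mat_conjTranspose] using this.symm
  by_contra h0
  obtain ⟨c, hc⟩ := D.schur_self (Tᴴ * T) fun g => by
    rw [Matrix.mul_assoc, hT, ← Matrix.mul_assoc, hT', Matrix.mul_assoc]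
  obtain ⟨d, hd⟩ := D.schur_self (T * Tᴴ) fun g => by
    rw [Matrix.mul_assoc, hT', ← Matrix.mul_assoc, hT, Matrix.mul_assoc]
  have hcd : c = d := by
    have h1 : (T * Tᴴ) * T = T * (Tᴴ * T) := Matrix.mul_assoc _ _ _
    rw [hc, hd, Matrix.smul_mul, Matrix.mul_smul, Matrix.one_mul, Matrix.mul_one, ← sub_eq_zero,
      ← sub_smul] at h1
    exact (sub_eq_zero.1 ((smul_eq_zero.1 h1).resolve_right h0)).symm
  subst hcd
  have hc0 : c ≠ 0 := by
    rintro rfl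
    rw [zero_smul, Matrix.conjTranspose_mul_self_eq_zero] at hc
    exact h0 hc
  obtain ⟨i⟩ := D.nonempty_space σ
  have hcpos : 0 ≤ c := by
    have h1 := congrFun (congrFun hc i) i
    simp only [Matrix.smul_apply, Matrix.one_apply_eq, smul_eq_mul, mul_one, Matrix.mul_apply,
      Matrix.conjTranspose_apply] at h1
    rw [← h1]
    exact Finset.sum_nonneg fun j _ => star_mul_self_nonneg _
  obtain ⟨r, hr, rfl⟩ : ∃ r : ℝ, 0 < r ∧ c = r := by
    refine ⟨c.re, ?_, ?_⟩
    · exact (Complex.lt_def.1 (lt_of_le_of_ne hcpos hc0.symm)).1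
    · exact Complex.ext rfl (by simpa using (Complex.le_def.1 hcpos).2.symm)
  obtain ⟨s, hs, hsr⟩ : ∃ s : ℂ, star s = s ∧ s * s * r = 1 := by
    refine ⟨((√r)⁻¹ : ℝ), Complex.conj_ofReal _, ?_⟩
    have h1 : (√r)⁻¹ * (√r)⁻¹ * r = 1 := by
      rw [← mul_inv, Real.mul_self_sqrt hr.le, inv_mul_cancel₀ hr.ne']
    exact_mod_cast h1
  refine hne (D.inequivalent σ π ⟨s • T, ?_, ?_, fun g => ?_⟩)
  · rw [Matrix.conjTranspose_smul, Matrix.smul_mul, Matrix.mul_smul, hc, smul_smul, smul_smul, hs,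
      hsr, one_smul]
  · rw [Matrix.conjTranspose_smul, Matrix.smul_mul, Matrix.mul_smul, hd, smul_smul, smul_smul, hs,
      hsr, one_smul]
  · rw [Matrix.smul_mul, Matrix.mul_smul]
    exact congrArg _ (hT g)

variable {m : Type*} [Fintype m] [DecidableEq m]

/-- The span of the ranges of the intertwiners from the irreducible representations. -/
def isotypicSpan (θ : G →* Matrix m m ℂ) : Submodule ℂ (m → ℂ) :=
  Submodule.span ℂ {x | ∃ (σ : D.Idx) (T : Matrix m (D.V σ) ℂ),
    (∀ g, T * D.mat σ g = θ g * T) ∧ ∃ v, T *ᵥ v = x}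

lemma mulVec_mem_isotypicSpan (θ : G →* Matrix m m ℂ) (g : G) {x : m → ℂ}
    (hx : x ∈ D.isotypicSpan θ) : θ g *ᵥ x ∈ D.isotypicSpan θ := by
  have : D.isotypicSpan θ ≤ (D.isotypicSpan θ).comap (θ g).mulVecLin := by
    refine Submodule.span_le.2 ?_
    rintro _ ⟨σ, T, hT, v, rfl⟩
    refine Submodule.subset_span ⟨σ, T, hT, D.mat σ g *ᵥ v, ?_⟩
    simp only [Matrix.mulVecLin_apply, Matrix.mulVec_mulVec, hT]
  exact this hx

/-- An irreducible invariant subspace, written as the range of an isometry. -/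
lemma exists_irreducible_isometry (θ : G →* Matrix m m ℂ) (hθ : ∀ g, (θ g)ᴴ = θ g⁻¹)
    (K₀ : Submodule ℂ (m → ℂ)) (h0 : K₀ ≠ ⊥) (hinv : ∀ g, ∀ x ∈ K₀, θ g *ᵥ x ∈ K₀) :
    ∃ (σ : D.Idx) (T : Matrix m (D.V σ) ℂ), (∀ g, T * D.mat σ g = θ g * T) ∧ T ≠ 0 ∧
      ∀ v, T *ᵥ v ∈ K₀ := by
  -- A minimal nonzero invariant subspace is irreducible; an orthonormal basis of it, as the columns
  -- of `V`, transports the representation to unitary matrices.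
  obtain ⟨K, ⟨hK0, hKK, hKinv⟩, hmin⟩ := (wellFounded_lt (α := Submodule ℂ (m → ℂ))).has_min
    {K | K ≠ ⊥ ∧ K ≤ K₀ ∧ ∀ g, ∀ x ∈ K, θ g *ᵥ x ∈ K} ⟨K₀, h0, le_rfl, hinv⟩
  let K' : Submodule ℂ (EuclideanSpace ℂ m) :=
    K.comap (WithLp.linearEquiv 2 ℂ (m → ℂ) : EuclideanSpace ℂ m →ₗ[ℂ] (m → ℂ))
  let b := stdOrthonormalBasis ℂ K'
  set k := Module.finrank ℂ K'
  let V : Matrix m (Fin k) ℂ := Matrix.of fun i j => (b j : EuclideanSpace ℂ m) i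
  have hVV : Vᴴ * V = 1 := by
    ext i j
    have := orthonormal_iff_ite.1 b.orthonormal i j
    rw [Submodule.coe_inner, PiLp.inner_apply] at this
    simp only [Matrix.mul_apply, Matrix.conjTranspose_apply, Matrix.one_apply, V, Matrix.of_apply]
    rw [← this]
    refine Finset.sum_congr rfl fun l _ => ?_
    simp [mul_comm]
  have hVmem : ∀ v, V *ᵥ v ∈ K := fun v => by
    have : V *ᵥ v = ∑ j, v j • (WithLp.linearEquiv 2 ℂ (m → ℂ) (b j : EuclideanSpace ℂ m)) := by
      ext i
      simp [Matrix.mulVec, dotProduct, V, mul_comm]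
    rw [this]
    exact Submodule.sum_mem _ fun j _ => Submodule.smul_mem _ _ (b j).2
  have hVproj : ∀ x ∈ K, V *ᵥ (Vᴴ *ᵥ x) = x := fun x hx => by
    let x' : K' := ⟨WithLp.toLp 2 x, hx⟩
    have h1 := congrArg (fun y : K' => (y : EuclideanSpace ℂ m)) (b.sum_repr' x')
    ext i
    have h2 := congrArg (fun y : EuclideanSpace ℂ m => y i) h1
    simp only [AddSubmonoidClass.coe_finsetSum, Submodule.coe_smul, Submodule.coe_inner,
      PiLp.inner_apply, WithLp.ofLp_sum, WithLp.ofLp_smul, Finset.sum_apply, Pi.smul_apply,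
      smul_eq_mul] at h2
    rw [show x i = (x' : EuclideanSpace ℂ m) i from rfl, ← h2]
    simp only [Matrix.mulVec, dotProduct, V, Matrix.of_apply, Matrix.conjTranspose_apply]
    refine Finset.sum_congr rfl fun j _ => ?_
    rw [mul_comm]
    congr 1
    refine Finset.sum_congr rfl fun l _ => ?_
    simp [x', mul_comm]
  have hθV : ∀ g, V * Vᴴ * (θ g * V) = θ g * V := fun g => by
    refine Matrix.toLin'.injective (LinearMap.ext fun v => ?_)
    simp only [Matrix.toLin'_apply, ← Matrix.mulVec_mulVec]
    exact hVproj _ (hKinv g _ (hVmem v))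
  have hmul : ∀ g h, (Vᴴ * θ g * V) * (Vᴴ * θ h * V) = Vᴴ * θ (g * h) * V := fun g h => by
    calc (Vᴴ * θ g * V) * (Vᴴ * θ h * V) = Vᴴ * θ g * (V * Vᴴ * (θ h * V)) := by
          simp only [Matrix.mul_assoc]
      _ = _ := by rw [hθV, map_mul]; simp only [Matrix.mul_assoc]
  have hstar : ∀ g, star (Vᴴ * θ g * V) = Vᴴ * θ g⁻¹ * V := fun g => by
    simp [Matrix.star_eq_conjTranspose, Matrix.conjTranspose_mul, hθ, Matrix.mul_assoc]
  have hone : Vᴴ * θ 1 * V = 1 := by rw [map_one, Matrix.mul_one, hVV]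
  let σ₀ : G →* Matrix.unitaryGroup (Fin k) ℂ :=
    { toFun := fun g => ⟨Vᴴ * θ g * V, by rw [hstar, hmul, inv_mul_cancel, hone],
        by rw [hstar, hmul, mul_inv_cancel, hone]⟩
      map_one' := Subtype.ext hone
      map_mul' := fun g h => Subtype.ext (hmul g h).symm }
  have hVσ : ∀ g, V * (σ₀ g).1 = θ g * V := fun g => by
    rw [← hθV g]; show V * (Vᴴ * θ g * V) = _; simp only [Matrix.mul_assoc]
  have hVinj : ∀ v, V *ᵥ v = 0 → v = 0 := fun v hv => by
    rw [← Matrix.one_mulVec v, ← hVV, ← Matrix.mulVec_mulVec, hv, Matrix.mulVec_zero]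
  have hV0 : V ≠ 0 := fun hV => hK0 (by
    rw [eq_bot_iff]
    intro x hx
    rw [Submodule.mem_bot, ← hVproj x hx, hV, Matrix.zero_mulVec])
  have hirr : (toRep σ₀).IsIrreducible := by
    refine { exists_pair_ne := ⟨⊥, ⊤, fun h => hV0 ?_⟩, eq_bot_or_eq_top := fun L => ?_ }
    · refine Matrix.toLin'.injective (LinearMap.ext fun v => ?_)
      have h1 : v ∈ (⊤ : Subrepresentation (toRep σ₀)) := Submodule.mem_top (R := ℂ)
      rw [← h] at h1
      rw [(Submodule.mem_bot ℂ).1 h1]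
      simp
    · by_cases hL : L = ⊥
      · exact Or.inl hL
      right
      have h1 : L.toSubmodule.map V.mulVecLin = K := by
        by_contra hne
        refine hmin (L.toSubmodule.map V.mulVecLin) ⟨fun hb => hL ?_, ?_, ?_⟩ ?_
        · refine Subrepresentation.toSubmodule_injective ?_
          refine (Submodule.eq_bot_iff _).2 fun v hv => hVinj v ?_
          exact (Submodule.eq_bot_iff _).1 hb _ (Submodule.mem_map_of_mem hv)
        · refine le_trans ?_ hKK
          rintro _ ⟨v, -, rfl⟩
          exact hVmem v
        · rintro g _ ⟨v, hv, rfl⟩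
          refine ⟨toRep σ₀ g v, L.apply_mem_toSubmodule g hv, ?_⟩
          rw [toRep_apply, Matrix.mulVecLin_apply, Matrix.mulVec_mulVec, hVσ,
            Matrix.mulVecLin_apply, Matrix.mulVec_mulVec]
        · refine lt_of_le_of_ne ?_ hne
          rintro _ ⟨v, -, rfl⟩
          exact hVmem v
      refine Subrepresentation.toSubmodule_injective ?_
      refine Submodule.eq_top_iff'.2 fun v => ?_
      have h2 := hVmem v
      rw [← h1] at h2
      obtain ⟨w, hw, hwv⟩ := h2
      have h3 := hVinj (w - v) (by
        rw [Matrix.mulVec_sub, sub_eq_zero]; exact hwv)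
      rwa [← sub_eq_zero.1 h3]
  obtain ⟨i, X, hX1, hX2, hX⟩ := D.exhaustive k σ₀ hirr
  refine ⟨i, V * Xᴴ, fun g => ?_, fun h => hV0 ?_, fun v => ?_⟩
  · have h1 : (σ₀ g).1 * Xᴴ = Xᴴ * D.mat i g := by
      calc (σ₀ g).1 * Xᴴ = Xᴴ * X * (σ₀ g).1 * Xᴴ := by rw [hX1, Matrix.one_mul]
        _ = Xᴴ * (X * (σ₀ g).1) * Xᴴ := by simp only [Matrix.mul_assoc]
        _ = Xᴴ * D.mat i g * (X * Xᴴ) := by rw [hX g]; simp only [mat, Matrix.mul_assoc]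
        _ = _ := by rw [hX2, Matrix.mul_one]
    rw [Matrix.mul_assoc, ← h1, ← Matrix.mul_assoc, hVσ, Matrix.mul_assoc]
  · rw [← Matrix.mul_one V, ← hX1, ← Matrix.mul_assoc, h, Matrix.zero_mul]
  · rw [← Matrix.mulVec_mulVec]
    exact hKK (hVmem _)

/-- Complete reducibility. -/
theorem isotypicSpan_eq_top (θ : G →* Matrix m m ℂ) (hθ : ∀ g, (θ g)ᴴ = θ g⁻¹) :
    D.isotypicSpan θ = ⊤ := by
  by_contra hne
  let e := (WithLp.linearEquiv 2 ℂ (m → ℂ))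
  let W' : Submodule ℂ (EuclideanSpace ℂ m) :=
    (D.isotypicSpan θ).comap (e : EuclideanSpace ℂ m →ₗ[ℂ] (m → ℂ))
  have hinner : ∀ (A : Matrix m m ℂ) (x y : m → ℂ),
      inner ℂ (WithLp.toLp 2 x) (WithLp.toLp 2 (A *ᵥ y))
        = inner ℂ (WithLp.toLp 2 (Aᴴ *ᵥ x)) (WithLp.toLp 2 y : EuclideanSpace ℂ m) := fun A x y => by
    simp only [EuclideanSpace.inner_toLp_toLp, Matrix.star_mulVec, Matrix.conjTranspose_conjTranspose]
    rw [dotProduct_comm, dotProduct_comm y, Matrix.dotProduct_mulVec]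
  have hperp : W'ᗮ ≠ ⊥ := fun h => hne (by
    rw [Submodule.orthogonal_eq_bot_iff] at h
    refine Submodule.eq_top_iff'.2 fun x => ?_
    have h1 : WithLp.toLp 2 x ∈ W' := h ▸ Submodule.mem_top
    exact h1)
  -- An irreducible piece of the orthogonal complement also lies in the span by definition, so it is
  -- orthogonal to itself.
  obtain ⟨σ, T, hT, hT0, hTm⟩ := D.exists_irreducible_isometry θ hθ
    (W'ᗮ.comap (e.symm : (m → ℂ) →ₗ[ℂ] EuclideanSpace ℂ m)) (fun h => hperp (by
      rw [Submodule.eq_bot_iff] at h ⊢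
      intro x hx
      have := h (e x) (by simpa using hx)
      simpa using this)) (fun g x hx => by
      intro y hy
      have h1 := hinner (θ g) (e y) x
      refine h1.trans ?_
      rw [hθ]
      exact hx _ (D.mulVec_mem_isotypicSpan θ _ hy))
  refine hT0 (Matrix.toLin'.injective (LinearMap.ext fun v => ?_))
  have h1 := hTm v
  have h2 : WithLp.toLp 2 (T *ᵥ v) ∈ W' := Submodule.subset_span ⟨σ, T, hT, v, rfl⟩
  have h3 := h1 _ h2
  rw [Matrix.toLin'_apply, map_zero, LinearMap.zero_apply]
  have h4 := inner_self_eq_zero.1 h3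
  exact congrArg e h4

end UnitaryDual

end Schur

/-! ### Fourier analysis on a finite group -/

section Fourier

variable {G : Type*} [Group G]

namespace UnitaryDual

variable (D : UnitaryDual G)

section Complete

variable [Fintype G]

/-- The average of a matrix unit over the group. -/
def avg (σ ρ : D.Idx) (j : D.V ρ) (l : D.V σ) : Matrix (D.V ρ) (D.V σ) ℂ :=
  ∑ b, D.mat ρ b * (Matrix.single j l 1 : Matrix (D.V ρ) (D.V σ) ℂ) * (D.mat σ b)ᴴ

lemma avg_apply (σ ρ : D.Idx) (k l : D.V σ) (i j : D.V ρ) :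
    D.avg σ ρ j l i k = ∑ b, star (D.mat σ b k l) * D.mat ρ b i j := by
  simp only [avg, Matrix.sum_apply]
  refine Finset.sum_congr rfl fun b _ => ?_
  rw [Matrix.mul_apply, Finset.sum_eq_single l]
  · simp [mul_comm]
  · intro c _ hc
    rw [Matrix.mul_single_apply_of_ne _ _ _ _ _ hc]
    simp
  · simp

lemma avg_mul_mat (σ ρ : D.Idx) (j : D.V ρ) (l : D.V σ) (g : G) :
    D.avg σ ρ j l * D.mat σ g = D.mat ρ g * D.avg σ ρ j l := by
  rw [avg, Matrix.sum_mul, Matrix.mul_sum]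
  refine (Fintype.sum_equiv (Equiv.mulLeft g) _ _ fun b => ?_).symm
  rw [Equiv.coe_mulLeft, mat_mul, D.mat_conjTranspose, D.mat_conjTranspose, mul_inv_rev, mat_mul,
    Matrix.mul_assoc _ _ (D.mat σ g), Matrix.mul_assoc _ _ (D.mat σ g), ← mat_mul D σ,
    inv_mul_cancel, mat_one, Matrix.mul_one]
  simp only [Matrix.mul_assoc]

/-- Schur orthogonality of matrix coefficients. -/
theorem sum_star_mat_mul_mat_self (σ : D.Idx) (k l i j : D.V σ) :
    ∑ b, star (D.mat σ b k l) * D.mat σ b i j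
      = if k = i ∧ l = j then (Fintype.card G : ℂ) / D.dim σ else 0 := by
  obtain ⟨c, hc⟩ := D.schur_self _ (D.avg_mul_mat σ σ j l)
  have hd : (D.dim σ : ℂ) ≠ 0 := by exact_mod_cast (D.dim_pos σ).ne'
  have htr : (D.dim σ : ℂ) * c = if l = j then (Fintype.card G : ℂ) else 0 := by
    have h1 : (D.avg σ σ j l).trace = D.dim σ * c := by
      rw [hc, Matrix.trace_smul, Matrix.trace_one]; simp [mul_comm]
    rw [← h1, avg, Matrix.trace_sum]
    have h2 : ∀ b, (D.mat σ b * (Matrix.single j l 1 : Matrix (D.V σ) (D.V σ) ℂ) *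
        (D.mat σ b)ᴴ).trace = if l = j then 1 else 0 := fun b => by
      rw [Matrix.mul_assoc, Matrix.trace_mul_comm, Matrix.mul_assoc, D.mat_conjTranspose,
        ← mat_mul, inv_mul_cancel, mat_one, Matrix.mul_one]
      split_ifs with hlj
      · rw [hlj, Matrix.trace_single_eq_same]
      · rw [Matrix.trace_single_eq_of_ne _ _ _ (Ne.symm hlj)]
    simp [h2]
  have hc' : c = if l = j then (Fintype.card G : ℂ) / D.dim σ else 0 := by
    rw [← mul_right_inj' hd, htr]
    split_ifs
    · field_simp
    · simp
  rw [← avg_apply, hc, Matrix.smul_apply, Matrix.one_apply, smul_eq_mul, hc']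
  by_cases h1 : k = i <;> by_cases h2 : l = j <;> simp [h1, h2, eq_comm (a := i)]

theorem sum_star_mat_mul_mat_of_ne {σ ρ : D.Idx} (h : σ ≠ ρ) (k l : D.V σ) (i j : D.V ρ) :
    ∑ b, star (D.mat σ b k l) * D.mat ρ b i j = 0 := by
  rw [← avg_apply, D.schur_ne h _ (D.avg_mul_mat σ ρ j l)]; rfl

/-- The regular representation. -/
def regular (G : Type*) [Group G] [Fintype G] [DecidableEq G] : G →* Matrix G G ℂ where
  toFun g := Matrix.of fun h k => if h = g * k then 1 else 0
  map_one' := by ext h k; simp [Matrix.one_apply]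
  map_mul' g₁ g₂ := by
    ext h k
    simp [Matrix.mul_apply, mul_assoc]

lemma regular_conjTranspose [DecidableEq G] (g : G) : (regular G g)ᴴ = regular G g⁻¹ := by
  ext h k
  simp only [regular, Matrix.conjTranspose_apply, MonoidHom.coe_mk, OneHom.coe_mk, Matrix.of_apply]
  by_cases hk : k = g * h
  · simp [hk]
  · have : h ≠ g⁻¹ * k := fun h' => hk (by rw [h', mul_inv_cancel_left])
    simp [hk, this]

/-- Completeness of the matrix coefficients. -/
theorem sum_dim_mul_star_mat_mul_mat [DecidableEq G] (b g : G) :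
    ∑ ρ, (D.dim ρ : ℂ) / Fintype.card G * ∑ i, ∑ j, star (D.mat ρ b i j) * D.mat ρ g i j
      = if b = g then 1 else 0 := by
  have hn : (Fintype.card G : ℂ) ≠ 0 := by exact_mod_cast Fintype.card_ne_zero
  let 𝒞 : Submodule ℂ (G → ℂ) :=
    Submodule.span ℂ {f | ∃ (ρ : D.Idx) (i j : D.V ρ), (fun g => D.mat ρ g i j) = f}
  -- The point mass at the unit is a matrix coefficient of the regular representation, which is
  -- completely reducible.
  have hmem : Pi.single (1 : G) (1 : ℂ) ∈ 𝒞 := by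
    let Φ : (G → ℂ) →ₗ[ℂ] (G → ℂ) :=
      { toFun := fun v g => (regular G g *ᵥ v) 1
        map_add' := fun v w => by ext g; simp [Matrix.mulVec_add]
        map_smul' := fun c v => by ext g; simp [Matrix.mulVec_smul] }
    have h1 : D.isotypicSpan (regular G) ≤ 𝒞.comap Φ := by
      refine Submodule.span_le.2 ?_
      rintro _ ⟨σ, T, hT, v, rfl⟩
      have : Φ (T *ᵥ v) = ∑ i, ∑ j, (T 1 i * v j) • (fun g => D.mat σ g i j) := by
        ext g
        show (regular G g *ᵥ (T *ᵥ v)) 1 = _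
        rw [Matrix.mulVec_mulVec, ← hT, ← Matrix.mulVec_mulVec]
        simp only [Matrix.mulVec, dotProduct, Finset.sum_apply, Pi.smul_apply, smul_eq_mul,
          Finset.mul_sum]
        refine Finset.sum_congr rfl fun i _ => Finset.sum_congr rfl fun j _ => by ring
      rw [SetLike.mem_coe, Submodule.mem_comap, this]
      exact Submodule.sum_mem _ fun i _ => Submodule.sum_mem _ fun j _ =>
        Submodule.smul_mem _ _ (Submodule.subset_span ⟨σ, i, j, rfl⟩)
    rw [D.isotypicSpan_eq_top _ regular_conjTranspose] at h1
    have h2 : Φ (Pi.single 1 1) ∈ 𝒞 := h1 Submodule.mem_top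
    convert h2 using 1
    ext g
    show _ = (regular G g *ᵥ Pi.single 1 1) 1
    simp only [Matrix.mulVec_single_one, regular, MonoidHom.coe_mk, OneHom.coe_mk, Matrix.col_apply,
      Matrix.of_apply, mul_one, Pi.single_apply, eq_comm]
  -- Fourier inversion holds for a single coefficient by Schur orthogonality and extends linearly.
  -- Applied to the point mass at `b⁻¹ g` it becomes the completeness relation.
  have hexp : ∀ f ∈ 𝒞, ∀ g, f g = ∑ ρ, (D.dim ρ : ℂ) / Fintype.card G *
      ∑ i, ∑ j, (∑ b, star (D.mat ρ b i j) * f b) * D.mat ρ g i j := by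
    intro f hf g
    induction hf using Submodule.span_induction with
    | mem f hf =>
      obtain ⟨σ, k, l, rfl⟩ := hf
      rw [Finset.sum_eq_single σ]
      · have hd : (D.dim σ : ℂ) ≠ 0 := by exact_mod_cast (D.dim_pos σ).ne'
        simp only [sum_star_mat_mul_mat_self]
        rw [Finset.sum_eq_single k, Finset.sum_eq_single l]
        · simp only [and_self, if_true]; field_simp
        · intro j _ hj; simp [hj]
        · simp
        · intro i _ hi; simp [hi]
        · simp
      · intro ρ _ hρ
        simp only [D.sum_star_mat_mul_mat_of_ne hρ, zero_mul, Finset.sum_const_zero, mul_zero]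
      · simp
    | zero => simp
    | add f₁ f₂ _ _ h₁ h₂ =>
      rw [Pi.add_apply, h₁, h₂]
      simp only [Pi.add_apply, mul_add, add_mul, Finset.sum_add_distrib]
    | smul c f _ h =>
      rw [Pi.smul_apply, h, smul_eq_mul]
      simp only [Pi.smul_apply, smul_eq_mul, Finset.mul_sum, Finset.sum_mul]
      refine Finset.sum_congr rfl fun ρ _ => Finset.sum_congr rfl fun i _ =>
        Finset.sum_congr rfl fun j _ => Finset.sum_congr rfl fun b _ => by ring
  have h1 := hexp _ hmem (b⁻¹ * g)
  have h2 : (Pi.single (1 : G) (1 : ℂ) : G → ℂ) (b⁻¹ * g) = if b = g then 1 else 0 := by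
    rw [Pi.single_apply]
    congr 1
    rw [inv_mul_eq_one]
  rw [h2] at h1
  rw [h1]
  refine Finset.sum_congr rfl fun ρ _ => ?_
  congr 1
  have h3 : ∀ i j, (∑ b, star (D.mat ρ b i j) * (Pi.single (1 : G) (1 : ℂ) : G → ℂ) b)
      = if i = j then 1 else 0 := fun i j => by
    rw [Finset.sum_eq_single 1]
    · simp only [mat_one, Matrix.one_apply, Pi.single_eq_same, mul_one]
      split_ifs <;> simp
    · intro b _ hb; simp [hb]
    · simp
  simp only [h3, ite_mul, one_mul, zero_mul, Finset.sum_ite_eq, Finset.mem_univ, if_true]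
  rw [Finset.sum_comm]
  refine Finset.sum_congr rfl fun j _ => ?_
  rw [mat_mul, Matrix.mul_apply, ← mat_conjTranspose]
  rfl

theorem sum_dim_sq : ∑ ρ, (D.dim ρ : ℝ) ^ 2 = Fintype.card G := by
  classical
  have hn : (Fintype.card G : ℂ) ≠ 0 := by exact_mod_cast Fintype.card_ne_zero
  have h1 := D.sum_dim_mul_star_mat_mul_mat 1 1
  simp only [mat_one, Matrix.one_apply, if_true] at h1
  have h2 : ∀ ρ : D.Idx, ∑ i : D.V ρ, ∑ j : D.V ρ,
      (star (if i = j then 1 else 0 : ℂ) * if i = j then 1 else 0) = D.dim ρ := fun ρ => by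
    simp
  simp only [h2] at h1
  have h3 : ∑ ρ, (D.dim ρ : ℂ) ^ 2 = Fintype.card G := by
    rw [← mul_one (Fintype.card G : ℂ), ← h1, Finset.mul_sum]
    refine Finset.sum_congr rfl fun ρ _ => ?_
    field_simp
  exact_mod_cast h3

end Complete

namespace IntertwinerBases

variable {D} (B : D.IntertwinerBases)

lemma T_mul_mat (π ρ σ : D.Idx) (e) (g : G) :
    B.T π ρ σ e * D.mat σ g = (D.mat π g ⊗ₖ D.mat ρ g) * B.T π ρ σ e := by
  have : B.T π ρ σ e ∈ D.intertwiners π ρ σ := by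
    rw [← B.span_eq]; exact Submodule.subset_span ⟨e, rfl⟩
  exact this g

lemma conjTranspose_T_mul (π ρ σ : D.Idx) (e) (g : G) :
    (B.T π ρ σ e)ᴴ * (D.mat π g ⊗ₖ D.mat ρ g) = D.mat σ g * (B.T π ρ σ e)ᴴ := by
  have h1 := congrArg Matrix.conjTranspose (B.T_mul_mat π ρ σ e g⁻¹)
  rw [Matrix.conjTranspose_mul, Matrix.conjTranspose_mul, Matrix.conjTranspose_kronecker,
    mat_conjTranspose, mat_conjTranspose, mat_conjTranspose, inv_inv] at h1
  exact h1.symm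

lemma conjTranspose_T_mul_T_of_ne {π ρ σ σ' : D.Idx} (h : σ' ≠ σ) (e e') :
    (B.T π ρ σ' e')ᴴ * B.T π ρ σ e = 0 := by
  refine D.schur_ne (Ne.symm h) _ fun g => ?_
  rw [Matrix.mul_assoc, B.T_mul_mat, ← Matrix.mul_assoc, B.conjTranspose_T_mul, Matrix.mul_assoc]

/-- The bases of all intertwiner spaces add up to an orthonormal decomposition of `π ⊗ ρ`. -/
theorem sum_T_mul_conjTranspose (π ρ : D.Idx) :
    ∑ σ, ∑ e, B.T π ρ σ e * (B.T π ρ σ e)ᴴ = 1 := by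
  let θ : G →* Matrix (D.V π × D.V ρ) (D.V π × D.V ρ) ℂ :=
    { toFun := fun g => D.mat π g ⊗ₖ D.mat ρ g
      map_one' := by simp
      map_mul' := fun g h => by simp only [mat_mul, Matrix.mul_kronecker_mul] }
  have hθ : ∀ g, (θ g)ᴴ = θ g⁻¹ := fun g => by
    show (D.mat π g ⊗ₖ D.mat ρ g)ᴴ = D.mat π g⁻¹ ⊗ₖ D.mat ρ g⁻¹
    rw [Matrix.conjTranspose_kronecker, mat_conjTranspose, mat_conjTranspose]
  set Q := ∑ σ, ∑ e, B.T π ρ σ e * (B.T π ρ σ e)ᴴ with hQ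
  have hQT : ∀ σ e, Q * B.T π ρ σ e = B.T π ρ σ e := fun σ e => by
    rw [hQ, Matrix.sum_mul, Finset.sum_eq_single σ, Matrix.sum_mul, Finset.sum_eq_single e]
    · rw [Matrix.mul_assoc, B.orthonormal, if_pos rfl, Matrix.mul_one]
    · intro e' _ he'
      rw [Matrix.mul_assoc, B.orthonormal, if_neg he', Matrix.mul_zero]
    · simp
    · intro σ' _ hσ'
      rw [Matrix.sum_mul]
      refine Finset.sum_eq_zero fun e' _ => ?_
      rw [Matrix.mul_assoc, B.conjTranspose_T_mul_T_of_ne hσ', Matrix.mul_zero]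
    · simp
  refine Matrix.toLin'.injective (LinearMap.ext fun x => ?_)
  have hx : x ∈ D.isotypicSpan θ := by rw [D.isotypicSpan_eq_top θ hθ]; trivial
  rw [Matrix.toLin'_apply, Matrix.toLin'_apply, Matrix.one_mulVec]
  induction hx using Submodule.span_induction with
  | mem x hx =>
    obtain ⟨σ, T, hT, v, rfl⟩ := hx
    have hT' : T ∈ Submodule.span ℂ (Set.range (B.T π ρ σ)) := by
      rw [B.span_eq]; exact hT
    have : Q * T = T := by
      clear hT
      induction hT' using Submodule.span_induction with
      | mem S hS => obtain ⟨e, rfl⟩ := hS; exact hQT σ e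
      | zero => simp
      | add S S' _ _ h h' => rw [Matrix.mul_add, h, h']
      | smul c S _ h => rw [Matrix.mul_smul, h]
    rw [Matrix.mulVec_mulVec, this]
  | zero => simp
  | add x y _ _ hx hy => rw [Matrix.mulVec_add, hx, hy]
  | smul c x _ hx => rw [Matrix.mulVec_smul, hx]

lemma sum_T_mul_mat_mul (π ρ : D.Idx) (g : G) :
    ∑ σ, ∑ e, B.T π ρ σ e * D.mat σ g * (B.T π ρ σ e)ᴴ = D.mat π g ⊗ₖ D.mat ρ g := by
  simp only [T_mul_mat, Matrix.mul_assoc, ← Finset.mul_sum, sum_T_mul_conjTranspose, Matrix.mul_one]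

end IntertwinerBases

end UnitaryDual

end Fourier

/-! ### Calculus of amplifications -/

section AmplificationCalculus

variable {A : Type*} [Ring A] [StarRing A] [Algebra ℂ A] [StarModule ℂ A]
variable {k l m n p q : Type*}

/-- `X ⊗ T` for a scalar matrix `T`. -/
def tk (X : Matrix m n A) (T : Matrix p q ℂ) : Matrix (m × p) (n × q) A := X ⊗ₖ scal A T

omit [StarRing A] [StarModule ℂ A]

@[simp] lemma scal_apply (T : Matrix m n ℂ) (i : m) (j : n) :
    scal A T i j = algebraMap ℂ A (T i j) := rfl

lemma tk_apply (X : Matrix m n A) (T : Matrix p q ℂ) (i : m × p) (j : n × q) :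
    tk X T i j = T i.2 j.2 • X i.1 j.1 := by
  rw [tk, Matrix.kronecker_apply, scal_apply, ← Algebra.commutes, Algebra.smul_def]

lemma scal_mul [Fintype n] (S : Matrix m n ℂ) (T : Matrix n p ℂ) :
    scal A (S * T) = scal A S * scal A T := by
  rw [scal, Matrix.map_mul]; rfl

lemma scal_sum {ι : Type*} (s : Finset ι) (T : ι → Matrix m n ℂ) :
    scal A (∑ i ∈ s, T i) = ∑ i ∈ s, scal A (T i) := by
  ext i j
  simp [Matrix.sum_apply]

@[simp] lemma scal_one [DecidableEq n] : scal A (1 : Matrix n n ℂ) = 1 :=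
  Matrix.map_one _ (map_zero _) (map_one _)

lemma rightAmp_eq_tk [DecidableEq q] (X : Matrix m n A) : rightAmp q X = tk X (1 : Matrix q q ℂ) := by
  rw [rightAmp, tk, scal_one]

lemma scal_kronecker (S : Matrix m n ℂ) (T : Matrix p q ℂ) :
    scal A (S ⊗ₖ T) = tk (scal A S) T := by
  ext i j
  simp [tk_apply, Algebra.smul_def, mul_comm (S _ _)]

lemma tk_mul [Fintype n] [Fintype q] (X : Matrix m n A) (S : Matrix p q ℂ) (Y : Matrix n k A)
    (T : Matrix q l ℂ) : tk X S * tk Y T = tk (X * Y) (S * T) := by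
  ext i j
  simp only [Matrix.mul_apply, tk_apply, Fintype.sum_prod_type, smul_mul_smul_comm,
    Finset.sum_smul_sum]
  rw [Finset.sum_comm]

lemma sum_tk {ι : Type*} (s : Finset ι) (X : ι → Matrix m n A) (T : Matrix p q ℂ) :
    ∑ i ∈ s, tk (X i) T = tk (∑ i ∈ s, X i) T := by
  ext i j
  simp [Matrix.sum_apply, tk_apply, Finset.smul_sum]

lemma tk_sum {ι : Type*} (s : Finset ι) (X : Matrix m n A) (T : ι → Matrix p q ℂ) :
    ∑ i ∈ s, tk X (T i) = tk X (∑ i ∈ s, T i) := by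
  ext i j
  simp [Matrix.sum_apply, tk_apply, Finset.sum_smul]

@[simp] lemma tk_one_one [DecidableEq m] [DecidableEq p] :
    tk (1 : Matrix m m A) (1 : Matrix p p ℂ) = 1 := by
  rw [tk, scal_one, Matrix.one_kronecker_one]

lemma tk_kronecker {k' l' : Type*} (X : Matrix m n A) (S : Matrix p q ℂ) (T : Matrix k' l' ℂ) :
    tk X (S ⊗ₖ T) = (tk (tk X S) T).submatrix (Equiv.prodAssoc m p k').symm
      (Equiv.prodAssoc n q l').symm := by
  ext i j
  simp [tk_apply, smul_smul, mul_comm]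

include A in
lemma rightAmp_mul [DecidableEq q] [Fintype q] [Fintype n] (X : Matrix m n A) (Y : Matrix n k A) :
    rightAmp q (X * Y) = rightAmp q X * rightAmp q Y := by
  simp only [rightAmp_eq_tk, tk_mul, Matrix.one_mul]

lemma rightAmp_amp [DecidableEq q] [DecidableEq n] (x : A) :
    rightAmp q (amp n x) = amp (n × q) x := by
  ext i j
  rw [rightAmp_eq_tk, tk_apply]
  rcases i with ⟨i, r⟩
  rcases j with ⟨j, s⟩
  simp only [amp, Matrix.diagonal_apply, Matrix.one_apply, Prod.mk.injEq]
  by_cases h : i = j <;> by_cases h' : r = s <;> simp [h, h']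

lemma amp_mul_amp [DecidableEq n] [Fintype n] (x y : A) : amp n x * amp n y = amp n (x * y) := by
  simp [amp]

lemma amp_mul_apply [DecidableEq m] [Fintype m] (x : A) (X : Matrix m n A) (i : m) (j : n) :
    (amp m x * X) i j = x * X i j := by
  simp [amp, Matrix.diagonal_mul]

lemma mul_amp_apply [DecidableEq n] [Fintype n] (X : Matrix m n A) (x : A) (i : m) (j : n) :
    (X * amp n x) i j = X i j * x := by
  simp [amp, Matrix.mul_diagonal]

lemma scal_mul_amp [DecidableEq m] [DecidableEq n] [Fintype m] [Fintype n] (T : Matrix m n ℂ)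
    (x : A) : scal A T * amp n x = amp m x * scal A T := by
  ext i j
  rw [mul_amp_apply, amp_mul_apply, scal_apply, Algebra.commutes]

@[simp] lemma amp_one [DecidableEq n] : amp n (1 : A) = 1 := rfl

section Star

variable [StarRing A] [StarModule ℂ A]

lemma conjTranspose_scal (T : Matrix m n ℂ) : (scal A T)ᴴ = scal A Tᴴ := by
  ext i j
  exact (algebraMap_star_comm _).symm

lemma conjTranspose_tk (X : Matrix m n A) (T : Matrix p q ℂ) : (tk X T)ᴴ = tk Xᴴ Tᴴ := by
  ext i j
  simp [tk_apply]

lemma conjTranspose_rightAmp [DecidableEq q] (X : Matrix m n A) :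
    (rightAmp q X)ᴴ = rightAmp q Xᴴ := by
  rw [rightAmp_eq_tk, conjTranspose_tk, Matrix.conjTranspose_one, rightAmp_eq_tk]

omit [StarModule ℂ A]

lemma conjTranspose_amp [DecidableEq n] (x : A) : (amp n x)ᴴ = amp n (star x) := by
  simp [amp, Matrix.diagonal_conjTranspose]

variable [Fintype p] [DecidableEq p] (φ : A →⋆ₐ[ℂ] Matrix p p A)

lemma ampMap_apply (X : Matrix m n A) (a : p × m) (b : p × n) :
    ampMap φ X a b = φ (X a.2 b.2) a.1 b.1 := rfl

lemma ampMap_mul [Fintype n] (X : Matrix m n A) (Y : Matrix n k A) :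
    ampMap φ (X * Y) = ampMap φ X * ampMap φ Y := by
  ext a b
  simp only [ampMap_apply, Matrix.mul_apply, map_sum, map_mul, Matrix.sum_apply,
    Fintype.sum_prod_type]
  rw [Finset.sum_comm]

lemma ampMap_sum {ι : Type*} (s : Finset ι) (X : ι → Matrix m n A) :
    ampMap φ (∑ i ∈ s, X i) = ∑ i ∈ s, ampMap φ (X i) := by
  ext a b
  simp [ampMap_apply, Matrix.sum_apply]

lemma ampMap_conjTranspose (X : Matrix m n A) : (ampMap φ X)ᴴ = ampMap φ Xᴴ := by
  ext a b
  simp only [ampMap_apply, Matrix.conjTranspose_apply, map_star, Matrix.star_apply]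

lemma ampMap_scal (T : Matrix m n ℂ) : ampMap φ (scal A T) = tk 1 T := by
  ext a b
  rw [ampMap_apply, tk_apply, scal_apply, Algebra.algebraMap_eq_smul_one, map_smul, map_one]
  rfl

lemma ampMap_amp [DecidableEq n] (x : A) : ampMap φ (amp n x) = rightAmp n (φ x) := by
  ext ⟨i, r⟩ ⟨j, s⟩
  rw [ampMap_apply, rightAmp_eq_tk, tk_apply]
  simp only [amp, Matrix.diagonal_apply, Matrix.one_apply]
  by_cases h : r = s <;> simp [h]

lemma ampMap_tk {k' l' : Type*} (X : Matrix m n A) (T : Matrix k' l' ℂ) :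
    ampMap φ (tk X T) = (tk (ampMap φ X) T).submatrix (Equiv.prodAssoc p m k').symm
      (Equiv.prodAssoc p n l').symm := by
  ext ⟨i, r, s⟩ ⟨j, r', s'⟩
  simp [ampMap_apply, tk_apply]

end Star

end AmplificationCalculus

/-! ### Fourier coefficients -/

section FourierCoefficients

variable {G : Type*} [Group G] [Fintype G] (D : UnitaryDual G)
variable {A : Type*} [Ring A] [Algebra ℂ A]
variable {m n : Type*}

/-- The Fourier coefficients of a family `Y_σ ∈ A ⊗ B(H_σ)`, so that
`Y_σ = ∑_b Y^b ⊗ σ(b)`. -/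
def fourierCoeff (Y : ∀ σ : D.Idx, Matrix (m × D.V σ) (n × D.V σ) A) (b : G) : Matrix m n A :=
  Matrix.of fun i l => ∑ ρ, ((D.dim ρ : ℂ) / Fintype.card G) •
    ∑ r, ∑ s, star (D.mat ρ b r s) • Y ρ (i, r) (l, s)

/-- Schur orthogonality, which gives inversion on the dual side; completeness of the coefficients
gives the converse inversion below, hence uniqueness. -/
theorem sum_tk_fourierCoeff (Y : ∀ σ : D.Idx, Matrix (m × D.V σ) (n × D.V σ) A) (σ : D.Idx) :
    ∑ b, tk (fourierCoeff D Y b) (D.mat σ b) = Y σ := by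
  have hn : (Fintype.card G : ℂ) ≠ 0 := by exact_mod_cast Fintype.card_ne_zero
  have hd : (D.dim σ : ℂ) ≠ 0 := by exact_mod_cast (D.dim_pos σ).ne'
  ext ⟨i, r⟩ ⟨l, s⟩
  have h1 : ∀ b, tk (fourierCoeff D Y b) (D.mat σ b) (i, r) (l, s)
      = ∑ ρ, ∑ r', ∑ s', ((D.dim ρ : ℂ) / Fintype.card G *
          (star (D.mat ρ b r' s') * D.mat σ b r s)) • Y ρ (i, r') (l, s') := fun b => by
    simp only [tk_apply, fourierCoeff, Matrix.of_apply, Finset.smul_sum, smul_smul]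
    refine Finset.sum_congr rfl fun ρ _ => Finset.sum_congr rfl fun r' _ =>
      Finset.sum_congr rfl fun s' _ => ?_
    congr 1; ring
  rw [Matrix.sum_apply]
  simp only [h1]
  rw [Finset.sum_comm, Finset.sum_eq_single σ]
  · rw [Finset.sum_comm]
    simp only [Finset.sum_comm (s := (Finset.univ : Finset G)), ← Finset.sum_smul, ← Finset.mul_sum,
      D.sum_star_mat_mul_mat_self]
    rw [Finset.sum_eq_single r, Finset.sum_eq_single s]
    · simp only [and_self, if_true]
      rw [div_mul_div_cancel₀ hn, div_self hd, one_smul]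
    · intro s' _ hs'; simp [hs']
    · simp
    · intro r' _ hr'; simp [hr']
    · simp
  · intro ρ _ hρ
    rw [Finset.sum_comm]
    simp only [Finset.sum_comm (s := (Finset.univ : Finset G)), ← Finset.sum_smul, ← Finset.mul_sum,
      D.sum_star_mat_mul_mat_of_ne hρ, mul_zero, zero_smul, Finset.sum_const_zero]
  · simp

theorem fourierCoeff_sum_tk (Z : G → Matrix m n A) (g : G) :
    fourierCoeff D (fun σ => ∑ b, tk (Z b) (D.mat σ b)) g = Z g := by
  classical
  ext i l
  have h1 : fourierCoeff D (fun σ => ∑ b, tk (Z b) (D.mat σ b)) g i l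
      = ∑ b, (∑ ρ, (D.dim ρ : ℂ) / Fintype.card G *
          ∑ r, ∑ s, star (D.mat ρ g r s) * D.mat ρ b r s) • Z b i l := by
    simp only [fourierCoeff, Matrix.of_apply, Matrix.sum_apply, tk_apply, Finset.smul_sum, smul_smul,
      Finset.sum_smul, Finset.mul_sum]
    rw [Finset.sum_comm]
    rw [Finset.sum_comm]
    rw [Finset.sum_comm (s := (Finset.univ : Finset G))]
    refine Finset.sum_congr rfl fun ρ _ => ?_
    rw [Finset.sum_comm (s := (Finset.univ : Finset G))]
    refine Finset.sum_congr rfl fun r _ => ?_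
    rw [Finset.sum_comm (s := (Finset.univ : Finset G))]
  rw [h1]
  simp only [D.sum_dim_mul_star_mat_mul_mat]
  simp

lemma fourierCoeff_unique {Y : ∀ σ : D.Idx, Matrix (m × D.V σ) (n × D.V σ) A} {Z : G → Matrix m n A}
    (h : ∀ σ, Y σ = ∑ b, tk (Z b) (D.mat σ b)) (g : G) : fourierCoeff D Y g = Z g := by
  obtain rfl : Y = fun σ => ∑ b, tk (Z b) (D.mat σ b) := funext h
  exact fourierCoeff_sum_tk D Z g

end FourierCoefficients

/-! ### The Fourier coefficients of a cocycle -/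

section CocycleCoefficients

variable {G : Type*} [Group G] [Fintype G] [DecidableEq G] {D : UnitaryDual G}
  {B : D.IntertwinerBases}
variable {A : Type*} [Ring A] [StarRing A] [Algebra ℂ A] [StarModule ℂ A]

/-- The coefficient map of the coproduct, `Y ↦ ∑_{σ,e} T_{π,ρ}^{σ,e} Y_σ T_{π,ρ}^{σ,e}*`. -/
def coproduct (B : D.IntertwinerBases) (Y : ∀ σ : D.Idx, Matrix (D.V σ) (D.V σ) A)
    (π ρ : D.Idx) : Matrix (D.V π × D.V ρ) (D.V π × D.V ρ) A :=
  ∑ σ, ∑ e, scal A (B.T π ρ σ e) * Y σ * scal A (B.T π ρ σ e)ᴴ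

omit [Fintype G] [DecidableEq G] [StarRing A] [StarModule ℂ A] in
lemma sum_scal_T_mul (B : D.IntertwinerBases) (π ρ : D.Idx) :
    ∑ σ, ∑ e, scal A (B.T π ρ σ e) * scal A (B.T π ρ σ e)ᴴ = 1 := by
  simp only [← scal_mul, ← scal_sum, B.sum_T_mul_conjTranspose, scal_one]

variable {α : ∀ π : D.Idx, A →⋆ₐ[ℂ] Matrix (D.V π) (D.V π) A}
    {U : ∀ π ρ : D.Idx, Matrix (D.V π × D.V ρ) (D.V π × D.V ρ) A}

namespace IsCocycleTwistedAction

variable (h : IsCocycleTwistedAction D B α U)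
include h

/-- As `σ(b)* σ(c) = σ(b⁻¹ c)`, the product `U* U` has the left side as its coefficient at `d`.
Unitarity for all `σ` at once identifies it with the coefficient of `1`. -/
lemma sum_conjTranspose_mul_coeff (π : D.Idx) (d : G) :
    ∑ b, (fourierCoeff D (U π) b)ᴴ * fourierCoeff D (U π) (b * d) = if d = 1 then 1 else 0 := by
  have key : ∀ σ, (1 : Matrix (D.V π × D.V σ) (D.V π × D.V σ) A)
      = ∑ d, tk (∑ b, (fourierCoeff D (U π) b)ᴴ * fourierCoeff D (U π) (b * d)) (D.mat σ d) := by
    intro σ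
    rw [← (Unitary.mem_iff.1 (h.unitary_mem π σ)).1, Matrix.star_eq_conjTranspose]
    conv_lhs => rw [← sum_tk_fourierCoeff D (U π) σ]
    simp only [Matrix.conjTranspose_sum, conjTranspose_tk, Matrix.sum_mul, Matrix.mul_sum, tk_mul,
      D.mat_conjTranspose, ← D.mat_mul, ← sum_tk]
    conv_rhs => rw [Finset.sum_comm]
    rw [Finset.sum_comm]
    refine Finset.sum_congr rfl fun b _ => ?_
    refine (Fintype.sum_equiv (Equiv.mulLeft b) _ _ fun d => ?_).symm
    simp
  have key' : ∀ σ, (1 : Matrix (D.V π × D.V σ) (D.V π × D.V σ) A)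
      = ∑ d, tk (if d = 1 then (1 : Matrix (D.V π) (D.V π) A) else 0) (D.mat σ d) := by
    intro σ
    rw [Finset.sum_eq_single 1]
    · simp
    · intro b _ hb
      rw [if_neg hb]; ext i j; simp [tk_apply]
    · simp
  rw [← fourierCoeff_unique D key, fourierCoeff_unique D key']

lemma sum_coeff_mul_conjTranspose (π : D.Idx) (d : G) :
    ∑ c, fourierCoeff D (U π) (d * c) * (fourierCoeff D (U π) c)ᴴ = if d = 1 then 1 else 0 := by
  have key : ∀ σ, (1 : Matrix (D.V π × D.V σ) (D.V π × D.V σ) A)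
      = ∑ d, tk (∑ c, fourierCoeff D (U π) (d * c) * (fourierCoeff D (U π) c)ᴴ) (D.mat σ d) := by
    intro σ
    rw [← (Unitary.mem_iff.1 (h.unitary_mem π σ)).2, Matrix.star_eq_conjTranspose]
    conv_lhs => rw [← sum_tk_fourierCoeff D (U π) σ]
    simp only [Matrix.conjTranspose_sum, conjTranspose_tk, Matrix.sum_mul, Matrix.mul_sum, tk_mul,
      D.mat_conjTranspose, ← D.mat_mul, ← sum_tk]
    conv_rhs => rw [Finset.sum_comm]
    rw [Finset.sum_comm]
    conv_lhs => rw [Finset.sum_comm]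
    refine Finset.sum_congr rfl fun c _ => ?_
    refine (Fintype.sum_equiv (Equiv.mulRight c) _ _ fun d => ?_).symm
    simp
  have key' : ∀ σ, (1 : Matrix (D.V π × D.V σ) (D.V π × D.V σ) A)
      = ∑ d, tk (if d = 1 then (1 : Matrix (D.V π) (D.V π) A) else 0) (D.mat σ d) := by
    intro σ
    rw [Finset.sum_eq_single 1]
    · simp
    · intro b _ hb
      rw [if_neg hb]; ext i j; simp [tk_apply]
    · simp
  rw [← fourierCoeff_unique D key, fourierCoeff_unique D key']

lemma coeff_triv (d : G) : fourierCoeff D (U D.triv) d = if d = 1 then 1 else 0 := by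
  refine fourierCoeff_unique D (Z := fun d => if d = 1 then 1 else 0) (fun σ => ?_) d
  rw [h.left_triv, Finset.sum_eq_single 1]
  · simp
  · intro b _ hb
    rw [if_neg hb]; ext i j; simp [tk_apply]
  · simp

/-- The cocycle identity in terms of Fourier coefficients. -/
lemma sum_ampMap_coeff_mul (π ρ : D.Idx) (d : G) :
    ∑ b, ampMap (α π) (fourierCoeff D (U ρ) b) *
        tk (fourierCoeff D (U π) (b⁻¹ * d)) (D.mat ρ (b⁻¹ * d))
      = U π ρ * coproduct B (fun ζ => fourierCoeff D (U ζ) d) π ρ := by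
  set u : ∀ π, G → Matrix (D.V π) (D.V π) A := fun π => fourierCoeff D (U π) with hu
  have hU : ∀ π σ, U π σ = ∑ b, tk (u π b) (D.mat σ b) := fun π σ =>
    (sum_tk_fourierCoeff D (U π) σ).symm
  -- The inner sum over `ξ, b` is a resolution of the identity and disappears; the outer one
  -- assembles the matrices `η(c)` into `ρ(c) ⊗ σ(c)`.
  have lhs : ∀ σ, (∑ η, ∑ a, ∑ ξ, ∑ b,
        ampMap (α π) (U ρ σ * scal A (B.T ρ σ η a)) * (U π η * scal A (B.T π η ξ b)) *
          scal A (B.T π η ξ b)ᴴ * scal A ((1 : Matrix (D.V π) (D.V π) ℂ) ⊗ₖ (B.T ρ σ η a)ᴴ))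
      = ∑ b, ∑ c, ampMap (α π) (tk (u ρ b) (D.mat σ b)) *
          tk (u π c) (D.mat ρ c ⊗ₖ D.mat σ c) := fun σ => by
    have h1 : ∀ η a, (∑ ξ, ∑ b,
        ampMap (α π) (U ρ σ * scal A (B.T ρ σ η a)) * (U π η * scal A (B.T π η ξ b)) *
          scal A (B.T π η ξ b)ᴴ * scal A ((1 : Matrix (D.V π) (D.V π) ℂ) ⊗ₖ (B.T ρ σ η a)ᴴ))
        = ampMap (α π) (U ρ σ) * ∑ c, tk (u π c) (B.T ρ σ η a * D.mat η c * (B.T ρ σ η a)ᴴ) := by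
      intro η a
      have h2 : ∀ ξ b, ampMap (α π) (U ρ σ * scal A (B.T ρ σ η a)) *
          (U π η * scal A (B.T π η ξ b)) * scal A (B.T π η ξ b)ᴴ *
          scal A ((1 : Matrix (D.V π) (D.V π) ℂ) ⊗ₖ (B.T ρ σ η a)ᴴ)
          = ampMap (α π) (U ρ σ * scal A (B.T ρ σ η a)) * U π η *
            (scal A (B.T π η ξ b) * scal A (B.T π η ξ b)ᴴ) *
            scal A ((1 : Matrix (D.V π) (D.V π) ℂ) ⊗ₖ (B.T ρ σ η a)ᴴ) := fun ξ b => by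
        simp only [Matrix.mul_assoc]
      simp only [h2, ← Matrix.sum_mul, ← Matrix.mul_sum, sum_scal_T_mul, Matrix.mul_one]
      rw [ampMap_mul, ampMap_scal, scal_kronecker, scal_one, hU π η, Matrix.mul_assoc,
        Matrix.mul_assoc]
      congr 1
      rw [← Matrix.mul_assoc, Matrix.mul_sum, Matrix.sum_mul]
      simp only [tk_mul, Matrix.one_mul, Matrix.mul_one]
    simp only [h1, ← Matrix.mul_sum]
    rw [hU ρ σ, ampMap_sum, Matrix.sum_mul]
    refine Finset.sum_congr rfl fun b _ => ?_
    congr 1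
    simp only [Finset.sum_comm (t := (Finset.univ : Finset G)), tk_sum, B.sum_T_mul_mat_mul]
  have rhs : ∀ σ, (∑ ζ, ∑ c, ∑ ξ, ∑ d,
        rightAmp (D.V σ) (U π ρ * scal A (B.T π ρ ζ c)) * (U ζ σ * scal A (B.T ζ σ ξ d)) *
          scal A (B.T ζ σ ξ d)ᴴ * scal A ((B.T π ρ ζ c)ᴴ ⊗ₖ (1 : Matrix (D.V σ) (D.V σ) ℂ)))
      = ∑ d, tk (U π ρ * coproduct B (fun ζ => u ζ d) π ρ) (D.mat σ d) := fun σ => by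
    have h1 : ∀ ζ c, (∑ ξ, ∑ d,
        rightAmp (D.V σ) (U π ρ * scal A (B.T π ρ ζ c)) * (U ζ σ * scal A (B.T ζ σ ξ d)) *
          scal A (B.T ζ σ ξ d)ᴴ * scal A ((B.T π ρ ζ c)ᴴ ⊗ₖ (1 : Matrix (D.V σ) (D.V σ) ℂ)))
        = ∑ d, tk (U π ρ * (scal A (B.T π ρ ζ c) * u ζ d * scal A (B.T π ρ ζ c)ᴴ))
            (D.mat σ d) := by
      intro ζ c
      have h2 : ∀ ξ d, rightAmp (D.V σ) (U π ρ * scal A (B.T π ρ ζ c)) *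
          (U ζ σ * scal A (B.T ζ σ ξ d)) * scal A (B.T ζ σ ξ d)ᴴ *
          scal A ((B.T π ρ ζ c)ᴴ ⊗ₖ (1 : Matrix (D.V σ) (D.V σ) ℂ))
          = rightAmp (D.V σ) (U π ρ * scal A (B.T π ρ ζ c)) * U ζ σ *
            (scal A (B.T ζ σ ξ d) * scal A (B.T ζ σ ξ d)ᴴ) *
            scal A ((B.T π ρ ζ c)ᴴ ⊗ₖ (1 : Matrix (D.V σ) (D.V σ) ℂ)) := fun ξ d => by
        simp only [Matrix.mul_assoc]
      simp only [h2, ← Matrix.sum_mul, ← Matrix.mul_sum, sum_scal_T_mul, Matrix.mul_one]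
      rw [rightAmp_eq_tk, scal_kronecker, hU ζ σ, Matrix.mul_sum, Matrix.sum_mul]
      simp only [tk_mul, Matrix.one_mul, Matrix.mul_one, Matrix.mul_assoc]
    simp only [h1, coproduct, Matrix.mul_sum, ← sum_tk]
    simp only [Finset.sum_comm (t := (Finset.univ : Finset G))]
  -- Both sides are now Fourier expansions in the last leg `σ`; the left one is regrouped by `d = b
  -- c`, and uniqueness of coefficients removes `σ`.
  have key : ∀ σ, ∑ d, tk (U π ρ * coproduct B (fun ζ => u ζ d) π ρ) (D.mat σ d)
      = ∑ d, tk (∑ b, ampMap (α π) (u ρ b) * tk (u π (b⁻¹ * d)) (D.mat ρ (b⁻¹ * d)))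
          (D.mat σ d) := fun σ => by
    rw [← rhs, ← h.cocycle, lhs]
    have h3 : ∀ b c, ampMap (α π) (tk (u ρ b) (D.mat σ b)) * tk (u π c) (D.mat ρ c ⊗ₖ D.mat σ c)
        = (tk (ampMap (α π) (u ρ b) * tk (u π c) (D.mat ρ c)) (D.mat σ (b * c))).submatrix
          (Equiv.prodAssoc _ _ _).symm (Equiv.prodAssoc _ _ _).symm := fun b c => by
      rw [ampMap_tk, tk_kronecker, Matrix.submatrix_mul_equiv, tk_mul, D.mat_mul]
    have h4 : ∀ X : Matrix ((D.V π × D.V ρ) × D.V σ) ((D.V π × D.V ρ) × D.V σ) A,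
        Matrix.reindex (Equiv.prodAssoc _ _ _).symm (Equiv.prodAssoc _ _ _).symm
          (X.submatrix (Equiv.prodAssoc _ _ _).symm (Equiv.prodAssoc _ _ _).symm) = X := fun X => by
      ext ⟨⟨i, r⟩, s⟩ ⟨⟨j, r'⟩, s'⟩; rfl
    have h5 : ∀ f : G → G → Matrix ((D.V π × D.V ρ) × D.V σ) ((D.V π × D.V ρ) × D.V σ) A,
        ∑ b, ∑ c, (f b c).submatrix (Equiv.prodAssoc _ _ _).symm (Equiv.prodAssoc _ _ _).symm
        = (∑ b, ∑ c, f b c).submatrix (Equiv.prodAssoc _ _ _).symm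
          (Equiv.prodAssoc _ _ _).symm := fun f => by
      ext i j; simp [Matrix.sum_apply]
    simp only [h3]
    rw [h5, h4]
    simp only [← sum_tk]
    conv_rhs => rw [Finset.sum_comm]
    refine Finset.sum_congr rfl fun b _ => ?_
    refine Fintype.sum_equiv (Equiv.mulLeft b) _ _ fun c => ?_
    simp
  rw [← fourierCoeff_unique D (fun σ => rfl) d
      (Z := fun d => ∑ b, ampMap (α π) (u ρ b) * tk (u π (b⁻¹ * d)) (D.mat ρ (b⁻¹ * d))),
    fourierCoeff_unique D (fun σ => (key σ).symm)]

end IsCocycleTwistedAction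

end CocycleCoefficients

/-! ### Trivializing the cocycle on matrices over the group -/

section Lift

variable {G : Type*} [Group G] [Fintype G] [DecidableEq G]
variable {A : Type*} [Ring A] [StarRing A] [Algebra ℂ A] [StarModule ℂ A]
variable {k m n p q : Type*}

/-- The `(g, k)`-block of a matrix over `A ⊗ B(ℓ²(G))`. -/
def blk (X : Matrix m n (Matrix G G A)) (g k : G) : Matrix m n A := Matrix.of fun i j => X i j g k

omit [Fintype G] [DecidableEq G] [Group G] in
lemma blk_ext {X Y : Matrix m n (Matrix G G A)} (h : ∀ g k, blk X g k = blk Y g k) : X = Y := by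
  ext i j g k
  exact congrFun (congrFun (h g k) i) j

omit [DecidableEq G] in
lemma blk_mul [Fintype n] (X : Matrix m n (Matrix G G A)) (Y : Matrix n k (Matrix G G A)) (g l : G) :
    blk (X * Y) g l = ∑ h, blk X g h * blk Y h l := by
  ext i j
  simp only [blk, Matrix.of_apply, Matrix.mul_apply, Matrix.sum_apply]
  rw [Finset.sum_comm]

lemma blk_sum {ι : Type*} (s : Finset ι) (X : ι → Matrix m n (Matrix G G A)) (g k : G) :
    blk (∑ i ∈ s, X i) g k = ∑ i ∈ s, blk (X i) g k := by
  ext i j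
  simp [blk, Matrix.sum_apply]

lemma blk_conjTranspose (X : Matrix m n (Matrix G G A)) (g k : G) :
    blk Xᴴ g k = (blk X k g)ᴴ := rfl

lemma blk_one [DecidableEq n] (g k : G) :
    blk (1 : Matrix n n (Matrix G G A)) g k = if g = k then 1 else 0 := by
  ext i j
  simp only [blk, Matrix.of_apply, Matrix.one_apply]
  by_cases h : g = k <;> by_cases h' : i = j <;> simp [h, h', Matrix.one_apply]

lemma blk_tk (X : Matrix m n (Matrix G G A)) (T : Matrix p q ℂ) (g k : G) :
    blk (tk X T) g k = tk (blk X g k) T := by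
  ext i j
  simp [blk, tk_apply]

lemma blk_scal_mul [Fintype n] (T : Matrix m n ℂ) (X : Matrix n k (Matrix G G A)) (g l : G) :
    blk (scal (Matrix G G A) T * X) g l = scal A T * blk X g l := by
  ext i j
  simp only [blk, Matrix.of_apply, Matrix.mul_apply, Matrix.sum_apply, scal_apply, ← Algebra.smul_def,
    Matrix.smul_apply]

lemma blk_mul_scal [Fintype n] (X : Matrix m n (Matrix G G A)) (T : Matrix n k ℂ) (g l : G) :
    blk (X * scal (Matrix G G A) T) g l = blk X g l * scal A T := by
  ext i j
  simp only [blk, Matrix.of_apply, Matrix.mul_apply, Matrix.sum_apply, scal_apply,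
    ← Algebra.commutes, ← Algebra.smul_def, Matrix.smul_apply]

/-- `X ⊗ 1` for a matrix `X` over `A`. -/
def ampEntry (G : Type*) [Fintype G] [DecidableEq G] (X : Matrix m n A) : Matrix m n (Matrix G G A) :=
  X.map (amp G)

lemma blk_ampEntry (X : Matrix m n A) (g k : G) :
    blk (ampEntry G X) g k = if g = k then X else 0 := by
  ext i j
  simp only [blk, ampEntry, Matrix.of_apply, Matrix.map_apply, amp, Matrix.diagonal_apply]
  split_ifs <;> rfl

lemma blk_ampEntry_mul [Fintype n] (X : Matrix m n A) (Y : Matrix n k (Matrix G G A)) (g l : G) :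
    blk (ampEntry G X * Y) g l = X * blk Y g l := by
  rw [blk_mul, Finset.sum_eq_single g]
  · rw [blk_ampEntry, if_pos rfl]
  · intro b _ hb
    rw [blk_ampEntry, if_neg (Ne.symm hb), Matrix.zero_mul]
  · simp

lemma blk_mul_ampEntry [Fintype n] (X : Matrix m n (Matrix G G A)) (Y : Matrix n k A) (g l : G) :
    blk (X * ampEntry G Y) g l = blk X g l * Y := by
  rw [blk_mul, Finset.sum_eq_single l]
  · rw [blk_ampEntry, if_pos rfl]
  · intro b _ hb
    rw [blk_ampEntry, if_neg hb, Matrix.mul_zero]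
  · simp

/-- The entrywise extension of a homomorphism to matrices. -/
def liftHom (G : Type*) [Fintype G] [DecidableEq G] [Fintype p] [DecidableEq p]
    (φ : A →⋆ₐ[ℂ] Matrix p p A) : Matrix G G A →⋆ₐ[ℂ] Matrix p p (Matrix G G A) where
  toFun X := Matrix.of fun i j => Matrix.of fun g k => φ (X g k) i j
  map_one' := by
    ext i j g k
    simp only [Matrix.of_apply, Matrix.one_apply]
    by_cases h : g = k <;> by_cases h' : i = j <;> simp [h, h', Matrix.one_apply]
  map_mul' X Y := by
    ext i j g k
    simp only [Matrix.of_apply, Matrix.mul_apply, map_sum, map_mul, Matrix.sum_apply]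
    rw [Finset.sum_comm]
  map_zero' := by ext; simp
  map_add' X Y := by ext; simp
  commutes' c := by
    ext i j g k
    simp only [Matrix.of_apply, Matrix.algebraMap_matrix_apply]
    by_cases h : g = k <;> by_cases h' : i = j <;>
      simp [h, h', Matrix.algebraMap_matrix_apply, AlgHomClass.commutes]
  map_star' X := by
    ext i j g k
    simp [Matrix.star_apply, map_star]

variable [Fintype p] [DecidableEq p] (φ : A →⋆ₐ[ℂ] Matrix p p A)

lemma liftHom_apply (X : Matrix G G A) (i j : p) (g k : G) :
    liftHom G φ X i j g k = φ (X g k) i j := rfl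

lemma blk_liftHom (X : Matrix G G A) (g k : G) : blk (liftHom G φ X) g k = φ (X g k) := rfl

lemma blk_ampMap_liftHom (X : Matrix m n (Matrix G G A)) (g k : G) :
    blk (ampMap (liftHom G φ) X) g k = ampMap φ (blk X g k) := rfl

end Lift

/-! ### The cocycle is a coboundary on `A ⊗ B(ℓ²(G))`. -/

section Trivialize

variable {G : Type*} [Group G] [Fintype G] [DecidableEq G] {D : UnitaryDual G}
  {B : D.IntertwinerBases}
variable {A : Type*} [Ring A] [StarRing A] [Algebra ℂ A] [StarModule ℂ A]
variable {α : ∀ π : D.Idx, A →⋆ₐ[ℂ] Matrix (D.V π) (D.V π) A}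
    {U : ∀ π ρ : D.Idx, Matrix (D.V π × D.V ρ) (D.V π × D.V ρ) A}

/-- The unitaries over `A ⊗ B(ℓ²(G))` whose coboundary is the cocycle. -/
def trivializer (U : ∀ π ρ : D.Idx, Matrix (D.V π × D.V ρ) (D.V π × D.V ρ) A) (π : D.Idx) :
    Matrix (D.V π) (D.V π) (Matrix G G A) :=
  -- This is `∑_b u_π(b) ⊗ λ(b)`, the cocycle evaluated at the left regular representation `λ`,
  -- times the diagonal matrix of the `π(k)`.
  Matrix.of fun i j => Matrix.of fun g k =>
    (fourierCoeff D (U π) (g * k⁻¹) * scal A (D.mat π k)) i j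

lemma blk_trivializer (π : D.Idx) (g k : G) :
    blk (trivializer U π) g k = fourierCoeff D (U π) (g * k⁻¹) * scal A (D.mat π k) := rfl

lemma blk_coproduct (Y : ∀ σ : D.Idx, Matrix (D.V σ) (D.V σ) (Matrix G G A)) (π ρ : D.Idx)
    (g k : G) : blk (coproduct B Y π ρ) g k = coproduct B (fun σ => blk (Y σ) g k) π ρ := by
  simp only [coproduct, blk_sum, blk_mul_scal, blk_scal_mul]

lemma coproduct_mul_scal (Y : ∀ σ : D.Idx, Matrix (D.V σ) (D.V σ) A) (π ρ : D.Idx) (g : G) :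
    coproduct B (fun σ => Y σ * scal A (D.mat σ g)) π ρ
      = coproduct B Y π ρ * tk (scal A (D.mat π g)) (D.mat ρ g) := by
  simp only [coproduct, Matrix.sum_mul]
  refine Finset.sum_congr rfl fun σ _ => Finset.sum_congr rfl fun e _ => ?_
  rw [← scal_kronecker, Matrix.mul_assoc _ (scal A _) (scal A _), ← scal_mul]
  rw [B.conjTranspose_T_mul, scal_mul]
  simp only [Matrix.mul_assoc]

namespace IsCocycleTwistedAction

variable (h : IsCocycleTwistedAction D B α U)
include h

lemma trivializer_mem_unitary (π : D.Idx) :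
    trivializer U π ∈ unitary (Matrix (D.V π) (D.V π) (Matrix G G A)) := by
  have hs : ∀ g, (scal A (D.mat π g))ᴴ * scal A (D.mat π g) = 1 := fun g => by
    rw [conjTranspose_scal, ← scal_mul, D.mat_conjTranspose, ← D.mat_mul, inv_mul_cancel, D.mat_one,
      scal_one]
  have hs' : ∀ g, scal A (D.mat π g) * (scal A (D.mat π g))ᴴ = 1 := fun g => by
    rw [conjTranspose_scal, ← scal_mul, D.mat_conjTranspose, ← D.mat_mul, mul_inv_cancel, D.mat_one,
      scal_one]
  rw [Unitary.mem_iff]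
  constructor
  · refine blk_ext fun g k => ?_
    rw [Matrix.star_eq_conjTranspose, blk_mul, blk_one]
    have h1 : ∀ l, blk (trivializer U π)ᴴ g l * blk (trivializer U π) l k
        = (scal A (D.mat π g))ᴴ * ((fourierCoeff D (U π) (l * g⁻¹))ᴴ *
          fourierCoeff D (U π) (l * g⁻¹ * (g * k⁻¹))) * scal A (D.mat π k) := fun l => by
      rw [blk_conjTranspose, blk_trivializer, blk_trivializer, Matrix.conjTranspose_mul,
        show l * g⁻¹ * (g * k⁻¹) = l * k⁻¹ by group]
      simp only [Matrix.mul_assoc]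
    simp only [h1, ← Matrix.sum_mul, ← Matrix.mul_sum]
    have h2 : ∑ l, (fourierCoeff D (U π) (l * g⁻¹))ᴴ *
        fourierCoeff D (U π) (l * g⁻¹ * (g * k⁻¹)) = if g * k⁻¹ = 1 then 1 else 0 := by
      rw [← h.sum_conjTranspose_mul_coeff]
      exact Fintype.sum_equiv (Equiv.mulRight g⁻¹) _ _ fun l => rfl
    rw [h2]
    by_cases hgk : g = k
    · subst hgk
      simp [hs]
    · have : g * k⁻¹ ≠ 1 := fun h' => hgk (mul_inv_eq_one.1 h')
      simp [hgk, this]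
  · refine blk_ext fun g k => ?_
    rw [Matrix.star_eq_conjTranspose, blk_mul, blk_one]
    have h1 : ∀ l, blk (trivializer U π) g l * blk (trivializer U π)ᴴ l k
        = fourierCoeff D (U π) (g * k⁻¹ * (k * l⁻¹)) *
          (fourierCoeff D (U π) (k * l⁻¹))ᴴ := fun l => by
      rw [blk_conjTranspose, blk_trivializer, blk_trivializer, Matrix.conjTranspose_mul,
        Matrix.mul_assoc, ← Matrix.mul_assoc (scal A _), hs', Matrix.one_mul,
        show g * k⁻¹ * (k * l⁻¹) = g * l⁻¹ by group]
    simp only [h1]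
    have h2 : ∑ l, fourierCoeff D (U π) (g * k⁻¹ * (k * l⁻¹)) *
        (fourierCoeff D (U π) (k * l⁻¹))ᴴ = if g * k⁻¹ = 1 then 1 else 0 := by
      rw [← h.sum_coeff_mul_conjTranspose]
      exact Fintype.sum_equiv ((Equiv.inv G).trans (Equiv.mulLeft k)) _ _ fun l => rfl
    rw [h2]
    by_cases hgk : g = k
    · subst hgk
      simp
    · have : g * k⁻¹ ≠ 1 := fun h' => hgk (mul_inv_eq_one.1 h')
      simp [hgk, this]

lemma trivializer_triv : trivializer U D.triv = (1 : Matrix _ _ (Matrix G G A)) := by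
  refine blk_ext fun g k => ?_
  rw [blk_trivializer, blk_one, h.coeff_triv]
  have h1 : D.mat D.triv k = 1 := by rw [UnitaryDual.mat, D.rep_triv]; rfl
  rw [h1, scal_one, Matrix.mul_one]
  simp only [mul_inv_eq_one]

/-- In the `(g, k)` block the summation index `l` corresponds to `b = g l⁻¹`. Writing `ρ(l) = ρ(l
k⁻¹) ρ(k)` leaves the coefficient form of the cocycle identity at `d = g k⁻¹`, multiplied by `π(k) ⊗
ρ(k)`. -/
lemma ampMap_trivializer_mul (π ρ : D.Idx) :
    ampMap (liftHom G (α π)) (trivializer U ρ) * rightAmp (D.V ρ) (trivializer U π)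
      = ampEntry G (U π ρ) * coproduct B (trivializer U) π ρ := by
  refine blk_ext fun g k => ?_
  rw [blk_ampEntry_mul, blk_coproduct, blk_mul]
  simp only [blk_ampMap_liftHom, blk_trivializer, rightAmp_eq_tk, blk_tk, ampMap_mul, ampMap_scal]
  rw [coproduct_mul_scal, ← Matrix.mul_assoc, ← h.sum_ampMap_coeff_mul, Matrix.sum_mul]
  refine Fintype.sum_equiv ((Equiv.inv G).trans (Equiv.mulLeft g)) _ _ fun l => ?_
  simp only [Equiv.trans_apply, Equiv.inv_apply, Equiv.coe_mulLeft, Matrix.mul_assoc, tk_mul,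
    Matrix.one_mul, Matrix.mul_one, ← D.mat_mul]
  rw [show (g * l⁻¹)⁻¹ * (g * k⁻¹) = l * k⁻¹ by group, show l * k⁻¹ * k = l by group]

lemma liftHom_intertwine (π ρ σ : D.Idx) (e : Fin (B.mult π ρ σ)) (X : Matrix G G A) :
    ampMap (liftHom G (α π)) (liftHom G (α ρ) X) * ampEntry G (U π ρ) *
        scal (Matrix G G A) (B.T π ρ σ e)
      = ampEntry G (U π ρ) * scal (Matrix G G A) (B.T π ρ σ e) * liftHom G (α σ) X := by
  refine blk_ext fun g k => ?_
  rw [blk_mul_scal, blk_mul_ampEntry, blk_ampMap_liftHom, blk_liftHom,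
    Matrix.mul_assoc (ampEntry G (U π ρ)), blk_ampEntry_mul, blk_scal_mul, blk_liftHom, ← Matrix.mul_assoc]
  refine h.intertwine π ρ σ _ ?_ _
  rw [← B.span_eq]
  exact Submodule.subset_span ⟨e, rfl⟩

lemma liftHom_triv (X : Matrix G G A) : liftHom G (α D.triv) X = amp (D.V D.triv) X := by
  ext i j g k
  rw [liftHom_apply, h.map_triv]
  simp only [amp, Matrix.diagonal_apply]
  split_ifs <;> rfl

lemma ampEntry_mem_unitary (π ρ : D.Idx) : ampEntry G (U π ρ) ∈ unitary
    (Matrix (D.V π × D.V ρ) (D.V π × D.V ρ) (Matrix G G A)) := by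
  have h1 := Unitary.mem_iff.1 (h.unitary_mem π ρ)
  rw [Matrix.star_eq_conjTranspose] at h1
  rw [Unitary.mem_iff, Matrix.star_eq_conjTranspose]
  constructor
  · refine blk_ext fun g k => ?_
    rw [blk_mul_ampEntry, blk_conjTranspose, blk_ampEntry, blk_one]
    by_cases hgk : g = k
    · simp [hgk, h1.1]
    · simp [hgk, Ne.symm hgk]
  · refine blk_ext fun g k => ?_
    rw [blk_ampEntry_mul, blk_conjTranspose, blk_ampEntry, blk_one]
    by_cases hgk : g = k
    · simp [hgk, h1.2]
    · simp [hgk, Ne.symm hgk]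

end IsCocycleTwistedAction

end Trivialize

/-! ### Averaging over a genuine action of the dual -/

section Coproduct

variable {G : Type*} [Group G] {D : UnitaryDual G} {B : D.IntertwinerBases}
variable {A : Type*} [Ring A] [StarRing A] [Algebra ℂ A] [StarModule ℂ A]

-- The coproduct is multiplicative because the isometries `T` have mutually orthogonal ranges.
omit [StarRing A] [StarModule ℂ A] in
lemma coproduct_mul (Y Z : ∀ σ : D.Idx, Matrix (D.V σ) (D.V σ) A) (π ρ : D.Idx) :
    coproduct B Y π ρ * coproduct B Z π ρ = coproduct B (fun σ => Y σ * Z σ) π ρ := by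
  simp only [coproduct, Matrix.sum_mul]
  refine Finset.sum_congr rfl fun σ _ => Finset.sum_congr rfl fun e _ => ?_
  rw [Matrix.mul_sum, Finset.sum_eq_single σ, Matrix.mul_sum, Finset.sum_eq_single e]
  · calc _ = scal A (B.T π ρ σ e) * Y σ * (scal A (B.T π ρ σ e)ᴴ * scal A (B.T π ρ σ e)) * Z σ *
        scal A (B.T π ρ σ e)ᴴ := by simp only [Matrix.mul_assoc]
      _ = _ := by
        rw [← scal_mul, B.orthonormal, if_pos rfl, scal_one, Matrix.mul_one]
        simp only [Matrix.mul_assoc]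
  · intro f _ hf
    calc _ = scal A (B.T π ρ σ e) * Y σ * (scal A (B.T π ρ σ e)ᴴ * scal A (B.T π ρ σ f)) * Z σ *
        scal A (B.T π ρ σ f)ᴴ := by simp only [Matrix.mul_assoc]
      _ = 0 := by
        rw [← scal_mul, B.orthonormal, if_neg (Ne.symm hf)]
        have : scal A (0 : Matrix (D.V σ) (D.V σ) ℂ) = 0 := by ext i j; simp
        rw [this, Matrix.mul_zero, Matrix.zero_mul, Matrix.zero_mul]
  · simp
  · intro σ' _ hσ'
    rw [Matrix.mul_sum]
    refine Finset.sum_eq_zero fun f _ => ?_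
    calc _ = scal A (B.T π ρ σ e) * Y σ * (scal A (B.T π ρ σ e)ᴴ * scal A (B.T π ρ σ' f)) * Z σ' *
        scal A (B.T π ρ σ' f)ᴴ := by simp only [Matrix.mul_assoc]
      _ = 0 := by
        rw [← scal_mul, B.conjTranspose_T_mul_T_of_ne (Ne.symm hσ')]
        have : scal A (0 : Matrix (D.V σ) (D.V σ') ℂ) = 0 := by ext i j; simp
        rw [this, Matrix.mul_zero, Matrix.zero_mul, Matrix.zero_mul]
  · simp

lemma conjTranspose_coproduct (Y : ∀ σ : D.Idx, Matrix (D.V σ) (D.V σ) A) (π ρ : D.Idx) :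
    (coproduct B Y π ρ)ᴴ = coproduct B (fun σ => (Y σ)ᴴ) π ρ := by
  simp only [coproduct, Matrix.conjTranspose_sum, Matrix.conjTranspose_mul, conjTranspose_scal,
    Matrix.conjTranspose_conjTranspose, Matrix.mul_assoc]

omit [StarRing A] [StarModule ℂ A] in
lemma coproduct_amp (x : A) (π ρ : D.Idx) :
    coproduct B (fun σ => amp (D.V σ) x) π ρ = amp (D.V π × D.V ρ) x := by
  simp only [coproduct, scal_mul_amp, Matrix.mul_assoc, ← Matrix.mul_sum, sum_scal_T_mul,
    Matrix.mul_one]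

omit [StarRing A] [StarModule ℂ A] in
lemma coproduct_mul_amp (Y : ∀ σ : D.Idx, Matrix (D.V σ) (D.V σ) A) (x : A) (π ρ : D.Idx) :
    coproduct B (fun σ => Y σ * amp (D.V σ) x) π ρ = coproduct B Y π ρ * amp _ x := by
  rw [← coproduct_amp (B := B), coproduct_mul]

omit [StarRing A] [StarModule ℂ A] in
lemma coproduct_amp_mul (x : A) (Y : ∀ σ : D.Idx, Matrix (D.V σ) (D.V σ) A) (π ρ : D.Idx) :
    coproduct B (fun σ => amp (D.V σ) x * Y σ) π ρ = amp _ x * coproduct B Y π ρ := by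
  rw [← coproduct_amp (B := B), coproduct_mul]

variable [Fintype G]

omit [StarRing A] [StarModule ℂ A] in
lemma exists_fourier (Y : ∀ σ : D.Idx, Matrix (D.V σ) (D.V σ) A) :
    ∃ y : G → A, ∀ σ, Y σ = ∑ b, amp (D.V σ) (y b) * scal A (D.mat σ b) := by
  let Y' : ∀ σ : D.Idx, Matrix (Unit × D.V σ) (Unit × D.V σ) A :=
    fun σ => Matrix.of fun i j => Y σ i.2 j.2
  refine ⟨fun b => fourierCoeff D Y' b () (), fun σ => ?_⟩
  ext i j
  have := congrFun (congrFun (sum_tk_fourierCoeff D Y' σ) ((), i)) ((), j)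
  rw [show Y σ i j = Y' σ ((), i) ((), j) from rfl, ← this, Matrix.sum_apply, Matrix.sum_apply]
  refine Finset.sum_congr rfl fun b _ => ?_
  rw [tk_apply, amp_mul_apply, scal_apply, ← Algebra.commutes, Algebra.smul_def]

/-- The Haar weights. -/
def haarSum (Y : ∀ σ : D.Idx, Matrix (D.V σ) (D.V σ) A) : A :=
  ∑ π, ((D.dim π : ℂ) / Fintype.card G) • ∑ i, Y π i i

/-- The normalized character of the regular representation; it makes `haarSum` pick out the Fourier
coefficient at the unit. -/
lemma sum_dim_mul_trace [DecidableEq G] (D : UnitaryDual G) (b : G) :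
    ∑ π, (D.dim π : ℂ) / Fintype.card G * ∑ i, D.mat π b i i = if b = 1 then 1 else 0 := by
  have h1 := D.sum_dim_mul_star_mat_mul_mat 1 b
  simp only [eq_comm (a := (1 : G))] at h1
  rw [← h1]
  refine Finset.sum_congr rfl fun π _ => ?_
  congr 1
  refine Finset.sum_congr rfl fun i _ => ?_
  rw [Finset.sum_eq_single i]
  · simp
  · intro j _ hj
    simp [Ne.symm hj]
  · simp

omit [StarRing A] [StarModule ℂ A] in
lemma haarSum_fourier [DecidableEq G] (y : G → A) :
    haarSum (fun σ => ∑ b, amp (D.V σ) (y b) * scal A (D.mat σ b)) = y 1 := by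
  have h1 : haarSum (fun σ : D.Idx => ∑ b, amp (D.V σ) (y b) * scal A (D.mat σ b))
      = ∑ b, (∑ π, (D.dim π : ℂ) / Fintype.card G * ∑ i, D.mat π b i i) • y b := by
    simp only [haarSum, Matrix.sum_apply, amp_mul_apply, scal_apply, ← Algebra.commutes,
      ← Algebra.smul_def, Finset.sum_smul, Finset.smul_sum, smul_smul, Finset.mul_sum]
    rw [Finset.sum_comm (s := (Finset.univ : Finset G))]
    refine Finset.sum_congr rfl fun π _ => ?_
    rw [Finset.sum_comm]
  rw [h1]
  simp [sum_dim_mul_trace]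

omit [StarRing A] [StarModule ℂ A] in
/-- Invariance of the Haar weights. -/
lemma haarSum_coproduct (Y : ∀ σ : D.Idx, Matrix (D.V σ) (D.V σ) A) (ρ : D.Idx) (k l : D.V ρ) :
    ∑ π, ((D.dim π : ℂ) / Fintype.card G) • ∑ i, coproduct B Y ρ π (k, i) (l, i)
      = amp (D.V ρ) (haarSum Y) k l := by
  classical
  obtain ⟨y, hy⟩ := exists_fourier Y
  obtain rfl : Y = fun σ => ∑ b, amp (D.V σ) (y b) * scal A (D.mat σ b) := funext hy
  -- On group elements the coproduct is `σ(b) ↦ ρ(b) ⊗ π(b)`. The weighted trace over `π` keeps only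
  -- `b = 1`, where `ρ(b)` is the identity.
  have h1 : ∀ π, coproduct B (fun σ => ∑ b, amp (D.V σ) (y b) * scal A (D.mat σ b)) ρ π
      = ∑ b, amp (D.V ρ × D.V π) (y b) * scal A (D.mat ρ b ⊗ₖ D.mat π b) := fun π => by
    have h2 : coproduct B (fun σ => ∑ b, amp (D.V σ) (y b) * scal A (D.mat σ b)) ρ π
        = ∑ b, coproduct B (fun σ => amp (D.V σ) (y b) * scal A (D.mat σ b)) ρ π := by
      simp only [coproduct, Matrix.mul_sum, Matrix.sum_mul,
        Finset.sum_comm (t := (Finset.univ : Finset G))]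
    rw [h2]
    refine Finset.sum_congr rfl fun b _ => ?_
    rw [coproduct_amp_mul]
    congr 1
    simp only [coproduct, ← scal_mul, ← scal_sum, B.sum_T_mul_mat_mul]
  have h3 : ∑ π, ((D.dim π : ℂ) / Fintype.card G) • ∑ i,
        (∑ b, amp (D.V ρ × D.V π) (y b) * scal A (D.mat ρ b ⊗ₖ D.mat π b)) (k, i) (l, i)
      = ∑ b, (D.mat ρ b k l * ∑ π, (D.dim π : ℂ) / Fintype.card G * ∑ i, D.mat π b i i) • y b := by
    simp only [Matrix.sum_apply, amp_mul_apply, scal_apply, ← Algebra.commutes, ← Algebra.smul_def,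
      Finset.sum_smul, Finset.smul_sum, smul_smul, Finset.mul_sum, Matrix.kronecker_apply]
    rw [Finset.sum_comm (s := (Finset.univ : Finset G))]
    refine Finset.sum_congr rfl fun π _ => ?_
    rw [Finset.sum_comm]
    refine Finset.sum_congr rfl fun b _ => Finset.sum_congr rfl fun i _ => ?_
    congr 1
    ring
  simp only [h1]
  rw [h3, haarSum_fourier]
  simp only [sum_dim_mul_trace]
  simp [amp, Matrix.diagonal_apply, Matrix.one_apply]

end Coproduct

/-! ### Fixed points of an action of the dual and the average over it. -/

section DualAction

variable {G : Type*} [Group G] [Fintype G] {D : UnitaryDual G} {B : D.IntertwinerBases}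
variable {A : Type*} [Ring A] [StarRing A] [Algebra ℂ A] [StarModule ℂ A]
variable (γ : ∀ π : D.Idx, A →⋆ₐ[ℂ] Matrix (D.V π) (D.V π) A)

/-- The fixed point algebra. -/
def fixedAlgebra : StarSubalgebra ℂ A where
  carrier := {x | ∀ π, γ π x = amp (D.V π) x}
  mul_mem' {x y} hx hy π := by rw [map_mul, hx, hy, amp_mul_amp]
  one_mem' π := by rw [map_one, amp_one]
  add_mem' {x y} hx hy π := by
    rw [map_add, hx, hy]; simp [amp, Matrix.diagonal_add]
  zero_mem' π := by rw [map_zero]; simp [amp]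
  algebraMap_mem' c π := by rw [AlgHomClass.commutes]; rfl
  star_mem' {x} hx π := by rw [map_star, hx, Matrix.star_eq_conjTranspose, conjTranspose_amp]

/-- The conditional expectation onto the fixed points. -/
def average : A →ₗ[ℂ] A where
  toFun x := haarSum fun π => γ π x
  map_add' x y := by simp [haarSum, Finset.sum_add_distrib]
  map_smul' c x := by
    simp only [haarSum, map_smul, Matrix.smul_apply, ← Finset.smul_sum, RingHom.id_apply]
    rw [Finset.smul_sum]
    exact Finset.sum_congr rfl fun π _ => smul_comm _ _ _

lemma average_apply (x : A) :
    average γ x = ∑ π, ((D.dim π : ℂ) / Fintype.card G) • ∑ i, γ π x i i := rfl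

variable {γ}

/-- Applying `γ ρ` to the average produces the coproduct in the remaining leg, and invariance of the
Haar weights applies. -/
lemma average_mem
    (hγ : ∀ π ρ x, ampMap (γ π) (γ ρ x) = coproduct B (fun σ => γ σ x) π ρ) (x : A) :
    average γ x ∈ fixedAlgebra γ := by
  intro ρ
  ext k l
  show _ = amp (D.V ρ) (haarSum fun π => γ π x) k l
  rw [← haarSum_coproduct (B := B), average_apply, map_sum, Matrix.sum_apply]
  refine Finset.sum_congr rfl fun π _ => ?_
  rw [map_smul, Matrix.smul_apply, map_sum, Matrix.sum_apply]
  congr 1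
  refine Finset.sum_congr rfl fun i _ => ?_
  rw [← hγ]; rfl

lemma average_one : average γ 1 = 1 := by
  classical
  have h1 := haarSum_fourier (D := D) (A := A) (fun b : G => if b = 1 then 1 else 0)
  rw [if_pos rfl] at h1
  refine Eq.trans ?_ h1
  show haarSum _ = _
  congr 1
  ext1 σ
  rw [map_one, Finset.sum_eq_single 1]
  · simp
  · intro b _ hb
    simp [hb, amp]
  · simp

lemma average_conj {r : A} (hr : r ∈ fixedAlgebra γ) (x : A) :
    average γ (r * x * r) = r * average γ x * r := by
  have h1 : ∀ π i, γ π (r * x * r) i i = r * γ π x i i * r := fun π i => by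
    rw [map_mul, map_mul, hr, mul_amp_apply, amp_mul_apply]
  simp only [average_apply, h1, Finset.mul_sum, Finset.sum_mul, mul_smul_comm, smul_mul_assoc]

end DualAction

/-! ### Perturbing a trivialized cocycle -/

section Perturb

variable {G : Type*} [Group G] {D : UnitaryDual G} {B : D.IntertwinerBases}
variable {A : Type*} [Ring A] [StarRing A] [Algebra ℂ A] [StarModule ℂ A]

/-- Conjugation of a homomorphism by a unitary. -/
def conjHom {p : Type*} [Fintype p] [DecidableEq p] (φ : A →⋆ₐ[ℂ] Matrix p p A) {V : Matrix p p A}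
    (hV : V ∈ unitary (Matrix p p A)) : A →⋆ₐ[ℂ] Matrix p p A where
  toFun x := star V * φ x * V
  map_one' := by rw [map_one, mul_one, (Unitary.mem_iff.1 hV).1]
  map_mul' x y := by
    calc star V * φ (x * y) * V = star V * φ x * 1 * φ y * V := by
          rw [map_mul, mul_one]; simp only [mul_assoc]
      _ = _ := by rw [← (Unitary.mem_iff.1 hV).2]; simp only [mul_assoc]
  map_zero' := by simp
  map_add' x y := by rw [map_add, mul_add, add_mul]
  commutes' c := by
    rw [AlgHomClass.commutes, ← Algebra.commutes, mul_assoc, (Unitary.mem_iff.1 hV).1, mul_one]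
  map_star' x := by simp [mul_assoc, map_star]

lemma rightAmp_mul_apply {l m n q : Type*} [Fintype n] [Fintype q] [DecidableEq q]
    (X : Matrix m n A) (Z : Matrix (n × q) l A) (i : m) (r : q) (j : l) :
    (rightAmp q X * Z) (i, r) j = ∑ a, X i a * Z (a, r) j := by
  simp only [Matrix.mul_apply, Fintype.sum_prod_type, rightAmp_eq_tk, tk_apply, Matrix.one_apply]
  simp

lemma mul_rightAmp_apply {l m n q : Type*} [Fintype n] [Fintype q] [DecidableEq q]
    (Z : Matrix l (n × q) A) (X : Matrix n m A) (i : l) (j : m) (s : q) :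
    (Z * rightAmp q X) i (j, s) = ∑ a, Z i (a, s) * X a j := by
  simp only [Matrix.mul_apply, Fintype.sum_prod_type, rightAmp_eq_tk, tk_apply, Matrix.one_apply]
  simp

lemma ampMap_conjHom {m n p : Type*} [Fintype p] [DecidableEq p] [Fintype m] [Fintype n]
    [DecidableEq m] [DecidableEq n] (φ : A →⋆ₐ[ℂ] Matrix p p A)
    {V : Matrix p p A} (hV : V ∈ unitary (Matrix p p A)) (X : Matrix m n A) :
    ampMap (conjHom φ hV) X = rightAmp m (star V) * ampMap φ X * rightAmp n V := by
  ext ⟨i, r⟩ ⟨j, s⟩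
  rw [mul_rightAmp_apply]
  simp only [rightAmp_mul_apply, ampMap_apply]
  show (star V * φ (X r s) * V) i j = _
  simp only [Matrix.mul_apply]

/-- A cocycle twisted action whose cocycle is the coboundary of `Ω`. -/
structure IsTrivialized (B : D.IntertwinerBases)
    (α : ∀ π : D.Idx, A →⋆ₐ[ℂ] Matrix (D.V π) (D.V π) A)
    (U : ∀ π ρ : D.Idx, Matrix (D.V π × D.V ρ) (D.V π × D.V ρ) A)
    (Ω : ∀ π : D.Idx, Matrix (D.V π) (D.V π) A) : Prop where
  cocycle_mem : ∀ π ρ, U π ρ ∈ unitary (Matrix (D.V π × D.V ρ) (D.V π × D.V ρ) A)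
  mem : ∀ π, Ω π ∈ unitary (Matrix (D.V π) (D.V π) A)
  intertwine : ∀ π ρ σ (e : Fin (B.mult π ρ σ)) x,
    ampMap (α π) (α ρ x) * U π ρ * scal A (B.T π ρ σ e) = U π ρ * scal A (B.T π ρ σ e) * α σ x
  trivialize : ∀ π ρ, ampMap (α π) (Ω ρ) * rightAmp (D.V ρ) (Ω π) = U π ρ * coproduct B Ω π ρ

namespace IsTrivialized

variable {α : ∀ π : D.Idx, A →⋆ₐ[ℂ] Matrix (D.V π) (D.V π) A}
  {U : ∀ π ρ : D.Idx, Matrix (D.V π × D.V ρ) (D.V π × D.V ρ) A}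
  {Ω : ∀ π : D.Idx, Matrix (D.V π) (D.V π) A} (h : IsTrivialized B α U Ω)
include h

/-- The intertwining relations for the individual `T` are summed using the resolution of the
identity `∑ T T* = 1`. -/
lemma ampMap_mul_cocycle (π ρ : D.Idx) (x : A) :
    ampMap (α π) (α ρ x) * U π ρ = U π ρ * coproduct B (fun σ => α σ x) π ρ := by
  have h1 : ampMap (α π) (α ρ x) * U π ρ
      = ∑ σ, ∑ e, ampMap (α π) (α ρ x) * U π ρ * scal A (B.T π ρ σ e) * scal A (B.T π ρ σ e)ᴴ := by
    simp only [Matrix.mul_assoc _ (scal A _) (scal A _), ← Matrix.mul_sum, sum_scal_T_mul,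
      Matrix.mul_one]
  rw [h1]
  simp only [h.intertwine, coproduct, Matrix.mul_sum, Matrix.mul_assoc]

/-- The perturbed action. -/
def action (π : D.Idx) : A →⋆ₐ[ℂ] Matrix (D.V π) (D.V π) A := conjHom (α π) (h.mem π)

lemma action_apply (π : D.Idx) (x : A) : h.action π x = star (Ω π) * α π x * Ω π := rfl

theorem ampMap_action (π ρ : D.Idx) (x : A) :
    ampMap (h.action π) (h.action ρ x) = coproduct B (fun σ => h.action σ x) π ρ := by
  have hU := (Unitary.mem_iff.1 (h.cocycle_mem π ρ)).1
  rw [Matrix.star_eq_conjTranspose] at hU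
  -- Since `Z = U Δ(Ω)`, conjugation by `Z` first undoes the cocycle, turning `α_π α_ρ` into `Δ(α)`,
  -- and then becomes the coproduct of conjugation by `Ω`.
  set Z := ampMap (α π) (Ω ρ) * rightAmp (D.V ρ) (Ω π) with hZ
  have h1 : ampMap (h.action π) (h.action ρ x) = Zᴴ * ampMap (α π) (α ρ x) * Z := by
    rw [action, ampMap_conjHom, action_apply, ampMap_mul, ampMap_mul, hZ, Matrix.conjTranspose_mul,
      Matrix.star_eq_conjTranspose, Matrix.star_eq_conjTranspose, ← ampMap_conjTranspose,
      conjTranspose_rightAmp]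
    simp only [Matrix.mul_assoc]
  rw [h1, hZ, h.trivialize, Matrix.conjTranspose_mul, ← Matrix.mul_assoc,
    Matrix.mul_assoc _ _ (U π ρ), Matrix.mul_assoc (_)ᴴ (U π ρ)ᴴ, h.ampMap_mul_cocycle,
    ← Matrix.mul_assoc (U π ρ)ᴴ, hU, Matrix.one_mul, conjTranspose_coproduct, coproduct_mul,
    coproduct_mul]
  rfl

/-- The corner of the trivializing unitaries cut down by a partial isometry. -/
def corner (_ : IsTrivialized B α U Ω) (w : A) (π : D.Idx) : Matrix (D.V π) (D.V π) A :=
  α π (star w) * Ω π * amp (D.V π) w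

variable {w p : A}

/-- Invariance of the range projection under the perturbed action, rewritten so that the projection
passes through `Ω`. This lets it be absorbed into `w` in the computations with the corner. -/
lemma map_mul_unitary (hq : w * star w ∈ fixedAlgebra h.action) (π : D.Idx) :
    α π (w * star w) * Ω π = Ω π * amp (D.V π) (w * star w) := by
  rw [← hq π, action_apply, ← mul_assoc, ← mul_assoc, (Unitary.mem_iff.1 (h.mem π)).2, one_mul]

variable (hwp : star w * w = p) (hw : w * p = w) (hp : ∀ π, α π p = amp (D.V π) p)
  (hq : w * star w ∈ fixedAlgebra h.action)
include hwp hw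

omit h in
lemma conj_range_proj : star w * (w * star w) * w = p := by
  rw [← mul_assoc, hwp, mul_assoc, hwp]
  nth_rewrite 1 [← hwp]
  rw [mul_assoc, hw, hwp]

include hq

lemma star_corner_mul_corner (π : D.Idx) :
    star (h.corner w π) * h.corner w π = amp (D.V π) p := by
  have hA : star (amp (D.V π) w) = amp (D.V π) (star w) := conjTranspose_amp w
  calc star (h.corner w π) * h.corner w π
      = amp (D.V π) (star w) * star (Ω π) * (α π (w * star w) * Ω π) * amp (D.V π) w := by
        rw [corner, star_mul, star_mul, ← map_star, star_star, hA, map_mul]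
        simp only [mul_assoc]
    _ = amp (D.V π) (star w) * (star (Ω π) * Ω π) * amp (D.V π) (w * star w) * amp (D.V π) w := by
        rw [h.map_mul_unitary hq]; simp only [mul_assoc]
    _ = amp (D.V π) p := by
        rw [(Unitary.mem_iff.1 (h.mem π)).1, mul_one, amp_mul_amp, amp_mul_amp,
          conj_range_proj hwp hw]

include hp in
lemma corner_mul_star_corner (π : D.Idx) :
    h.corner w π * star (h.corner w π) = amp (D.V π) p := by
  have hA : star (amp (D.V π) w) = amp (D.V π) (star w) := conjTranspose_amp w
  calc h.corner w π * star (h.corner w π)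
      = α π (star w) * (Ω π * (amp (D.V π) w * amp (D.V π) (star w))) * star (Ω π) * α π w := by
        rw [corner, star_mul, star_mul, ← map_star, star_star, hA]
        simp only [mul_assoc]
    _ = α π (star w) * α π (w * star w) * (Ω π * star (Ω π)) * α π w := by
        rw [amp_mul_amp, ← h.map_mul_unitary hq]; simp only [mul_assoc]
    _ = amp (D.V π) p := by
        rw [(Unitary.mem_iff.1 (h.mem π)).2, mul_one, ← map_mul, ← map_mul,
          conj_range_proj hwp hw, hp]

/-- In the product the inner factors combine to `α_π(w w*) Ω_π w = Ω_π w`, so the equation for `Ω`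
can be used; the cocycle relation then moves `α_π α_ρ(w*)` across `U`. -/
theorem ampMap_corner_mul (π ρ : D.Idx) :
    ampMap (α π) (h.corner w ρ) * rightAmp (D.V ρ) (h.corner w π)
      = U π ρ * coproduct B (h.corner w) π ρ := by
  have hqw : w * star w * w = w := by rw [mul_assoc, hwp, hw]
  calc ampMap (α π) (h.corner w ρ) * rightAmp (D.V ρ) (h.corner w π)
      = ampMap (α π) (α ρ (star w)) * ampMap (α π) (Ω ρ) *
          rightAmp (D.V ρ) (α π (w * star w) * Ω π) * amp _ w := by
        rw [corner, corner, ampMap_mul, ampMap_mul, ampMap_amp, rightAmp_mul, rightAmp_mul,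
          rightAmp_mul, map_mul, rightAmp_mul, rightAmp_amp]
        simp only [Matrix.mul_assoc]
    _ = ampMap (α π) (α ρ (star w)) * (ampMap (α π) (Ω ρ) * rightAmp (D.V ρ) (Ω π)) *
          (amp _ (w * star w) * amp _ w) := by
        rw [h.map_mul_unitary hq, rightAmp_mul, rightAmp_amp]
        simp only [Matrix.mul_assoc]
    _ = ampMap (α π) (α ρ (star w)) * U π ρ * coproduct B Ω π ρ * amp _ w := by
        rw [h.trivialize, amp_mul_amp, hqw]; simp only [Matrix.mul_assoc]
    _ = U π ρ * coproduct B (h.corner w) π ρ := by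
        rw [h.ampMap_mul_cocycle, Matrix.mul_assoc (U π ρ), coproduct_mul, Matrix.mul_assoc (U π ρ),
          ← coproduct_mul_amp]
        rfl

end IsTrivialized

end Perturb

/-! ### Trace preservation and the expectation onto the fixed points -/

section TracePreserving

variable {A : Type*} [Ring A] [StarRing A] [Algebra ℂ A] [StarModule ℂ A] {τ : A →ₗ[ℂ] ℂ}

lemma l2_amp (τ : A →ₗ[ℂ] ℂ) (n : Type*) [Fintype n] [DecidableEq n] [Nonempty n] (x : A) :
    l2 (matTrace τ n) (amp n x) = l2 τ x := by
  have hc : (Fintype.card n : ℂ) ≠ 0 := by exact_mod_cast Fintype.card_ne_zero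
  have h1 : star (amp n x) = amp n (star x) := conjTranspose_amp x
  rw [l2, l2, h1, amp_mul_amp, matTrace_apply]
  simp [amp, hc]

lemma l2_of_trace_eq {p : Type*} [Fintype p] [DecidableEq p] {φ : A →⋆ₐ[ℂ] Matrix p p A}
    (hφ : ∀ x, matTrace τ p (φ x) = τ x) (x : A) : l2 (matTrace τ p) (φ x) = l2 τ x := by
  rw [l2, l2, ← map_star, ← map_mul, hφ]

lemma l2_matTrace_le (h : IsTracialState τ) {p : Type*} [Fintype p] [DecidableEq p] [Nonempty p]
    {X : Matrix p p A} {C : ℝ} (hX : ∀ i j, l2 τ (X i j) ≤ C) :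
    l2 (matTrace τ p) X ≤ Fintype.card p * C := by
  have hc : (1 : ℝ) ≤ Fintype.card p := by exact_mod_cast Fintype.card_pos
  have hC : 0 ≤ C := by
    obtain ⟨i⟩ := ‹Nonempty p›
    exact (h.l2_nonneg _).trans (hX i i)
  refine le_of_sq_le_sq ?_ (by positivity)
  rw [l2_matTrace_sq h]
  have h1 : ∑ i, ∑ j, l2 τ (X i j) ^ 2 ≤ ∑ _i : p, ∑ _j : p, C ^ 2 :=
    Finset.sum_le_sum fun i _ => Finset.sum_le_sum fun j _ =>
      pow_le_pow_left₀ (h.l2_nonneg _) (hX i j) 2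
  simp only [Finset.sum_const, Finset.card_univ, nsmul_eq_mul] at h1
  calc _ ≤ (Fintype.card p : ℝ)⁻¹ * (Fintype.card p * (Fintype.card p * C ^ 2)) := by gcongr
    _ = Fintype.card p * C ^ 2 := by field_simp
    _ ≤ _ := by nlinarith [sq_nonneg C, mul_nonneg (sub_nonneg.2 hc) (sq_nonneg C)]

lemma trace_liftHom {G : Type*} [Group G] [Fintype G] [DecidableEq G] {p : Type*} [Fintype p]
    [DecidableEq p] {φ : A →⋆ₐ[ℂ] Matrix p p A} (hφ : ∀ x, matTrace τ p (φ x) = τ x)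
    (X : Matrix G G A) :
    matTrace (matTrace τ G) p (liftHom G φ X) = matTrace τ G X := by
  simp only [matTrace_apply, liftHom_apply]
  rw [← Finset.mul_sum, Finset.sum_comm, mul_left_comm, Finset.mul_sum]
  congr 1
  exact Finset.sum_congr rfl fun g _ => hφ (X g g)

lemma trace_conjHom (h : IsTracialState τ) {p : Type*} [Fintype p] [DecidableEq p] [Nonempty p]
    {φ : A →⋆ₐ[ℂ] Matrix p p A} (hφ : ∀ x, matTrace τ p (φ x) = τ x) {V : Matrix p p A}
    (hV : V ∈ unitary (Matrix p p A)) (x : A) : matTrace τ p (conjHom φ hV x) = τ x := by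
  show matTrace τ p (star V * φ x * V) = τ x
  rw [h.matTrace.tracial, ← mul_assoc, (Unitary.mem_iff.1 hV).2, one_mul, hφ]

end TracePreserving

/-! ### Trace preservation and the index inequality for averages. -/

section FixedPoints

variable {A : Type*} [CStarAlgebra A] [PartialOrder A] [StarOrderedRing A] {τ : A →ₗ[ℂ] ℂ}

lemma mul_source_proj {w p : A} (hp : IsStarProjection p) (hw : star w * w = p) : w * p = w := by
  have h1 : star (w - w * p) * (w - w * p) = 0 := by
    rw [star_sub, star_mul, hp.isSelfAdjoint.star_eq, sub_mul, mul_sub, mul_sub, ← mul_assoc, hw,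
      mul_assoc, hw, hp.isIdempotentElem.eq, mul_assoc, ← mul_assoc (star w), hw,
      hp.isIdempotentElem.eq, hp.isIdempotentElem.eq]
    simp
  exact (sub_eq_zero.1 (CStarRing.star_mul_self_eq_zero_iff _ |>.1 h1)).symm

/-- The matrix trace composed with `φ` is a tracial state, and there is only one. -/
lemma IsTracialWStar.trace_hom (h : IsTracialWStar τ)
    (hprime : ∀ x y : A, (∀ a, x * a * y = 0) → x = 0 ∨ y = 0) {p : Type*} [Fintype p]
    [DecidableEq p] [Nonempty p] (φ : A →⋆ₐ[ℂ] Matrix p p A) (x : A) :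
    matTrace τ p (φ x) = τ x := by
  have hm := h.toIsTracialState.matTrace (n := p)
  have hσ : IsTracialState ((matTrace τ p).comp φ.toAlgHom.toLinearMap) :=
    { map_one := by
        show matTrace τ p (φ 1) = 1
        rw [map_one, hm.map_one]
      nonneg := fun x => by
        show 0 ≤ matTrace τ p (φ (star x * x))
        rw [map_mul, map_star]
        exact hm.nonneg _
      tracial := fun x y => by
        show matTrace τ p (φ (x * y)) = matTrace τ p (φ (y * x))
        rw [map_mul φ, map_mul φ, hm.tracial]
      map_star := fun x => by
        show matTrace τ p (φ (star x)) = star (matTrace τ p (φ x))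
        rw [map_star, hm.map_star] }
  exact congrArg (fun σ : A →ₗ[ℂ] ℂ => σ x) (h.eq_of_isTracialState hprime hσ)

variable {G : Type*} [Group G] [Fintype G] {D : UnitaryDual G} {B : D.IntertwinerBases}
  {γ : ∀ π : D.Idx, A →⋆ₐ[ℂ] Matrix (D.V π) (D.V π) A}

/-- The trivial representation contributes `|G|⁻¹ x` to the average of `x`, and for positive `x` all
other contributions are positive; this is the index inequality. The trace is preserved because the
squares of the dimensions add up to `|G|`. -/
theorem isFiniteIndexExpectation_average (h : IsTracialWStar τ)
    (hγ : ∀ π ρ x, ampMap (γ π) (γ ρ x) = coproduct B (fun σ => γ σ x) π ρ)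
    (htr : ∀ π x, matTrace τ (D.V π) (γ π x) = τ x)
    (htriv : ∀ x, γ D.triv x = amp (D.V D.triv) x) :
    IsFiniteIndexExpectation τ (fixedAlgebra γ) (average γ) (Fintype.card G : ℝ)⁻¹ where
  pos := by
    have : (0 : ℝ) < Fintype.card G := by exact_mod_cast Fintype.card_pos
    positivity
  closed x y hx hxy π := by
    have h0 : l2 (matTrace τ (D.V π)) (γ π y - amp (D.V π) y) = 0 := by
      have h1 : ∀ n, l2 (matTrace τ (D.V π)) (γ π y - amp (D.V π) y)
          ≤ l2 τ (x n - y) + l2 τ (x n - y) := fun n => by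
        refine (h.toIsTracialState.matTrace.l2_sub_le_sub_add_sub _ (γ π (x n)) _).trans ?_
        have e1 : γ π (x n) - amp (D.V π) y = amp (D.V π) (x n - y) := by
          rw [hx n π]; simp [amp, Matrix.diagonal_sub]
        rw [← map_sub, l2_of_trace_eq (htr π), e1, l2_amp, h.l2_sub_comm]
      refine le_antisymm ?_ (h.toIsTracialState.matTrace.l2_nonneg _)
      have h2 := hxy.add hxy
      rw [add_zero] at h2
      exact ge_of_tendsto' h2 h1
    rw [← sub_eq_zero]
    ext i j
    refine h.eq_zero_of_l2 (le_antisymm ?_ (h.l2_nonneg _))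
    simpa [h0] using l2_entry_le h.toIsTracialState (γ π y - amp (D.V π) y) i j
  mem := average_mem hγ
  map_one := average_one
  trace x := by
    have h1 : ∀ π, τ (((D.dim π : ℂ) / Fintype.card G) • ∑ i, γ π x i i)
        = (D.dim π : ℂ) ^ 2 / Fintype.card G * τ x := fun π => by
      have hd : (D.dim π : ℂ) ≠ 0 := by exact_mod_cast (D.dim_pos π).ne'
      rw [← htr π x, matTrace_apply, map_smul, map_sum, Fintype.card_fin, smul_eq_mul]
      field_simp
    have hn : (Fintype.card G : ℂ) ≠ 0 := by exact_mod_cast Fintype.card_ne_zero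
    have h2 : ∑ π, (D.dim π : ℂ) ^ 2 = Fintype.card G := by exact_mod_cast D.sum_dim_sq
    rw [average_apply, map_sum]
    simp only [h1]
    rw [← Finset.sum_mul, ← Finset.sum_div, h2, div_self hn, one_mul]
  conj r hr x := average_conj hr x
  index x hx := by
    obtain ⟨y, rfl⟩ := CStarAlgebra.nonneg_iff_eq_star_mul_self.1 hx
    have hpos : ∀ π i, 0 ≤ γ π (star y * y) i i := fun π i => by
      rw [map_mul, map_star, Matrix.mul_apply]
      exact Finset.sum_nonneg fun j _ => star_mul_self_nonneg _
    have hr : ∀ π, ((D.dim π : ℂ) / Fintype.card G) • ∑ i, γ π (star y * y) i i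
        = ((D.dim π : ℝ) / Fintype.card G) • ∑ i, γ π (star y * y) i i := fun π => by
      rw [← Complex.coe_smul]; push_cast; rfl
    rw [average_apply]
    simp only [hr]
    refine le_trans (le_of_eq ?_) (Finset.single_le_sum
      (f := fun π => ((D.dim π : ℝ) / Fintype.card G) • ∑ i, γ π (star y * y) i i)
      (fun π _ => smul_nonneg (by positivity) (Finset.sum_nonneg fun i _ => hpos π i))
      (Finset.mem_univ D.triv))
    have h1 : ∑ i, γ D.triv (star y * y) i i = star y * y := by
      rw [htriv]
      simp [amp, D.dim_triv]
    simp only [h1, D.dim_triv, Nat.cast_one, one_div]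

variable [DecidableEq G]

/-- An almost invariant projection of the matrices over `A` is close to a partial isometry onto an
invariant one. -/
theorem exists_partialIsometry_of_action (h : IsTracialWStar τ)
    (hprime : ∀ x y : A, (∀ a, x * a * y = 0) → x = 0 ∨ y = 0) (hfd : ¬ FiniteDimensional ℂ A)
    {γ : ∀ π : D.Idx, Matrix G G A →⋆ₐ[ℂ] Matrix (D.V π) (D.V π) (Matrix G G A)}
    (hγ : ∀ π ρ x, ampMap (γ π) (γ ρ x) = coproduct B (fun σ => γ σ x) π ρ)
    (htr : ∀ π x, matTrace (matTrace τ G) (D.V π) (γ π x) = matTrace τ G x)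
    (htriv : ∀ x, γ D.triv x = amp (D.V D.triv) x) {p : Matrix G G A} (hp : IsStarProjection p)
    {ε : ℝ} (hε0 : 0 ≤ ε)
    (hε : 2 * ((matTrace τ G p).re - (matTrace τ G (p * average γ p)).re) ≤ ε ^ 2) :
    ∃ w, star w * w = p ∧ w * p = w ∧ w * star w ∈ fixedAlgebra γ ∧
      l2 (matTrace τ G) (w - p) ≤ 4 * (7 * ε + √(7 * ε)) := by
  have hc := h.cmatTrace (n := G)
  have hE := isFiniteIndexExpectation_average (A := CStarMatrix G G A) (B := B) hc hγ htr htriv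
  have hp' : IsStarProjection (R := CStarMatrix G G A) p := ⟨hp.1, hp.2⟩
  have h1 := le_of_sq_le_sq ((hc.l2_expectation_sub_sq_le hE hp').trans hε) hε0
  obtain ⟨q, hq, w, hw, rfl, hwp⟩ := hc.exists_partialIsometry_of_expectation (cmat_prime hprime)
    (hc.isDiffuse_top (cmat_prime hprime) (not_finiteDimensional_cmat hfd)) hE hp' h1
  exact ⟨w, hw, mul_source_proj hp' hw, hq, hwp⟩

end FixedPoints

/-! ### The corner of the trivializing unitaries -/

section Corner

variable {G : Type*} [Group G] [Fintype G] [DecidableEq G] {D : UnitaryDual G}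
  {B : D.IntertwinerBases}
variable {A : Type*} [Ring A] [StarRing A] [Algebra ℂ A] [StarModule ℂ A]
variable {m n p : Type*}

/-- The minimal projection of `B(ℓ²(G))` at the unit. -/
def unitProj (G A : Type*) [Group G] [DecidableEq G] [Ring A] : Matrix G G A := Matrix.single 1 1 1

lemma isStarProjection_unitProj : IsStarProjection (unitProj G A) := by
  constructor
  · simp [IsIdempotentElem, unitProj]
  · simp [IsSelfAdjoint, unitProj, Matrix.star_eq_conjTranspose]

lemma blk_amp_unitProj_mul [DecidableEq m] [Fintype m] (X : Matrix m n (Matrix G G A)) (g k : G) :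
    blk (amp m (unitProj G A) * X) g k = if g = 1 then blk X 1 k else 0 := by
  ext i j
  show (amp m (unitProj G A) * X) i j g k = _
  rw [amp_mul_apply, unitProj]
  split_ifs with hg
  · subst hg; simp [blk]
  · simp [Matrix.single_mul_apply_of_ne _ _ _ _ _ hg]

lemma blk_mul_amp_unitProj [DecidableEq n] [Fintype n] (X : Matrix m n (Matrix G G A)) (g k : G) :
    blk (X * amp n (unitProj G A)) g k = if k = 1 then blk X g 1 else 0 := by
  ext i j
  show (X * amp n (unitProj G A)) i j g k = _
  rw [mul_amp_apply, unitProj]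
  split_ifs with hg
  · subst hg; simp [blk]
  · simp [Matrix.mul_single_apply_of_ne _ _ _ _ _ hg]

lemma liftHom_unitProj [Fintype p] [DecidableEq p] (φ : A →⋆ₐ[ℂ] Matrix p p A) :
    liftHom G φ (unitProj G A) = amp p (unitProj G A) := by
  ext i j g k
  rw [liftHom_apply, unitProj, amp, Matrix.diagonal_apply, Matrix.single_apply]
  by_cases h1 : 1 = g ∧ 1 = k
  · obtain ⟨rfl, rfl⟩ := h1
    by_cases h2 : i = j <;> simp [h2]
  · by_cases h2 : i = j <;> simp [h1, h2]

lemma blk_mul_of_support [Fintype n] {X : Matrix m n (Matrix G G A)} {Y : Matrix n p (Matrix G G A)}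
    (hX : ∀ k, k ≠ 1 → blk X 1 k = 0) : blk (X * Y) 1 1 = blk X 1 1 * blk Y 1 1 := by
  rw [blk_mul, Finset.sum_eq_single 1]
  · intro k _ hk
    rw [hX k hk, Matrix.zero_mul]
  · simp

variable {α : ∀ π : D.Idx, A →⋆ₐ[ℂ] Matrix (D.V π) (D.V π) A}
  {U : ∀ π ρ : D.Idx, Matrix (D.V π × D.V ρ) (D.V π × D.V ρ) A}

/-- The coproduct of `star W` inverts that of `W`, so the equation can be solved for `U`. -/
lemma eq_coboundary {W : ∀ π : D.Idx, Matrix (D.V π) (D.V π) A}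
    (hW : ∀ π, W π ∈ unitary (Matrix (D.V π) (D.V π) A)) {π ρ : D.Idx}
    (h : ampMap (α π) (W ρ) * rightAmp (D.V ρ) (W π) = U π ρ * coproduct B W π ρ) :
    U π ρ = coboundary D B α W π ρ := by
  have h1 : coboundary D B α W π ρ = ampMap (α π) (W ρ) * rightAmp (D.V ρ) (W π) *
      coproduct B (fun σ => star (W σ)) π ρ := by
    simp only [coboundary, coproduct, Matrix.mul_sum, Matrix.mul_assoc]
  have h2 : (fun σ => W σ * star (W σ)) = fun σ => amp (D.V σ) (1 : A) :=
    funext fun σ => (Unitary.mem_iff.1 (hW σ)).2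
  rw [h1, h, Matrix.mul_assoc, coproduct_mul, h2, coproduct_amp, amp_one, Matrix.mul_one]

namespace IsCocycleTwistedAction

variable (h : IsCocycleTwistedAction D B α U)
include h

lemma isTrivialized : IsTrivialized B (fun π => liftHom G (α π)) (fun π ρ => ampEntry G (U π ρ))
    (trivializer U) where
  cocycle_mem := h.ampEntry_mem_unitary
  mem := h.trivializer_mem_unitary
  intertwine := h.liftHom_intertwine
  trivialize := h.ampMap_trivializer_mul

lemma action_triv (X : Matrix G G A) : h.isTrivialized.action D.triv X = amp (D.V D.triv) X := by
  rw [IsTrivialized.action_apply, h.liftHom_triv, h.trivializer_triv, star_one, one_mul, mul_one]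

variable {w : Matrix G G A}

lemma amp_unitProj_mul_corner (hw : w * unitProj G A = w) (π : D.Idx) :
    amp (D.V π) (unitProj G A) * h.isTrivialized.corner w π = h.isTrivialized.corner w π := by
  have h1 : unitProj G A * star w = star w := by
    conv_rhs => rw [← hw, star_mul, isStarProjection_unitProj.isSelfAdjoint.star_eq]
  rw [IsTrivialized.corner, ← liftHom_unitProj (α π), ← mul_assoc, ← mul_assoc, ← map_mul, h1]

lemma corner_mul_amp_unitProj (hw : w * unitProj G A = w) (π : D.Idx) :
    h.isTrivialized.corner w π * amp (D.V π) (unitProj G A) = h.isTrivialized.corner w π := by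
  rw [IsTrivialized.corner, mul_assoc, amp_mul_amp, hw]

lemma blk_corner_of_ne (hw : w * unitProj G A = w) (π : D.Idx) {k : G} (hk : k ≠ 1) (g : G) :
    blk (h.isTrivialized.corner w π) g k = 0 := by
  rw [← h.corner_mul_amp_unitProj hw, blk_mul_amp_unitProj, if_neg hk]

lemma blk_corner_of_ne' (hw : w * unitProj G A = w) (π : D.Idx) {g : G} (hg : g ≠ 1) (k : G) :
    blk (h.isTrivialized.corner w π) g k = 0 := by
  rw [← h.amp_unitProj_mul_corner hw, blk_amp_unitProj_mul, if_neg hg]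

variable (hwp : star w * w = unitProj G A) (hw : w * unitProj G A = w)
  (hq : w * star w ∈ fixedAlgebra h.isTrivialized.action)
include hwp hw

lemma blk_corner_triv : blk (h.isTrivialized.corner w D.triv) 1 1 = 1 := by
  have h1 : h.isTrivialized.corner w D.triv = amp (D.V D.triv) (unitProj G A) := by
    rw [IsTrivialized.corner, h.liftHom_triv, h.trivializer_triv, mul_one, amp_mul_amp, hwp]
  rw [h1, ← mul_one (amp _ _), blk_amp_unitProj_mul, if_pos rfl, blk_one, if_pos rfl]

include hq

/-- The corner is supported in the single block `(1, 1)`, so unitarity in the corner at `unitProj`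
is unitarity of that block over `A`. -/
lemma blk_corner_mem_unitary (π : D.Idx) :
    blk (h.isTrivialized.corner w π) 1 1 ∈ unitary (Matrix (D.V π) (D.V π) A) := by
  have hone : blk (amp (D.V π) (unitProj G A)) 1 1 = 1 := by
    rw [← mul_one (amp _ _), blk_amp_unitProj_mul, if_pos rfl, blk_one, if_pos rfl]
  rw [Unitary.mem_iff, Matrix.star_eq_conjTranspose, ← blk_conjTranspose,
    ← blk_mul_of_support, ← blk_mul_of_support]
  · constructor
    · rw [← hone, ← h.isTrivialized.star_corner_mul_corner hwp hw hq π]; rfl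
    · rw [← hone, ← h.isTrivialized.corner_mul_star_corner hwp hw
        (fun π => liftHom_unitProj (α π)) hq π]; rfl
  · exact fun k hk => h.blk_corner_of_ne hw π hk 1
  · intro k hk
    rw [blk_conjTranspose, h.blk_corner_of_ne' hw π hk, Matrix.conjTranspose_zero]

lemma ampMap_blk_corner_mul (π ρ : D.Idx) :
    ampMap (α π) (blk (h.isTrivialized.corner w ρ) 1 1) *
        rightAmp (D.V ρ) (blk (h.isTrivialized.corner w π) 1 1)
      = U π ρ * coproduct B (fun σ => blk (h.isTrivialized.corner w σ) 1 1) π ρ := by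
  rw [← blk_coproduct, ← blk_ampEntry_mul, ← h.isTrivialized.ampMap_corner_mul hwp hw hq,
    blk_mul_of_support, blk_ampMap_liftHom, rightAmp_eq_tk, rightAmp_eq_tk, blk_tk]
  intro k hk
  rw [blk_ampMap_liftHom, h.blk_corner_of_ne hw ρ hk]
  ext i j
  simp [ampMap_apply]

end IsCocycleTwistedAction

end Corner

/-! ### Estimates -/

section Estimates

variable {G : Type*} [Group G] [Fintype G] {D : UnitaryDual G} {B : D.IntertwinerBases}

lemma UnitaryDual.dim_le_card (π : D.Idx) : (D.dim π : ℝ) ≤ Fintype.card G := by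
  have h1 : (1 : ℝ) ≤ D.dim π := by exact_mod_cast D.dim_pos π
  rw [← D.sum_dim_sq]
  refine le_trans ?_ (Finset.single_le_sum (f := fun ρ => (D.dim ρ : ℝ) ^ 2)
    (fun _ _ => sq_nonneg _) (Finset.mem_univ π))
  nlinarith

lemma sum_dim_div_mul_dim : ∑ π, (D.dim π : ℝ) / Fintype.card G * D.dim π = 1 := by
  have hn : (Fintype.card G : ℝ) ≠ 0 := by exact_mod_cast Fintype.card_ne_zero
  have : ∀ π, (D.dim π : ℝ) / Fintype.card G * D.dim π
      = (D.dim π : ℝ) ^ 2 / Fintype.card G := fun π => by ring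
  simp only [this]
  rw [← Finset.sum_div, D.sum_dim_sq, div_self hn]

variable {A : Type*} [Ring A] [StarRing A] [Algebra ℂ A] [StarModule ℂ A] {τ : A →ₗ[ℂ] ℂ}
  (h : IsTracialState τ)
include h

/-- The coefficient at the unit is a convex combination of normalized partial traces of the `Y σ`,
with Plancherel weights `(dim σ)² / |G|`, so the bound is not enlarged. -/
lemma l2_fourierCoeff_one_sub_le {m : Type*} [DecidableEq m]
    {Y : ∀ σ : D.Idx, Matrix (m × D.V σ) (m × D.V σ) A} {C : ℝ}
    (hY : ∀ σ a b, l2 τ ((Y σ - 1) a b) ≤ C) (i l : m) :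
    l2 τ ((fourierCoeff D Y 1 - 1) i l) ≤ C := by
  have hn : (Fintype.card G : ℂ) ≠ 0 := by exact_mod_cast Fintype.card_ne_zero
  have h0 : ∑ ρ, ((D.dim ρ : ℂ) / Fintype.card G) • (D.dim ρ : ℂ) • (1 : Matrix m m A) i l
      = (1 : Matrix m m A) i l := by
    simp only [smul_smul, ← Finset.sum_smul]
    have : ∑ π, (D.dim π : ℂ) / Fintype.card G * D.dim π = 1 := by
      have := congrArg (fun x : ℝ => (x : ℂ)) (sum_dim_div_mul_dim (D := D))
      push_cast at this
      exact this
    rw [this, one_smul]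
  have h1 : (fourierCoeff D Y 1 - 1) i l
      = ∑ ρ, ((D.dim ρ : ℂ) / Fintype.card G) • ∑ r, (Y ρ - 1) (i, r) (l, r) := by
    have h2 : ∀ ρ, ∑ r, (Y ρ - 1) (i, r) (l, r)
        = ∑ r, Y ρ (i, r) (l, r) - (D.dim ρ : ℂ) • (1 : Matrix m m A) i l := fun ρ => by
      simp only [Matrix.sub_apply, Finset.sum_sub_distrib, Matrix.one_apply, Prod.mk.injEq, and_true,
        Finset.sum_const, Finset.card_univ, Fintype.card_fin, Nat.cast_smul_eq_nsmul]
    have h3 : ∀ ρ, ∑ r, ∑ s, star (D.mat ρ 1 r s) • Y ρ (i, r) (l, s)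
        = ∑ r, Y ρ (i, r) (l, r) := fun ρ => by
      refine Finset.sum_congr rfl fun r _ => ?_
      rw [D.mat_one, Finset.sum_eq_single r]
      · simp
      · intro s _ hs; simp [Matrix.one_apply_ne hs.symm]
      · simp
    simp only [h2, smul_sub, Finset.sum_sub_distrib, h0]
    rw [Matrix.sub_apply, fourierCoeff, Matrix.of_apply]
    simp only [h3]
  rw [h1]
  refine (h.l2_sum_le _ _).trans ?_
  calc ∑ ρ, l2 τ (((D.dim ρ : ℂ) / Fintype.card G) • ∑ r, (Y ρ - 1) (i, r) (l, r))
      ≤ ∑ ρ, (D.dim ρ : ℝ) / Fintype.card G * (D.dim ρ * C) := by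
        refine Finset.sum_le_sum fun ρ _ => ?_
        rw [h.l2_smul, norm_div, Complex.norm_natCast, Complex.norm_natCast]
        refine mul_le_mul_of_nonneg_left ((h.l2_sum_le _ _).trans ?_) (by positivity)
        refine (Finset.sum_le_sum fun r _ => hY ρ _ _).trans ?_
        simp
    _ = C := by
        simp only [← mul_assoc]
        rw [← Finset.sum_mul, sum_dim_div_mul_dim, one_mul]

end Estimates

/-! ### Vanishing of small cocycles -/

section Vanishing

variable {G : Type*} [Group G] [Fintype G] [DecidableEq G] {D : UnitaryDual G}
  {B : D.IntertwinerBases}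
variable {A : Type*} [Ring A] [StarRing A] [Algebra ℂ A] [StarModule ℂ A] {τ : A →ₗ[ℂ] ℂ}
variable {α : ∀ π : D.Idx, A →⋆ₐ[ℂ] Matrix (D.V π) (D.V π) A}
  {U : ∀ π ρ : D.Idx, Matrix (D.V π × D.V ρ) (D.V π × D.V ρ) A}

lemma matTrace_unitProj_mul (X : Matrix G G A) :
    matTrace τ G (unitProj G A * X) = (Fintype.card G : ℂ)⁻¹ * τ (X 1 1) := by
  rw [matTrace_apply, Finset.sum_eq_single 1]
  · simp [unitProj]
  · intro g _ hg
    simp [unitProj, Matrix.single_mul_apply_of_ne _ _ _ _ _ hg]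
  · simp

lemma isStarProjection_amp (n : Type*) [Fintype n] [DecidableEq n] {q : A}
    (hq : IsStarProjection q) : IsStarProjection (amp n q) := by
  constructor
  · rw [IsIdempotentElem, amp_mul_amp, hq.isIdempotentElem.eq]
  · exact (conjTranspose_amp q).trans (by rw [hq.isSelfAdjoint.star_eq])

namespace IsCocycleTwistedAction

variable (h : IsCocycleTwistedAction D B α U)
include h

/-- The `(1, 1)` block of `Ω_π* p Ω_π` is `u_π(1)* u_π(1)`, so the overlap of `p` with its average
is measured by the coefficients at the unit. -/
lemma average_action_unitProj :
    average h.isTrivialized.action (unitProj G A) 1 1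
      = ∑ π, ((D.dim π : ℂ) / Fintype.card G) •
        ∑ i, ∑ j, star (fourierCoeff D (U π) 1 j i) * fourierCoeff D (U π) 1 j i := by
  rw [average_apply, Matrix.sum_apply]
  refine Finset.sum_congr rfl fun π _ => ?_
  rw [Matrix.smul_apply, Matrix.sum_apply]
  congr 1
  refine Finset.sum_congr rfl fun i _ => ?_
  have h1 : blk (h.isTrivialized.action π (unitProj G A)) 1 1
      = (fourierCoeff D (U π) 1)ᴴ * fourierCoeff D (U π) 1 := by
    have hu : blk (trivializer U π) 1 1 = fourierCoeff D (U π) 1 := by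
      rw [blk_trivializer, D.mat_one, scal_one, Matrix.mul_one, inv_one, mul_one]
    rw [IsTrivialized.action_apply, liftHom_unitProj, Matrix.star_eq_conjTranspose,
      blk_mul_of_support, blk_mul_amp_unitProj, if_pos rfl, blk_conjTranspose, hu]
    intro k hk
    rw [blk_mul_amp_unitProj, if_neg hk]
  exact (congrFun (congrFun h1 i) i).trans (Matrix.mul_apply ..)

lemma trace_unitProj_sub_le (hτ : IsTracialState τ) {C : ℝ}
    (hC : ∀ π i j, l2 τ ((fourierCoeff D (U π) 1 - 1) i j) ≤ C) :
    (matTrace τ G (unitProj G A)).re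
      - (matTrace τ G (unitProj G A * average h.isTrivialized.action (unitProj G A))).re
      ≤ (Fintype.card G : ℝ)⁻¹ * (2 * C) := by
  -- With `t` the `2`-norm of the diagonal entry, `t ≥ 1 - C` and `t² ≥ 2t - 1`; no upper bound on
  -- `C` is required.
  have hdiag : ∀ π i, 1 - 2 * C ≤ l2 τ (fourierCoeff D (U π) 1 i i) ^ 2 := fun π i => by
    have h1 := hτ.l2_sub_le (fourierCoeff D (U π) 1 i i) ((fourierCoeff D (U π) 1 - 1) i i)
    rw [Matrix.sub_apply, Matrix.one_apply_eq, sub_sub_cancel, hτ.l2_one] at h1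
    have h2 := hC π i i
    rw [Matrix.sub_apply, Matrix.one_apply_eq] at h2
    nlinarith [sq_nonneg (l2 τ (fourierCoeff D (U π) 1 i i) - 1)]
  have h1 : (τ (average h.isTrivialized.action (unitProj G A) 1 1)).re
      = ∑ π, (D.dim π : ℝ) / Fintype.card G *
          ∑ i, ∑ j, l2 τ (fourierCoeff D (U π) 1 j i) ^ 2 := by
    rw [h.average_action_unitProj]
    simp only [map_sum, map_smul, ← hτ.coe_l2_sq]
    rw [Complex.re_sum]
    refine Finset.sum_congr rfl fun π _ => ?_
    rw [smul_eq_mul, ← Complex.ofReal_re ((D.dim π : ℝ) / Fintype.card G * _)]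
    congr 1
    push_cast
    rfl
  have h2 : 1 - 2 * C ≤ (τ (average h.isTrivialized.action (unitProj G A) 1 1)).re := by
    rw [h1]
    calc 1 - 2 * C = ∑ π, (D.dim π : ℝ) / Fintype.card G * (D.dim π * (1 - 2 * C)) := by
          simp only [← mul_assoc]
          rw [← Finset.sum_mul, sum_dim_div_mul_dim, one_mul]
      _ ≤ _ := by
          refine Finset.sum_le_sum fun π _ => mul_le_mul_of_nonneg_left ?_ (by positivity)
          have hle : ∑ _i : D.V π, (1 - 2 * C)
              ≤ ∑ i, ∑ j, l2 τ (fourierCoeff D (U π) 1 j i) ^ 2 :=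
            Finset.sum_le_sum fun i _ => (hdiag π i).trans
              (Finset.single_le_sum (f := fun j => l2 τ (fourierCoeff D (U π) 1 j i) ^ 2)
                (fun _ _ => sq_nonneg _) (Finset.mem_univ i))
          rwa [Finset.sum_const, Finset.card_univ, Fintype.card_fin, nsmul_eq_mul] at hle
  have h3 := matTrace_unitProj_mul (τ := τ) (1 : Matrix G G A)
  rw [mul_one, Matrix.one_apply_eq, hτ.map_one, mul_one] at h3
  have hc : ((Fintype.card G : ℂ)⁻¹) = (((Fintype.card G : ℝ)⁻¹ : ℝ) : ℂ) := by push_cast; rfl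
  rw [h3, matTrace_unitProj_mul, hc, Complex.re_ofReal_mul, Complex.ofReal_re, ← mul_one_sub]
  exact mul_le_mul_of_nonneg_left (by linarith) (by positivity)

/-- The corner is close to the corner of the trivializing unitaries. -/
lemma l2_corner_sub_le (hτ : IsTracialState τ)
    (htr : ∀ π x, matTrace τ (D.V π) (α π x) = τ x) {w : Matrix G G A}
    (hq : IsStarProjection (w * star w)) (π : D.Idx) :
    l2 (matTrace (matTrace τ G) (D.V π)) (h.isTrivialized.corner w π -
        amp (D.V π) (unitProj G A) * trivializer U π * amp (D.V π) (unitProj G A))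
      ≤ 2 * l2 (matTrace τ G) (w - unitProj G A) := by
  have hG := hτ.matTrace (n := G)
  have hV := hG.matTrace (n := D.V π)
  have hΩ := Unitary.mem_iff.1 (h.trivializer_mem_unitary π)
  have hp := isStarProjection_amp (D.V π) (isStarProjection_unitProj (G := G) (A := A))
  have hps := (isStarProjection_unitProj (G := G) (A := A)).isSelfAdjoint.star_eq
  have hl : ∀ x, l2 (matTrace (matTrace τ G) (D.V π)) (liftHom G (α π) x) = l2 (matTrace τ G) x :=
    l2_of_trace_eq (trace_liftHom (htr π))
  -- Replace `w` by `p` one side at a time. In each difference all factors except `w - p` are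
  -- unitaries, projections or partial isometries and do not increase the `2`-norm.
  have e1 : h.isTrivialized.corner w π -
        amp (D.V π) (unitProj G A) * trivializer U π * amp (D.V π) (unitProj G A)
      = liftHom G (α π) (star (w - unitProj G A)) * trivializer U π * amp (D.V π) w
        + amp (D.V π) (unitProj G A) * (trivializer U π * amp (D.V π) (w - unitProj G A)) := by
    have e2 : amp (D.V π) (w - unitProj G A) = amp (D.V π) w - amp (D.V π) (unitProj G A) := by
      simp [amp, Matrix.diagonal_sub]
    rw [IsTrivialized.corner, e2, star_sub, map_sub, hps, liftHom_unitProj]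
    noncomm_ring
  have hqa : IsStarProjection (amp (D.V π) w * star (amp (D.V π) w)) := by
    have : star (amp (D.V π) w) = amp (D.V π) (star w) := conjTranspose_amp w
    rw [this, amp_mul_amp]
    exact isStarProjection_amp _ hq
  rw [e1, two_mul]
  refine (hV.l2_add_le _ _).trans (add_le_add ?_ ?_)
  · refine (hV.l2_mul_le_of_isStarProjection hqa _).trans ?_
    rw [hV.l2_mul_of_mul_star_self hΩ.2, hl, hG.l2_star]
  · refine (hV.l2_proj_mul_le hp _).trans ?_
    rw [hV.l2_mul_of_star_mul_self hΩ.1, l2_amp]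

lemma l2_blk_corner_sub_le (hτ : IsTracialState τ)
    (htr : ∀ π x, matTrace τ (D.V π) (α π x) = τ x) {w : Matrix G G A}
    (hq : IsStarProjection (w * star w)) (π : D.Idx) (i j : D.V π) :
    l2 τ ((blk (h.isTrivialized.corner w π) 1 1 - fourierCoeff D (U π) 1) i j)
      ≤ Fintype.card G * (2 * l2 (matTrace τ G) (w - unitProj G A)) := by
  have hG := hτ.matTrace (n := G)
  set X := h.isTrivialized.corner w π -
    amp (D.V π) (unitProj G A) * trivializer U π * amp (D.V π) (unitProj G A) with hX
  have h1 : (blk (h.isTrivialized.corner w π) 1 1 - fourierCoeff D (U π) 1) i j = X i j 1 1 := by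
    have hu : fourierCoeff D (U π) 1
        = blk (amp (D.V π) (unitProj G A) * trivializer U π * amp (D.V π) (unitProj G A)) 1 1 := by
      rw [blk_mul_amp_unitProj, if_pos rfl, blk_amp_unitProj_mul, if_pos rfl, blk_trivializer,
        D.mat_one, scal_one, Matrix.mul_one, inv_one, mul_one]
    rw [hu]; rfl
  have h2 := l2_entry_le hτ (X i j) 1 1
  have h3 := l2_entry_le hG X i j
  have h4 := h.l2_corner_sub_le hτ htr hq π
  have hd : √(Fintype.card (D.V π) : ℝ) ≤ √(Fintype.card G : ℝ) := by
    rw [Fintype.card_fin]; exact Real.sqrt_le_sqrt (UnitaryDual.dim_le_card π)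
  have h5 := hG.matTrace.l2_nonneg X
  rw [h1]
  calc l2 τ (X i j 1 1) ≤ √(Fintype.card G : ℝ) * (√(Fintype.card G : ℝ) *
        (2 * l2 (matTrace τ G) (w - unitProj G A))) := by
        refine h2.trans (mul_le_mul_of_nonneg_left (h3.trans ?_) (Real.sqrt_nonneg _))
        exact mul_le_mul hd h4 h5 (Real.sqrt_nonneg _)
    _ = _ := by rw [← mul_assoc, Real.mul_self_sqrt (Nat.cast_nonneg _)]

end IsCocycleTwistedAction

end Vanishing

/-- A bound for the distance to `1` of unitaries trivializing a cocycle within `δ` of `1`, for a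
group of order `n`. -/
def vanishingBound (n : ℕ) (δ : ℝ) : ℝ :=
  n * (n * (2 * (4 * (7 * (2 * √δ) + √(7 * (2 * √δ))))) + n * δ)

lemma vanishingBound_nonneg (n : ℕ) {δ : ℝ} (hδ : 0 ≤ δ) : 0 ≤ vanishingBound n δ := by
  unfold vanishingBound; positivity

lemma tendsto_vanishingBound (n : ℕ) : Tendsto (vanishingBound n) (𝓝 0) (𝓝 0) := by
  have hc : Continuous (vanishingBound n) := by unfold vanishingBound; fun_prop
  simpa [vanishingBound] using hc.tendsto 0

/-! ### Vanishing of small cocycles in a prime tracial algebra. -/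

section Main

variable {G : Type*} [Group G] [Fintype G] [DecidableEq G] {D : UnitaryDual G}
  {B : D.IntertwinerBases}
variable {A : Type*} [CStarAlgebra A] [PartialOrder A] [StarOrderedRing A] {τ : A →ₗ[ℂ] ℂ}
variable {α : ∀ π : D.Idx, A →⋆ₐ[ℂ] Matrix (D.V π) (D.V π) A}
  {U : ∀ π ρ : D.Idx, Matrix (D.V π × D.V ρ) (D.V π × D.V ρ) A}

/-- A cocycle close to `1` is the coboundary of unitaries close to `1`. -/
theorem IsCocycleTwistedAction.exists_coboundary (h : IsCocycleTwistedAction D B α U)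
    (hτ : IsTracialWStar τ) (hprime : ∀ x y : A, (∀ a, x * a * y = 0) → x = 0 ∨ y = 0)
    (hfd : ¬ FiniteDimensional ℂ A) {δ : ℝ} (hδ : 0 ≤ δ)
    (hUδ : ∀ π ρ, norm2 τ (U π ρ - 1) ≤ δ) :
    ∃ W : ∀ π : D.Idx, Matrix (D.V π) (D.V π) A,
      (∀ π, W π ∈ unitary (Matrix (D.V π) (D.V π) A)) ∧ W D.triv = 1 ∧
      (∀ π ρ, U π ρ = coboundary D B α (fun π' => star (W π')) π ρ) ∧
      ∀ π, norm2 τ (W π - 1) ≤ vanishingBound (Fintype.card G) δ := by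
  have hτs := hτ.toIsTracialState
  have hn : (0 : ℝ) < Fintype.card G := by exact_mod_cast Fintype.card_pos
  have htr : ∀ π x, matTrace τ (D.V π) (α π x) = τ x := fun π => hτ.trace_hom hprime (α π)
  have hU1 : ∀ π ρ a b, l2 τ ((U π ρ - 1) a b) ≤ Fintype.card G * δ := fun π ρ a b => by
    have h1 := hUδ π ρ
    rw [norm2_eq_l2] at h1
    refine (l2_entry_le hτs _ a b).trans ?_
    refine mul_le_mul ?_ h1 (hτs.matTrace.l2_nonneg _) hn.le
    rw [Fintype.card_prod, Fintype.card_fin, Fintype.card_fin, Nat.cast_mul]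
    refine Real.sqrt_le_iff.2 ⟨hn.le, ?_⟩
    rw [sq]
    exact mul_le_mul (UnitaryDual.dim_le_card π) (UnitaryDual.dim_le_card ρ) (Nat.cast_nonneg _) hn.le
  have hu : ∀ π i j, l2 τ ((fourierCoeff D (U π) 1 - 1) i j) ≤ Fintype.card G * δ := fun π =>
    l2_fourierCoeff_one_sub_le hτs fun ρ => hU1 π ρ
  have hp := isStarProjection_unitProj (G := G) (A := A)
  -- The trace defect is at most `2δ`, since the weight `|G|⁻¹` of `p` cancels the factor `|G|` in
  -- the entrywise bound. Twice it is `(2√δ)²`, which is the source of `2√δ` in `vanishingBound`.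
  have hε : 2 * ((matTrace τ G (unitProj G A)).re
      - (matTrace τ G (unitProj G A * average h.isTrivialized.action (unitProj G A))).re)
      ≤ (2 * √δ) ^ 2 := by
    rw [mul_pow, Real.sq_sqrt hδ]
    have h1 := h.trace_unitProj_sub_le hτs hu
    have h2 : (Fintype.card G : ℝ)⁻¹ * (2 * (Fintype.card G * δ)) = 2 * δ := by field_simp
    linarith
  obtain ⟨w, hwp, hw, hq, hwn⟩ := exists_partialIsometry_of_action hτ hprime hfd
    h.isTrivialized.ampMap_action
    (fun π => trace_conjHom hτs.matTrace (trace_liftHom (htr π)) (h.isTrivialized.mem π))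
    h.action_triv hp (by positivity) hε
  have hqp : IsStarProjection (w * star w) := by
    constructor
    · rw [IsIdempotentElem, mul_assoc, ← mul_assoc (star w), hwp, ← mul_assoc, hw]
    · simp [IsSelfAdjoint]
  have hWu := h.blk_corner_mem_unitary hwp hw hq
  -- The corner itself satisfies `U = ∂W`; its adjoint is taken because the cocycle is to be the
  -- coboundary of `W*`.
  refine ⟨fun π => star (blk (h.isTrivialized.corner w π) 1 1), fun π => Unitary.star_mem (hWu π),
    ?_, fun π ρ => ?_, fun π => ?_⟩
  · show star (blk (h.isTrivialized.corner w D.triv) 1 1) = 1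
    rw [h.blk_corner_triv hwp hw, star_one]
  · simp only [star_star]
    exact eq_coboundary hWu (h.ampMap_blk_corner_mul hwp hw hq π ρ)
  · have hV := hτs.matTrace (n := D.V π)
    have e1 : star (blk (h.isTrivialized.corner w π) 1 1) - 1
        = star (blk (h.isTrivialized.corner w π) 1 1 - 1) := by rw [star_sub, star_one]
    rw [norm2_eq_l2, e1, hV.l2_star]
    have hent : ∀ i j, l2 τ ((blk (h.isTrivialized.corner w π) 1 1 - 1) i j)
        ≤ Fintype.card G * (2 * (4 * (7 * (2 * √δ) + √(7 * (2 * √δ))))) + Fintype.card G * δ := by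
      intro i j
      refine (hτs.l2_sub_le_sub_add_sub _ (fourierCoeff D (U π) 1 i j) _).trans
        (add_le_add ?_ (hu π i j))
      refine (h.l2_blk_corner_sub_le hτs htr hqp π i j).trans ?_
      gcongr
    refine (l2_matTrace_le hτs hent).trans ?_
    rw [vanishingBound, Fintype.card_fin]
    exact mul_le_mul_of_nonneg_right (UnitaryDual.dim_le_card π) (by positivity)

end Main

/-! ### Specialization to factors of type II₁. -/

section VonNeumann

variable {H : Type*} [NormedAddCommGroup H] [InnerProductSpace ℂ H] [CompleteSpace H]
  {M : VonNeumannAlgebra H} {τ : M.toStarSubalgebra →ₗ[ℂ] ℂ}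
variable {G : Type*} [Group G] [Fintype G] [DecidableEq G] {D : UnitaryDual G}
  {B : D.IntertwinerBases}
variable {α : ∀ π : D.Idx, M.toStarSubalgebra →⋆ₐ[ℂ] Matrix (D.V π) (D.V π) M.toStarSubalgebra}
  {U : ∀ π ρ : D.Idx, Matrix (D.V π × D.V ρ) (D.V π × D.V ρ) M.toStarSubalgebra}

theorem IsTypeIIOneFactor.exists_coboundary (hM : IsTypeIIOneFactor M)
    (hτ : IsNormalizedTrace M τ) (h : IsCocycleTwistedAction D B α U) {δ : ℝ} (hδ : 0 ≤ δ)
    (hUδ : ∀ π ρ, norm2 τ (U π ρ - 1) ≤ δ) :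
    ∃ W : ∀ π : D.Idx, Matrix (D.V π) (D.V π) M.toStarSubalgebra,
      (∀ π, W π ∈ unitary (Matrix (D.V π) (D.V π) M.toStarSubalgebra)) ∧ W D.triv = 1 ∧
      (∀ π ρ, U π ρ = coboundary D B α (fun π' => star (W π')) π ρ) ∧
      ∀ π, norm2 τ (W π - 1) ≤ vanishingBound (Fintype.card G) δ := by
  have := isClosed_vonNeumann M
  let : CStarAlgebra M.toStarSubalgebra := StarSubalgebra.cstarAlgebra _
  let : PartialOrder M.toStarSubalgebra := CStarAlgebra.spectralOrder _
  have : StarOrderedRing M.toStarSubalgebra := CStarAlgebra.spectralOrderedRing _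
  have hW : IsTracialWStar τ :=
    { hτ.isTracialState with
      faithful := hτ.faithful
      complete := fun C x hC hx => hτ.complete C x hC hx }
  exact h.exists_coboundary hW hM.prime hM.infinite hδ hUδ

end VonNeumann

end GroupDual

end

theorem mainTheorem6 {G : Type*} [Group G] [Finite G] :
    ∃ δ₀ : ℝ, 0 < δ₀ ∧ ∃ f : ℝ → ℝ, (∀ δ, 0 < δ → 0 < f δ) ∧ Tendsto f (𝓝[>] 0) (𝓝 0) ∧
      ∀ (D : GroupDual.UnitaryDual G) (B : D.IntertwinerBases)
        {H : Type*} [NormedAddCommGroup H] [InnerProductSpace ℂ H] [CompleteSpace H]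
        (M : VonNeumannAlgebra H) (_ : GroupDual.IsTypeIIOneFactor M)
        (τ : M.toStarSubalgebra →ₗ[ℂ] ℂ) (_ : GroupDual.IsNormalizedTrace M τ)
        (α : ∀ π : D.Idx,
          M.toStarSubalgebra →⋆ₐ[ℂ] Matrix (D.V π) (D.V π) M.toStarSubalgebra)
        (U : ∀ π ρ : D.Idx,
          Matrix (D.V π × D.V ρ) (D.V π × D.V ρ) M.toStarSubalgebra),
        GroupDual.IsCocycleTwistedAction D B α U → GroupDual.IsOuter D α →
        ∀ δ : ℝ, 0 < δ → δ < δ₀ → (∀ π ρ, GroupDual.norm2 τ (U π ρ - 1) < δ) →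
          ∃ W : ∀ π : D.Idx, Matrix (D.V π) (D.V π) M.toStarSubalgebra,
            (∀ π, W π ∈ unitary (Matrix (D.V π) (D.V π) M.toStarSubalgebra)) ∧
            W D.triv = 1 ∧
            (∀ π ρ, U π ρ = GroupDual.coboundary D B α (fun π' => star (W π')) π ρ) ∧
            ∀ π, GroupDual.norm2 τ (W π - 1) < f δ := by
  classical
  have := Fintype.ofFinite G
  -- The threshold `1` is arbitrary, as the bound holds for every `δ ≥ 0`. The added `|δ|` makes the
  -- final estimate strict and `f` positive.
  refine ⟨1, one_pos, fun δ => GroupDual.vanishingBound (Fintype.card G) |δ| + |δ|, fun δ hδ => ?_,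
    ?_, ?_⟩
  · exact add_pos_of_nonneg_of_pos (GroupDual.vanishingBound_nonneg _ (abs_nonneg δ))
      (abs_pos.2 hδ.ne')
  · have h1 : Tendsto (fun δ : ℝ => |δ|) (𝓝[>] 0) (𝓝 0) :=
      (by simpa using continuous_abs.tendsto (0 : ℝ) : Tendsto (fun δ : ℝ => |δ|) (𝓝 0) (𝓝 0)).mono_left
        nhdsWithin_le_nhds
    simpa using ((GroupDual.tendsto_vanishingBound (Fintype.card G)).comp h1).add h1
  · intro D B H _ _ _ M hM τ hτ α U h _ δ hδ _ hU
    obtain ⟨W, hW, hW1, hWU, hWn⟩ := hM.exists_coboundary hτ h hδ.le fun π ρ => (hU π ρ).le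
    refine ⟨W, hW, hW1, hWU, fun π => (hWn π).trans_lt ?_⟩
    simpa [abs_of_pos hδ] using hδ
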